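/- **Setting.** Let $T$ be a complete first-order theory in a language $L$, and let $\bar M\models T$ be a monster model: for some cardinal $\kappa>|L|+\aleph_0$, $\bar M$ is $\kappa$-saturated and strongly $\kappa$-homogeneous; "small" means of cardinality $<\kappa$. Assume that $T$ has NIP: for every indiscernible sequence $(a_i:i<\omega)$ of finite tuples in $\bar M$ and every formula $\varphi(x,b)$ with parameters $b$ in $\bar M$, the truth value of $\varphi(a_i,b)$ is eventually constant. **Keisler measures.** A Keisler measure $\mu(x)$ over $A\subseteq\bar M$ (where $x$ is a finite or infinite tuple of variables) is a finitely additive probability measure on the formulas $\varphi(x)$ over $A$, up to equivalence in $\bar M$. It is identified with the regular Borel probability measure on the space $S_x(A)$ of complete types over $A$ that has the same values on the clopen sets $[\varphi]$. It is global if $A=\bar M$; $\mu|A$ denotes the restriction of a global $\mu$ to formulas over $A$. A global $\mu$ is invariant over a small model $M_0\preceq\bar M$ if $\mu(\varphi(x,\sigma b))=\mu(\varphi(x,b))$ for all formulas $\varphi(x,b)$ over $\bar M$ and all $\sigma\in\mathrm{Aut}(\bar M/M_0)$. **Products.** Let $\mu(x)$ and $\lambda(y)$ be global Keisler measures, $\mu$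 invariant over some small model. Their nonforking product is the global Keisler measure $(\mu\otimes\lambda)(x,y)$ given, for a formula $\varphi(x,y)$ over any small model $N$ over which $\mu$ is invariant, by $$(\mu\otimes\lambda)(\varphi(x,y))=\int_{S_y(N)} f\,d(\lambda|N),\qquad f(\mathrm{tp}(b/N))=\mu(\varphi(x,b)).$$ Write $\mu_1\otimes\cdots\otimes\mu_n=\mu_1\otimes(\mu_2\otimes(\cdots\otimes\mu_n))$. Put $\mu^{(1)}=\mu$ and $\mu^{(n+1)}(x_1,\dots,x_{n+1})=\mu(x_{n+1})\otimes\mu^{(n)}(x_1,\dots,x_n)$, and let $\mu^{(\omega)}(x_1,x_2,\dots)$ be the union of the $\mu^{(n)}$. **Weakly random tuples.** A tuple $c$ in $\bar M$ (possibly infinite, of the same length as $x$) is weakly random for a Keisler measure $\mu(x)$ over $A$ if $\bar M\models\neg\varphi(c)$ for every formula $\varphi(x)$ over $A$ with $\mu(\varphi)=0$. **Proposition 3.8.** Let $\mu_1(y_1),\dots,\mu_n(y_n)$ be global Keisler measures in finite tuples of variables $y_1,\dots,y_n$, all invariant over a small model $M_0\preceq\bar M$. Let $B$ be a Borel subset of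 $S_{y_1\dots y_n}(M_0)$ with $\big((\mu_1\otimes\cdots\otimes\mu_n)|M_0\big)(B)=1$. Then there are sequences $I_\alpha=(b^\alpha_i:i<\omega)$ in $\bar M$, for $\alpha=1,\dots,n$, such that (i) each $I_\alpha$ is weakly random for $\mu_\alpha^{(\omega)}|M_0$; and (ii) for all $(c_1,\dots,c_n)\in I_1\times\cdots\times I_n$, $\mathrm{tp}(c_1,\dots,c_n/M_0)\in B$. -/

import Mathlib

open FirstOrder FirstOrder.Language MeasureTheory Set
open scoped NNReal ENNReal Cardinal

universe u v w

namespace Keisler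

/-! ### Borel structure on spaces of complete types -/

section TypeSpace

variable {L : FirstOrder.Language.{u, v}} {T : L.Theory} {α : Type*}

instance : MeasurableSpace (T.CompleteType α) := borel _

instance : BorelSpace (T.CompleteType α) := ⟨rfl⟩

/-- The clopen set `[φ]` of complete types containing the formula `φ`. -/
def clopen (T : L.Theory) (φ : L.Formula α) : Set (T.CompleteType α) :=
  T.typesWith (Formula.equivSentence φ)

end TypeSpace

/-! ### Keisler measures -/

/-- A Keisler measure on `M` in the language `L`, in the tuple of variables indexed by `α`
(possibly infinite): a finitely additive probability measure on the `L`-formulas in these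
variables, up to equivalence in `M`. Keisler measures over a set `A` of parameters are obtained
with the language `L[[A]]`, global ones with `L[[M]]`. -/
@[ext]
structure KeislerMeasure (L : FirstOrder.Language.{u, v}) (M : Type w) [L.Structure M] (α : Type*) where
  toFun : L.Formula α → ℝ≥0
  map_top' : toFun ⊤ = 1
  congr' : ∀ φ ψ : L.Formula α,
    (∀ c : α → M, φ.Realize c ↔ ψ.Realize c) → toFun φ = toFun ψ
  map_sup' : ∀ φ ψ : L.Formula α,
    (∀ c : α → M, ¬ (φ.Realize c ∧ ψ.Realize c)) → toFun (φ ⊔ ψ) = toFun φ + toFun ψ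

namespace KeislerMeasure

section Basic

variable {L : FirstOrder.Language.{u, v}} {M : Type w} [L.Structure M] {α β : Type*}

instance : CoeFun (KeislerMeasure L M α) (fun _ => L.Formula α → ℝ≥0) := ⟨toFun⟩

/-- The Dirac measure at a tuple `c`. -/
noncomputable def dirac (L : FirstOrder.Language.{u, v}) [L.Structure M] (c : α → M) :
    KeislerMeasure L M α where
  toFun φ := open Classical in if φ.Realize c then 1 else 0
  map_top' := if_pos (BoundedFormula.realize_top.2 trivial)
  congr' φ ψ h := by
    congr 1
    exact propext (h c)
  map_sup' φ ψ h := by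
    have h1 := h c
    have h2 : (φ ⊔ ψ).Realize c ↔ φ.Realize c ∨ ψ.Realize c := BoundedFormula.realize_sup
    by_cases h3 : φ.Realize c <;> by_cases h4 : ψ.Realize c <;> simp_all

instance [Nonempty M] : Nonempty (KeislerMeasure L M α) :=
  ⟨dirac L fun _ => Classical.arbitrary M⟩

/-- The measure in the variables `α` induced by a measure in the variables `β`, when the variable
`a : α` is substituted by the variable `g a : β`. For injective `g` it is the restriction to fewer
variables, up to a renaming of the variables. -/
def comapVar (g : α → β) (μ : KeislerMeasure L M β) : KeislerMeasure L M α where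
  toFun φ := μ (φ.relabel g)
  map_top' := by
    rw [← μ.map_top']
    exact μ.congr' _ _ fun c => by simp [Formula.realize_relabel]
  congr' φ ψ h := μ.congr' _ _ fun c => by simp [Formula.realize_relabel, h]
  map_sup' φ ψ h := by
    rw [← μ.map_sup' _ _ fun c => by simpa [Formula.realize_relabel] using h (c ∘ g)]
    exact μ.congr' _ _ fun c => by simp [Formula.realize_relabel]


theorem mem_clopen_typeOf {T : L.Theory} [Nonempty M] [M ⊨ T] (φ : L.Formula α) (c : α → M) :
    T.typeOf c ∈ clopen T φ ↔ φ.Realize c :=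
  Theory.CompleteType.formula_mem_typeOf

theorem clopen_subset_iff [Nonempty M] {φ ψ : L.Formula α} :
    clopen (L.completeTheory M) φ ⊆ clopen (L.completeTheory M) ψ ↔
      ∀ c : α → M, φ.Realize c → ψ.Realize c := by
  classical
  refine ⟨fun h c hc => ?_, fun h p hp => ?_⟩
  · rw [← mem_clopen_typeOf (T := L.completeTheory M)] at hc ⊢
    exact h hc
  · obtain ⟨N, v, rfl⟩ := Theory.exists_modelType_is_realized_in _ p
    rw [mem_clopen_typeOf] at hp ⊢
    by_contra hψ
    have h1 : (Formula.exClosure (φ ⊓ ∼ψ)).Realize N :=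
      Formula.exists_realize_equivSentence_iff_realize_exClosure.1
        ⟨v, (Formula.realize_equivSentence_symm N _ v).1 (by
          rw [Equiv.symm_apply_apply]
          exact BoundedFormula.realize_inf.2 ⟨hp, BoundedFormula.realize_not.2 hψ⟩)⟩
    rw [realize_iff_of_model_completeTheory M N] at h1
    obtain ⟨c, hc⟩ := Formula.exists_realize_equivSentence_iff_realize_exClosure.2 h1
    have h2 := (Formula.realize_equivSentence_symm M _ c).2 hc
    rw [Equiv.symm_apply_apply] at h2
    obtain ⟨h3, h4⟩ := BoundedFormula.realize_inf.1 h2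
    exact BoundedFormula.realize_not.1 h4 (h c h3)

theorem mono [Nonempty M] (μ : KeislerMeasure L M α) {φ ψ : L.Formula α}
    (h : ∀ c : α → M, φ.Realize c → ψ.Realize c) : μ φ ≤ μ ψ := by
  have h1 : μ ψ = μ (φ ⊔ (ψ ⊓ ∼φ)) := μ.congr' _ _ fun c => by
    have := h c
    simp only [Formula.Realize, BoundedFormula.realize_sup, BoundedFormula.realize_inf,
      BoundedFormula.realize_not] at *
    tauto
  rw [h1, μ.map_sup' _ _ fun c => by
    simp only [Formula.Realize, BoundedFormula.realize_inf, BoundedFormula.realize_not]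
    tauto]
  exact le_self_add

theorem sup_le [Nonempty M] (μ : KeislerMeasure L M α) (φ ψ : L.Formula α) :
    μ (φ ⊔ ψ) ≤ μ φ + μ ψ := by
  have h1 : μ (φ ⊔ ψ) = μ (φ ⊔ (ψ ⊓ ∼φ)) := μ.congr' _ _ fun c => by
    simp only [Formula.Realize, BoundedFormula.realize_sup, BoundedFormula.realize_inf,
      BoundedFormula.realize_not]
    tauto
  rw [h1, μ.map_sup' _ _ fun c => by
    simp only [Formula.Realize, BoundedFormula.realize_inf, BoundedFormula.realize_not]
    tauto]
  gcongr
  exact μ.mono fun c => by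
    simp only [Formula.Realize, BoundedFormula.realize_inf, BoundedFormula.realize_not]
    tauto

theorem clopen_sup {T : L.Theory} (φ ψ : L.Formula α) :
    clopen T (φ ⊔ ψ) = clopen T φ ∪ clopen T ψ := by
  ext p
  obtain ⟨N, v, rfl⟩ := Theory.exists_modelType_is_realized_in _ p
  simp only [mem_union, mem_clopen_typeOf]
  exact BoundedFormula.realize_sup

theorem clopen_not {T : L.Theory} (φ : L.Formula α) :
    clopen T (∼φ) = (clopen T φ)ᶜ := by
  ext p
  obtain ⟨N, v, rfl⟩ := Theory.exists_modelType_is_realized_in _ p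
  simp only [mem_compl_iff, mem_clopen_typeOf]
  exact BoundedFormula.realize_not

theorem clopen_top {T : L.Theory} : clopen T (⊤ : L.Formula α) = univ := by
  ext p
  obtain ⟨N, v, rfl⟩ := Theory.exists_modelType_is_realized_in _ p
  simp only [mem_univ, mem_clopen_typeOf, iff_true]
  exact BoundedFormula.realize_top.2 trivial

theorem isClopen_clopen {T : L.Theory} (φ : L.Formula α) : IsClopen (clopen T φ) :=
  CompleteType.isClopen_typesWith _

/-- Disjoint closed sets of types are separated by a formula. -/
theorem exists_clopen_separating {T : L.Theory} {K₁ K₂ : Set (T.CompleteType α)}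
    (h₁ : IsClosed K₁) (h₂ : IsClosed K₂) (h : Disjoint K₁ K₂) :
    ∃ χ : L.Formula α, K₁ ⊆ clopen T χ ∧ K₂ ⊆ clopen T (∼χ) := by
  classical
  have hloc : ∀ p ∈ K₁, ∃ φ : L.Formula α, p ∈ clopen T φ ∧ clopen T φ ⊆ K₂ᶜ := by
    intro p hp
    obtain ⟨_, ⟨σ, rfl⟩, hpU, hU⟩ :=
      CompleteType.isTopologicalBasis_range_typesWith.exists_subset_of_mem_open
        (h.notMem_of_mem_left hp : p ∈ K₂ᶜ) h₂.isOpen_compl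
    refine ⟨Formula.equivSentence.symm σ, ?_, ?_⟩
    · simpa [clopen] using hpU
    · simpa [clopen] using hU
  choose! f hf1 hf2 using hloc
  obtain ⟨t, ht, hcov⟩ := h₁.isCompact.elim_nhds_subcover (fun p => clopen T (f p))
    fun p hp => (isClopen_clopen (f p)).isOpen.mem_nhds (hf1 p hp)
  have hfin : ∀ s : Finset (T.CompleteType α), (∀ p ∈ s, p ∈ K₁) →
      ∃ χ : L.Formula α, clopen T χ = ⋃ p ∈ s, clopen T (f p) := by
    intro s
    induction s using Finset.induction_on with
    | empty =>
      intro _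
      refine ⟨∼⊤, ?_⟩
      rw [clopen_not, clopen_top]
      simp
    | insert a s _ ih =>
      intro hs
      obtain ⟨χ, hχ⟩ := ih fun p hp => hs p (Finset.mem_insert_of_mem hp)
      refine ⟨f a ⊔ χ, ?_⟩
      rw [clopen_sup, hχ, Finset.set_biUnion_insert]
  obtain ⟨χ, hχ⟩ := hfin t ht
  refine ⟨χ, hχ ▸ hcov, ?_⟩
  rw [clopen_not, hχ, subset_compl_comm]
  exact iUnion₂_subset fun p hp => hf2 p (ht p hp)

/-- A Keisler measure extends to a regular Borel probability measure on the type space. -/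
theorem exists_regular_extension [Nonempty M] (μ : KeislerMeasure L M α) :
    ∃ ν : Measure ((L.completeTheory M).CompleteType α), ν.Regular ∧
      ∀ φ : L.Formula α, ν (clopen (L.completeTheory M) φ) = μ φ := by
  classical
  let T := L.completeTheory M
  let I : Set (T.CompleteType α) → Set ℝ≥0 := fun K => {r | ∃ φ, K ⊆ clopen T φ ∧ μ φ = r}
  have hne : ∀ K, (I K).Nonempty := fun K => ⟨_, ⊤, by rw [clopen_top]; exact subset_univ _, rfl⟩
  have hle : ∀ K φ, K ⊆ clopen T φ → sInf (I K) ≤ μ φ := fun K φ h =>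
    csInf_le (OrderBot.bddBelow _) ⟨φ, h, rfl⟩
  have hsup : ∀ K₁ K₂, sInf (I (K₁ ∪ K₂)) ≤ sInf (I K₁) + sInf (I K₂) := by
    intro K₁ K₂
    refine le_of_forall_pos_le_add fun ε hε => ?_
    obtain ⟨_, ⟨φ, hφ, rfl⟩, h1⟩ := exists_lt_of_csInf_lt (hne K₁)
      (lt_add_of_pos_right _ (half_pos hε))
    obtain ⟨_, ⟨ψ, hψ, rfl⟩, h2⟩ := exists_lt_of_csInf_lt (hne K₂)
      (lt_add_of_pos_right _ (half_pos hε))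
    calc sInf (I (K₁ ∪ K₂)) ≤ μ (φ ⊔ ψ) := hle _ _ (by
          rw [clopen_sup]; exact union_subset_union hφ hψ)
      _ ≤ μ φ + μ ψ := μ.sup_le φ ψ
      _ ≤ (sInf (I K₁) + ε / 2) + (sInf (I K₂) + ε / 2) := add_le_add h1.le h2.le
      _ = sInf (I K₁) + sInf (I K₂) + ε := by rw [add_add_add_comm, add_halves]
  let C : Content (T.CompleteType α) :=
    { toFun := fun K => sInf (I K)
      mono' := fun K₁ K₂ h => le_csInf (hne _) fun _ ⟨φ, hφ, hr⟩ => hr ▸ hle _ _ (h.trans hφ)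
      sup_disjoint' := by
        intro K₁ K₂ h h₁ h₂
        refine le_antisymm (hsup _ _) (le_csInf (hne _) ?_)
        rintro _ ⟨φ, hφ, rfl⟩
        obtain ⟨χ, hχ1, hχ2⟩ := exists_clopen_separating h₁ h₂ h
        have hinf : ∀ ψ : L.Formula α, clopen T (φ ⊓ ψ) = clopen T φ ∩ clopen T ψ := by
          intro ψ
          ext p
          obtain ⟨N, v, rfl⟩ := Theory.exists_modelType_is_realized_in _ p
          simp only [mem_inter_iff, mem_clopen_typeOf]
          exact BoundedFormula.realize_inf
        have e : μ φ = μ (φ ⊓ χ) + μ (φ ⊓ ∼χ) := by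
          rw [← μ.map_sup']
          · refine μ.congr' _ _ fun c => ?_
            simp only [Formula.Realize, BoundedFormula.realize_sup, BoundedFormula.realize_inf,
              BoundedFormula.realize_not]
            tauto
          · intro c
            simp only [Formula.Realize, BoundedFormula.realize_inf, BoundedFormula.realize_not]
            tauto
        rw [e]
        refine add_le_add (hle _ _ ?_) (hle _ _ ?_)
        · rw [hinf]
          exact subset_inter ((subset_union_left).trans hφ) hχ1
        · rw [hinf]
          exact subset_inter ((subset_union_right).trans hφ) hχ2
      sup_le' := fun K₁ K₂ => hsup K₁ K₂ }
  refine ⟨C.measure, inferInstance, fun φ => ?_⟩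
  have hφ := isClopen_clopen (T := T) φ
  rw [C.measure_apply hφ.isOpen.measurableSet, C.outerMeasure_of_isOpen _ hφ.isOpen,
    C.innerContent_of_isCompact hφ.isClosed.isCompact hφ.isOpen]
  refine congrArg ENNReal.ofNNReal (le_antisymm (hle _ _ Subset.rfl) (le_csInf (hne _) ?_))
  rintro _ ⟨ψ, hψ, rfl⟩
  exact μ.mono (clopen_subset_iff.1 hψ)

/-- The regular Borel probability measure on the space of complete types corresponding to a
Keisler measure: the (unique) regular Borel measure `ν` with `ν [φ] = μ φ` for all formulas. -/
noncomputable def borelMeasure [Nonempty M] (μ : KeislerMeasure L M α) :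
    Measure ((L.completeTheory M).CompleteType α) :=
  μ.exists_regular_extension.choose

end Basic

end KeislerMeasure

/-! ### The monster model and NIP -/

section Monster

variable (L : FirstOrder.Language.{u, v}) (M : Type w) [L.Structure M]

/-- `M` is a monster model, "small" meaning "of cardinality less than `κ`": `κ` is larger than
`ℵ₀` and the cardinality of the language, `M` is `κ`-saturated and strongly `κ`-homogeneous. -/
structure IsMonster [Nonempty M] (κ : Cardinal.{w}) : Prop where
  aleph0_lt : ℵ₀ < κ
  card_language_lt : Cardinal.lift.{w} L.card < Cardinal.lift.{max u v} κ
  saturated : ∀ A : Set M, #A < κ → ∀ (k : ℕ) (p : (L[[A]].completeTheory M).CompleteType (Fin k)),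
    ∃ c : Fin k → M, (L[[A]].completeTheory M).typeOf c = p
  homogeneous : ∀ A : Set M, #A < κ → ∀ f : A → M,
    (∀ φ : L.Formula A, φ.Realize (fun a : A => (a : M)) ↔ φ.Realize f) →
      ∃ σ : M ≃[L] M, ∀ a : A, σ a = f a

variable {M} in
/-- The sequence `(a i : i < ω)` of `k`-tuples is indiscernible (over `∅`). -/
def IsIndiscernible {k : ℕ} (a : ℕ → Fin k → M) : Prop :=
  ∀ (n : ℕ) (s t : Fin n ↪o ℕ) (φ : L.Formula (Fin n × Fin k)),
    φ.Realize (fun p => a (s p.1) p.2) ↔ φ.Realize (fun p => a (t p.1) p.2)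

/-- NIP, for the theory of a monster model `M`: for every indiscernible sequence `(a i : i < ω)` and
every formula `φ(x, b)`, the truth value of `φ(a i, b)` is eventually constant. -/
def IsNIP : Prop :=
  ∀ (k l : ℕ) (a : ℕ → Fin k → M), IsIndiscernible L a →
    ∀ (φ : L.Formula (Fin k ⊕ Fin l)) (b : Fin l → M),
      ∃ m : ℕ, (∀ i ≥ m, φ.Realize (Sum.elim (a i) b)) ∨ (∀ i ≥ m, ¬ φ.Realize (Sum.elim (a i) b))

end Monster

namespace KeislerMeasure

variable {L : FirstOrder.Language.{u, v}} {M : Type w} [L.Structure M] {α β : Type*}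

/-- A formula over a set `A` of parameters, as a formula over `M`. -/
def toGlobal (A : Set M) (φ : L[[A]].Formula α) : L[[M]].Formula α :=
  (L.lhomWithConstantsMap (fun a : A => (a : M))).onFormula φ

/-- The instance `φ(x, b)` of a formula `φ(x, y)` over `M`. -/
def instantiate (φ : L[[M]].Formula (α ⊕ β)) (b : β → M) : L[[M]].Formula α :=
  φ.subst (Sum.elim Term.var fun j => (L.con (b j)).term)

/-- The image of a formula over `M` under an automorphism of `M`, acting on the parameters. -/
def smulFormula (σ : M ≃[L] M) (φ : L[[M]].Formula α) : L[[M]].Formula α :=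
  (L.lhomWithConstantsMap σ).onFormula φ

theorem realize_toGlobal (A : Set M) (φ : L[[A]].Formula α) (c : α → M) :
    (toGlobal A φ).Realize c ↔ φ.Realize c := by
  have : (LHom.constantsOnMap (fun a : A => (a : M))).IsExpansionOn M :=
    constantsOnMap_isExpansionOn rfl
  have : (L.lhomWithConstantsMap (fun a : A => (a : M))).IsExpansionOn M :=
    LHom.sumMap_isExpansionOn _ _ _
  exact LHom.realize_onFormula _ φ

/-- The restriction `μ|A` of a global Keisler measure to a set `A` of parameters. -/
def restrict (μ : KeislerMeasure L[[M]] M α) (A : Set M) : KeislerMeasure L[[A]] M α where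
  toFun φ := μ (toGlobal A φ)
  map_top' := by
    rw [← μ.map_top']
    exact μ.congr' _ _ fun c => by
      rw [realize_toGlobal]
      simp only [Formula.Realize, BoundedFormula.realize_top]
  congr' φ ψ h := μ.congr' _ _ fun c => by simp only [realize_toGlobal, h]
  map_sup' φ ψ h := by
    rw [← μ.map_sup' _ _ fun c => by simpa only [realize_toGlobal] using h c]
    exact μ.congr' _ _ fun c => by
      have h1 := realize_toGlobal A φ c
      have h2 := realize_toGlobal A ψ c
      rw [realize_toGlobal]
      simp only [Formula.Realize, BoundedFormula.realize_sup] at *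
      rw [h1, h2]

/-- The global Keisler measure `μ` is `Aut(M/A)`-invariant. -/
def IsInvariant (μ : KeislerMeasure L[[M]] M α) (A : Set M) : Prop :=
  ∀ σ : M ≃[L] M, (∀ a ∈ A, σ a = a) → ∀ φ : L[[M]].Formula α, μ (smulFormula σ φ) = μ φ

variable [Nonempty M]

/-- For a global measure `μ(x)` that is `Aut(M/A)`-invariant and a formula `φ(x, y)` over `A`, the
function on the space of complete types over `A` in the variables `y` which takes `tp(b/A)` to
`μ(φ(x, b))` (it takes the value `0` at types that are not realized in `M`). -/
noncomputable def schema (A : Set M) (μ : KeislerMeasure L[[M]] M α)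
    (φ : L[[A]].Formula (α ⊕ β)) : (L[[A]].completeTheory M).CompleteType β → ℝ≥0 :=
  Function.extend (fun b : β → M => (L[[A]].completeTheory M).typeOf b)
    (fun b => μ (instantiate (toGlobal A φ) b)) 0

/-- `ω(x, y)` is the nonforking product of the global measures `μ(x)` and `ν(y)`: for every small
model `N` over which `μ` is invariant and every formula `φ(x, y)` over `N`,
`ω(φ(x, y))` is the integral of `tp(b/N) ↦ μ(φ(x, b))` with respect to `ν|N`. -/
def IsProd (κ : Cardinal.{w}) (μ : KeislerMeasure L[[M]] M α) (ν : KeislerMeasure L[[M]] M β)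
    (ω : KeislerMeasure L[[M]] M (α ⊕ β)) : Prop :=
  ∀ N : L.ElementarySubstructure M, #N < κ → μ.IsInvariant (N : Set M) →
    ∀ φ : L[[(N : Set M)]].Formula (α ⊕ β),
      (ω.restrict (N : Set M) φ : ℝ≥0∞) =
        ∫⁻ q, (schema (N : Set M) μ φ q : ℝ≥0∞) ∂(ν.restrict (N : Set M)).borelMeasure

/-- The nonforking product `μ ⊗ ν` of global Keisler measures, `μ` being invariant (over some small
model); it is determined by `IsProd`. -/
noncomputable def prod (κ : Cardinal.{w}) (μ : KeislerMeasure L[[M]] M α)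
    (ν : KeislerMeasure L[[M]] M β) : KeislerMeasure L[[M]] M (α ⊕ β) :=
  Classical.epsilon (IsProd κ μ ν)

/-- The product `μ₁ ⊗ (μ₂ ⊗ (⋯ ⊗ μₙ))` of global Keisler measures in tuples of variables of
lengths `m 1, …, m n`. (The product of no measures is the measure in no variables.) -/
noncomputable def prodFin (κ : Cardinal.{w}) : ∀ (n : ℕ) (m : Fin n → ℕ),
    (∀ i, KeislerMeasure L[[M]] M (Fin (m i))) → KeislerMeasure L[[M]] M (Σ i, Fin (m i))
  | 0, _, _ => dirac L[[M]] fun p => p.1.elim0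
  | n + 1, m, μ =>
    (prod κ (μ 0) (prodFin κ n (fun i => m i.succ) fun i => μ i.succ)).comapVar fun p =>
      Fin.cases (motive := fun i => Fin (m i) → Fin (m 0) ⊕ (Σ i : Fin n, Fin (m i.succ)))
        (fun a => Sum.inl a) (fun i a => Sum.inr ⟨i, a⟩) p.1 p.2

/-- The power `μ⁽ⁿ⁾` in the variables `(x₀, …, xₙ₋₁)`, each a tuple indexed by `α`:
`μ⁽ⁿ⁺¹⁾(x₀, …, xₙ) = μ(xₙ) ⊗ μ⁽ⁿ⁾(x₀, …, xₙ₋₁)`. -/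
noncomputable def power (κ : Cardinal.{w}) (μ : KeislerMeasure L[[M]] M α) :
    ∀ n : ℕ, KeislerMeasure L[[M]] M (Fin n × α)
  | 0 => dirac L[[M]] fun p => p.1.elim0
  | n + 1 =>
    (prod κ μ (power κ μ n)).comapVar fun p =>
      Fin.lastCases (motive := fun _ => α ⊕ (Fin n × α)) (Sum.inl p.2) (fun i => Sum.inr (i, p.2))
        p.1

/-- The Morley sequence measure `μ⁽ω⁾`, the union of the powers `μ⁽ⁿ⁾`: the Keisler measure in the
variables `(x₀, x₁, …)` whose restriction to `(x₀, …, xₙ₋₁)` is `μ⁽ⁿ⁾` for all `n`. -/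
noncomputable def powerOmega (κ : Cardinal.{w}) (μ : KeislerMeasure L[[M]] M α) :
    KeislerMeasure L[[M]] M (ℕ × α) :=
  Classical.epsilon fun ω => ∀ n : ℕ,
    ω.comapVar (fun p : Fin n × α => ((p.1 : ℕ), p.2)) = power κ μ n

/-- The tuple `c` is weakly random for the Keisler measure `μ` (over the parameters in the
language of `μ`): it satisfies no formula of `μ`-measure `0`. -/
def IsWeaklyRandom (μ : KeislerMeasure L M α) (c : α → M) : Prop :=
  ∀ φ : L.Formula α, μ φ = 0 → ¬ φ.Realize c

end KeislerMeasure
end Keisler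

/-!
The sequences `I₁, …, Iₙ` are found together, as a tuple realizing a random type for a single
measure. There is a global Keisler measure `Ω` in the variables `y_i^α` (`i < ω`, `α = 1, …, n`)
whose restriction to `y_0^α, y_1^α, …` is `μ_α⁽ω⁾` for each `α`, and whose restriction to
`y_{i(1)}^1, …, y_{i(n)}^n` is `μ₁ ⊗ ⋯ ⊗ μₙ` for each choice of `i(1), …, i(n)`
(`exists_comapVar_eq_powerOmega_and_prodFin`). With finitely many variables, it is the product in
which all copies of `μₙ` come innermost, then those of `μₙ₋₁`, and so on up to those of `μ₁`; its
restrictions are computed from two rules, that `μ ⊗ ν` restricts to `ν` and that forming `μ ⊗ ν`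
commutes with substitutions in the variables of `ν`. With infinitely many variables, it is a limit
of these along an ultrafilter. For the Borel measure of `Ω|M₀`, almost all types have the
countably many restrictions to `y_{i(1)}^1, …, y_{i(n)}^n` in `B`, and by regularity almost all
types contain no null formula at all (`ae_forall_notMem_clopen`). By saturation, any type with
both properties is realized, and its realization consists of the sequences wanted.

The products, defined by an integral condition, have to be shown to exist, which is where NIP
enters: the functions `tp(b/N) ↦ μ(φ(x, b))` have to be Borel (`IsInvariant.measurable_schema`).
This is proved in four steps.

* By NIP, the number of alternations of a formula along an indiscernible sequence is bounded
  (`IsNIP.exists_not_alternating`), and a definable family of sets has finite VC dimension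
  (`IsNIP.exists_not_shattered`).
* A global type in the support of a measure invariant over `N` is invariant over `N`
  (`InSupport.invOver`).
* A global type `p` invariant over `N` is Borel definable (`InvOver.measurableSet_fiber_mem`):
  whether `φ(x, b)` belongs to `p` can be read off from the longest tuple of the type of a Morley
  sequence of `p` along which `φ(x, b)` alternates.
* By the VC theorem (`exists_sample`), `μ(φ(x, b))` is a uniform limit in `b` of averages over
  finitely many types in the support of `μ` (`exists_average`).

Then the integral over the types over a small model can be replaced by an integral over the global
types, which does not depend on the model (`lintegral_schema_eq`), and additivity is that of the
integral (`exists_isProd`).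

Definable sets of tuples are used in place of formulas, and global types are represented by
ultrafilters on the set of tuples, of which only the definable members matter.
-/

namespace Keisler

/-! ### Types of finite tuples, in terms of definable sets -/

section TupleTypes

variable {L : FirstOrder.Language.{u, v}} {M : Type w} [L.Structure M] {α β γ : Type*} {A B : Set M}

/-- The fiber `{a | (a, b) ∈ s}` of a set of pairs of tuples over the tuple `b`. -/
def fiber (s : Set (α ⊕ β → M)) (b : β → M) : Set (α → M) := {a | Sum.elim a b ∈ s}

@[simp]
theorem mem_fiber {s : Set (α ⊕ β → M)} {b : β → M} {a : α → M} :
    a ∈ fiber s b ↔ Sum.elim a b ∈ s := Iff.rfl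

theorem definable_fiber {s : Set (α ⊕ β → M)} (hs : A.Definable L s) {b : β → M}
    (hAB : A ⊆ B) (hb : range b ⊆ B) : B.Definable L (fiber s b) := by
  rw [definable_iff_exists_formula_sum] at hs ⊢
  obtain ⟨φ, rfl⟩ := hs
  refine ⟨φ.relabel (Sum.elim (fun a : A => Sum.inl ⟨a, hAB a.2⟩) (Sum.elim Sum.inr
    fun j => Sum.inl ⟨b j, hb ⟨j, rfl⟩⟩)), ?_⟩
  ext a
  simp only [mem_fiber, mem_ofPred_eq, Formula.realize_relabel]
  have h : Sum.elim (fun x : B => (x : M)) a ∘ Sum.elim (fun x : A => Sum.inl ⟨x, hAB x.2⟩)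
      (Sum.elim Sum.inr fun j => Sum.inl ⟨b j, hb ⟨j, rfl⟩⟩) =
        Sum.elim (fun x : A => (x : M)) (Sum.elim a b) := by
    funext x
    rcases x with x | x | x <;> rfl
  rw [h]

theorem definable_fiber_left {s : Set (α ⊕ β → M)} (hs : A.Definable L s) {a : α → M}
    (hAB : A ⊆ B) (ha : range a ⊆ B) : B.Definable L {b | Sum.elim a b ∈ s} := by
  have := definable_fiber (hs.preimage_comp (Sum.swap : α ⊕ β → β ⊕ α)) hAB ha
  convert this using 1
  ext b
  simp [fiber, Sum.elim_swap]

variable (L) in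
/-- The tuples `a` and `b` have the same type over `A`. -/
def TpEq (A : Set M) (a b : α → M) : Prop :=
  ∀ D : Set (α → M), A.Definable L D → (a ∈ D ↔ b ∈ D)

theorem TpEq.refl (A : Set M) (a : α → M) : TpEq L A a a := fun _ _ => Iff.rfl

theorem TpEq.symm {a b : α → M} (h : TpEq L A a b) : TpEq L A b a := fun D hD => (h D hD).symm

theorem TpEq.trans {a b c : α → M} (h : TpEq L A a b) (h' : TpEq L A b c) : TpEq L A a c :=
  fun D hD => (h D hD).trans (h' D hD)

theorem TpEq.mono {a b : α → M} (h : TpEq L B a b) (hAB : A ⊆ B) : TpEq L A a b :=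
  fun D hD => h D (hD.mono hAB)

theorem TpEq.comp {a b : α → M} (h : TpEq L A a b) (f : β → α) : TpEq L A (a ∘ f) (b ∘ f) :=
  fun _ hD => h _ (hD.preimage_comp f)

theorem tpEq_of_imp {a b : α → M} (h : ∀ D : Set (α → M), A.Definable L D → a ∈ D → b ∈ D) :
    TpEq L A a b :=
  fun D hD => ⟨h D hD, fun hb => by_contra fun ha => h Dᶜ hD.compl ha hb⟩

/-- Equalities between entries of `a` and elements of `A` are part of the type of `a` over `A`. -/
theorem TpEq.elim_eq {a b : α → M} (h : TpEq L A a b) (x y : A ⊕ α)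
    (hxy : Sum.elim (↑) a x = (Sum.elim (↑) a y : M)) :
    (Sum.elim (↑) b x : M) = Sum.elim (↑) b y := by
  have hD : A.Definable L {v : α → M | (Sum.elim (↑) v x : M) = Sum.elim (↑) v y} :=
    definable_iff_exists_formula_sum.2 ⟨(Term.var x).equal (Term.var y), by ext; simp⟩
  exact (h _ hD).1 hxy

variable [Nonempty M] {κ : Cardinal.{w}}

theorem IsMonster.mk_union_range_lt (hM : IsMonster L M κ) (hA : #A < κ) [Finite β] (b : β → M) :
    #(A ∪ range b : Set M) < κ :=
  (Cardinal.mk_union_le _ _).trans_lt (Cardinal.add_lt_of_lt hM.aleph0_lt.le hA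
    ((Cardinal.lt_aleph0_of_finite _).trans hM.aleph0_lt))

theorem IsMonster.mk_union_lt (hM : IsMonster L M κ) (hA : #A < κ) (hB : #B < κ) :
    #(A ∪ B : Set M) < κ :=
  (Cardinal.mk_union_le _ _).trans_lt (Cardinal.add_lt_of_lt hM.aleph0_lt.le hA hB)

/-- Homogeneity: finite tuples of the same type over a small set `A` are conjugate by an
automorphism over `A`. -/
theorem IsMonster.exists_equiv_of_tpEq (hM : IsMonster L M κ) (hA : #A < κ) [Finite β]
    {b b' : β → M} (h : TpEq L A b b') :
    ∃ σ : M ≃[L] M, (∀ a ∈ A, σ a = a) ∧ ∀ j, σ (b j) = b' j := by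
  classical
  have hg : ∀ x : (A ∪ range b : Set M), ∃ y : A ⊕ β, (Sum.elim (↑) b y : M) = x := by
    rintro ⟨x, hx | ⟨j, rfl⟩⟩
    · exact ⟨Sum.inl ⟨x, hx⟩, rfl⟩
    · exact ⟨Sum.inr j, rfl⟩
  choose g hg using hg
  obtain ⟨σ, hσ⟩ := hM.homogeneous (A ∪ range b) (hM.mk_union_range_lt hA b)
    (fun x => Sum.elim (↑) b' (g x)) (by
      intro φ
      have h1 := h {v | (φ.relabel g).Realize (Sum.elim (↑) v)}
        (definable_iff_exists_formula_sum.2 ⟨_, rfl⟩)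
      simp only [mem_ofPred_eq, Formula.realize_relabel] at h1
      have h2 : Sum.elim (↑) b ∘ g = fun x : (A ∪ range b : Set M) => (x : M) := funext hg
      rw [h2] at h1
      exact h1)
  refine ⟨σ, fun a ha => ?_, fun j => ?_⟩
  · have h1 := hσ ⟨a, Or.inl ha⟩
    rw [h1]
    exact h.elim_eq _ (Sum.inl ⟨a, ha⟩) (hg _)
  · have h1 := hσ ⟨b j, Or.inr ⟨j, rfl⟩⟩
    rw [h1]
    exact h.elim_eq _ (Sum.inr j) (hg _)

/-- Saturation: over a small set of parameters, the definable sets in a proper filter on the finite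
tuples have a common element. -/
theorem IsMonster.exists_mem_of_filter (hM : IsMonster L M κ) (hA : #A < κ) [Finite β]
    (f : Filter (β → M)) [f.NeBot] : ∃ c, ∀ D ∈ f, A.Definable L D → c ∈ D := by
  obtain ⟨k, ⟨e⟩⟩ := Finite.exists_equiv_fin β
  let T := L[[A]].completeTheory M
  obtain ⟨p, hp⟩ := exists_clusterPt_of_compactSpace
    (f.map fun c : β → M => T.typeOf (c ∘ e.symm))
  obtain ⟨c, hc⟩ := hM.saturated A hA k p
  refine ⟨c ∘ e, ?_⟩
  rintro _ hDf ⟨φ, rfl⟩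
  have h1 : clopen T (φ.relabel e) ∈ f.map fun c : β → M => T.typeOf (c ∘ e.symm) := by
    rw [Filter.mem_map]
    filter_upwards [hDf] with x hx
    rw [mem_preimage, KeislerMeasure.mem_clopen_typeOf, Formula.realize_relabel]
    simpa [Function.comp_assoc] using hx
  have h3 : p ∈ clopen T (φ.relabel e) :=
    isClosed_iff_clusterPt.1 (KeislerMeasure.isClopen_clopen _).isClosed p
      (hp.mono (Filter.le_principal_iff.2 h1))
  rw [← hc] at h3
  exact Formula.realize_relabel.1 ((KeislerMeasure.mem_clopen_typeOf _ _).1 h3)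

theorem exists_filter_of_inter {X : Type*} (F : Set (Set X)) (hne : ∀ D ∈ F, D.Nonempty)
    (hF : F.Nonempty) (hinter : ∀ D ∈ F, ∀ E ∈ F, D ∩ E ∈ F) :
    ∃ f : Filter X, f.NeBot ∧ ∀ D ∈ F, D ∈ f := by
  let f : Filter X :=
    { sets := {s | ∃ D ∈ F, D ⊆ s}
      univ_sets := ⟨_, hF.some_mem, subset_univ _⟩
      sets_of_superset := fun ⟨D, hD, hs⟩ hst => ⟨D, hD, hs.trans hst⟩
      inter_sets := fun ⟨D, hD, hs⟩ ⟨E, hE, ht⟩ =>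
        ⟨D ∩ E, hinter D hD E hE, inter_subset_inter hs ht⟩ }
  refine ⟨f, ?_, fun D hD => ⟨D, hD, Subset.rfl⟩⟩
  rw [Filter.neBot_iff]
  intro h
  obtain ⟨D, hD, hs⟩ : ∅ ∈ f := by rw [h]; trivial
  exact (hne D hD).ne_empty (subset_empty_iff.1 hs)

/-- Saturation, for a family of definable sets that is closed under intersections. -/
theorem IsMonster.exists_mem_of_inter (hM : IsMonster L M κ) (hA : #A < κ) [Finite β]
    (F : Set (Set (β → M))) (hdef : ∀ D ∈ F, A.Definable L D) (hne : ∀ D ∈ F, D.Nonempty)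
    (hF : F.Nonempty) (hinter : ∀ D ∈ F, ∀ E ∈ F, D ∩ E ∈ F) : ∃ c, ∀ D ∈ F, c ∈ D := by
  obtain ⟨f, _, hf⟩ := exists_filter_of_inter F hne hF hinter
  obtain ⟨c, hc⟩ := hM.exists_mem_of_filter hA f
  exact ⟨c, fun D hD => hc D (hf D hD) (hdef D hD)⟩

end TupleTypes

theorem exists_seq_of_forall_fin {X : Type*} (R : ∀ n : ℕ, (Fin n → X) → X → Prop)
    (h : ∀ n v, ∃ x, R n v x) : ∃ a : ℕ → X, ∀ n, R n (fun i => a i) (a n) := by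
  choose F hF using h
  let a : ℕ → X := fun n => Nat.strongRec (fun n ih => F n fun i => ih i i.2) n
  refine ⟨a, fun n => ?_⟩
  have : a n = F n fun i => a i := by
    simp only [a]
    rw [Nat.strongRec_eq]
  rw [this]
  exact hF _ _

theorem realize_iff_of_eqOn_freeVar {L : FirstOrder.Language.{u, v}} {M : Type w} [L.Structure M]
    {α : Type*} [DecidableEq α] (φ : L.Formula α) {v v' : α → M}
    (h : ∀ a ∈ φ.freeVarFinset, v a = v' a) : φ.Realize v ↔ φ.Realize v' := by
  have h1 := BoundedFormula.realize_restrictFreeVar (φ := φ) (f := id) (xs := default)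
    (v := fun a => v a) v (fun _ => rfl)
  have h2 := BoundedFormula.realize_restrictFreeVar (φ := φ) (f := id) (xs := default)
    (v := fun a => v a) v' (fun a => h a a.2)
  exact h1.symm.trans h2

theorem exists_forall_freeVar_lt {L : FirstOrder.Language.{u, v}} (φ : L.Formula ℕ) :
    ∃ k, ∀ a ∈ φ.freeVarFinset, a < k :=
  ⟨φ.freeVarFinset.sup id + 1, fun _ ha => Nat.lt_succ_of_le (Finset.le_sup (f := id) ha)⟩

section CountableTuples

variable {L : FirstOrder.Language.{u, v}} {M : Type w} [L.Structure M] {A : Set M}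
  [Nonempty M] {κ : Cardinal.{w}}

theorem IsMonster.exists_mem_of_filter_nat (hM : IsMonster L M κ) (hA : #A < κ)
    (f : Filter (ℕ → M)) [f.NeBot] : ∃ c, ∀ D ∈ f, A.Definable L D → c ∈ D := by
  -- Coordinates are chosen one at a time, keeping the type of the initial segment correct.
  let Good : ∀ k : ℕ, (Fin k → M) → Prop := fun k v =>
    ∀ D : Set (Fin k → M), A.Definable L D → {x : ℕ → M | (fun i : Fin k => x i) ∈ D} ∈ f → v ∈ D
  have hstep : ∀ k v, ∃ x, Good k v → Good (k + 1) (Fin.snoc v x) := by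
    intro k v
    by_cases hv : Good k v
    swap
    · exact ⟨Classical.arbitrary M, fun h => (hv h).elim⟩
    let F : Set (Set (Fin 1 → M)) := {E | ∃ D : Set (Fin k ⊕ Fin 1 → M), A.Definable L D ∧
      {x : ℕ → M | Sum.elim (fun i : Fin k => x i) (fun _ => x k) ∈ D} ∈ f ∧
      E = {y | Sum.elim v y ∈ D}}
    obtain ⟨y, hy⟩ := hM.exists_mem_of_inter (hM.mk_union_range_lt hA v) F
      (by
        rintro _ ⟨D, hD, -, rfl⟩
        exact definable_fiber_left hD subset_union_left subset_union_right)
      (by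
        rintro _ ⟨D, hD, hDf, rfl⟩
        refine hv _ hD.exists_of_finite ?_
        filter_upwards [hDf] with x hx using ⟨_, hx⟩)
      ⟨_, univ, definable_univ, by simp, rfl⟩
      (by
        rintro _ ⟨D, hD, hDf, rfl⟩ _ ⟨E, hE, hEf, rfl⟩
        exact ⟨D ∩ E, hD.inter hE, by filter_upwards [hDf, hEf] with x h1 h2 using ⟨h1, h2⟩, rfl⟩)
    refine ⟨y 0, fun _ D hD hDf => ?_⟩
    let g : Fin (k + 1) → Fin k ⊕ Fin 1 := Fin.lastCases (Sum.inr 0) Sum.inl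
    have hg : ∀ (v : Fin k → M) (z : Fin 1 → M), Sum.elim v z ∘ g = Fin.snoc v (z 0) := by
      intro v z
      funext i
      refine Fin.lastCases ?_ (fun i => ?_) i <;> simp [g]
    have h1 := hy _ ⟨_, hD.preimage_comp g, by
      filter_upwards [hDf] with x hx
      rw [mem_preimage, hg]
      convert hx using 1
      funext i
      refine Fin.lastCases ?_ (fun i => ?_) i <;> simp, rfl⟩
    rwa [mem_ofPred_eq, mem_preimage, hg] at h1
  obtain ⟨c, hc⟩ := exists_seq_of_forall_fin _ hstep
  have hgood : ∀ k, Good k fun i => c i := by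
    intro k
    induction k with
    | zero =>
      intro D _ hDf
      obtain ⟨x, hx⟩ := Filter.nonempty_of_mem hDf
      rw [mem_ofPred_eq] at hx
      convert hx
    | succ k ih =>
      convert hc k ih using 1
      funext i
      refine Fin.lastCases ?_ (fun i => ?_) i <;> simp
  refine ⟨c, ?_⟩
  rintro _ hDf ⟨φ, rfl⟩
  obtain ⟨k, hk⟩ := exists_forall_freeVar_lt φ
  have hiff : ∀ x : ℕ → M, φ.Realize (fun n => x (min n k)) ↔ φ.Realize x := fun x =>
    realize_iff_of_eqOn_freeVar φ fun a ha => by rw [min_eq_left (hk a ha).le]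
  have h1 := hgood (k + 1) {v | φ.Realize fun n => v ⟨min n k, by omega⟩}
    ⟨φ.relabel fun n => (⟨min n k, by omega⟩ : Fin (k + 1)), by
      ext v; simp only [mem_ofPred_eq, Formula.realize_relabel]; rfl⟩
    (by filter_upwards [hDf] with x hx using (hiff x).2 hx)
  exact (hiff c).1 h1

/-- Saturation for countable tuples: over a small set of parameters, the definable sets in a proper
filter on the tuples have a common element. -/
theorem IsMonster.exists_mem_of_filter_countable (hM : IsMonster L M κ) (hA : #A < κ) {ι : Type*}
    [Countable ι] (f : Filter (ι → M)) [f.NeBot] : ∃ c, ∀ D ∈ f, A.Definable L D → c ∈ D := by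
  rcases isEmpty_or_nonempty ι with h | h
  · exact hM.exists_mem_of_filter hA f
  obtain ⟨g, hg⟩ := exists_surjective_nat ι
  obtain ⟨c, hc⟩ := hM.exists_mem_of_filter_nat hA (f.map fun x : ι → M => x ∘ g)
  refine ⟨c ∘ Function.surjInv hg, fun D hDf hD => ?_⟩
  refine hc _ ?_ (hD.preimage_comp (Function.surjInv hg))
  rw [Filter.mem_map]
  filter_upwards [hDf] with x hx
  simpa [Function.comp_assoc, Function.surjInv_eq hg, Function.comp_def] using hx

end CountableTuples

/-! ### Invariant types and Morley sequences -/

section Morley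

variable {L : FirstOrder.Language.{u, v}} {M : Type w} [L.Structure M] {α β γ : Type*} {A B : Set M}
  {p : Ultrafilter (α → M)}

variable (L) in
/-- The global type given by the definable sets in the ultrafilter `p` is invariant over `A`:
whether it contains the instance `s(x, b)` of a relation over `A` depends only on the type of `b`
over `A`. -/
def InvOver (A : Set M) (p : Ultrafilter (α → M)) : Prop :=
  ∀ (k : ℕ) (s : Set (α ⊕ Fin k → M)), A.Definable L s → ∀ b b' : Fin k → M, TpEq L A b b' →
    fiber s b ∈ p → fiber s b' ∈ p

theorem InvOver.fiber_mem_iff (hp : InvOver L A p) [Finite β] {s : Set (α ⊕ β → M)}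
    (hs : A.Definable L s) {b b' : β → M} (h : TpEq L A b b') : fiber s b ∈ p ↔ fiber s b' ∈ p := by
  obtain ⟨k, ⟨e⟩⟩ := Finite.exists_equiv_fin β
  have key : ∀ b : β → M, fiber ((fun g : α ⊕ Fin k → M => g ∘ Sum.map id e) ⁻¹' s) (b ∘ e.symm) =
      fiber s b := by
    intro b
    ext a
    simp [fiber, Sum.elim_comp_map, Function.comp_assoc]
  have h1 := hp k _ (hs.preimage_comp (Sum.map id e)) (b ∘ e.symm) (b' ∘ e.symm) (h.comp _)
  have h2 := hp k _ (hs.preimage_comp (Sum.map id e)) (b' ∘ e.symm) (b ∘ e.symm) (h.symm.comp _)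
  rw [key, key] at h1 h2
  exact ⟨h1, h2⟩

/-- A type which is finitely satisfiable in `A` is invariant over `A`. -/
theorem invOver_of_finitely_satisfiable (hp : {x : α → M | range x ⊆ A} ∈ p) : InvOver L A p := by
  intro k s hs b b' h hb
  filter_upwards [hb, hp] with x hx hxA
  exact (h _ (definable_fiber_left hs Subset.rfl hxA)).1 hx

variable (L) in
/-- The tuple `x` realizes the restriction to `A` of the global type given by `p`. -/
def Realizes (A : Set M) (p : Ultrafilter (α → M)) (x : α → M) : Prop :=
  ∀ D ∈ p, A.Definable L D → x ∈ D

theorem Realizes.mem_iff {x : α → M} (hx : Realizes L A p x) {D : Set (α → M)}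
    (hD : A.Definable L D) : x ∈ D ↔ D ∈ p := by
  refine ⟨fun h => ?_, fun h => hx D h hD⟩
  by_contra h1
  exact hx Dᶜ (Ultrafilter.compl_mem_iff_notMem.2 h1) hD.compl h

theorem Realizes.mono {x : α → M} (hx : Realizes L B p x) (h : A ⊆ B) : Realizes L A p x :=
  fun D hD hA => hx D hD (hA.mono h)

/-- The type of `(x, b)`, for `x` realizing an `A`-invariant type over `A` and `b`, depends only on
the type of `b` over `A`. -/
theorem InvOver.tpEq_elim (hp : InvOver L A p) [Finite β] {b b' : β → M} {x x' : α → M}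
    (h : TpEq L A b b') (hx : Realizes L (A ∪ range b) p x) (hx' : Realizes L (A ∪ range b') p x') :
    TpEq L A (Sum.elim x b) (Sum.elim x' b') := by
  intro D hD
  have h1 := hx.mem_iff (definable_fiber hD subset_union_left subset_union_right)
  have h2 := hx'.mem_iff (definable_fiber hD subset_union_left subset_union_right)
  rw [mem_fiber] at h1 h2
  rw [h1, h2, hp.fiber_mem_iff hD h]

variable (L) in
/-- `a` is a Morley sequence over `A` of the global type given by `p`. -/
def IsMorley (A : Set M) (p : Ultrafilter (α → M)) (a : ℕ → α → M) : Prop :=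
  ∀ n, Realizes L (A ∪ ⋃ i : Fin n, range (a i)) p (a n)

/-- The renaming that splits the last of `n + 1` tuples of variables off. -/
def splitLast (α : Type*) (n : ℕ) : Fin (n + 1) × α → α ⊕ (Fin n × α) := fun q =>
  Fin.lastCases (motive := fun _ => α ⊕ (Fin n × α)) (Sum.inl q.2) (fun i => Sum.inr (i, q.2)) q.1

theorem elim_comp_splitLast {X : Type*} {n : ℕ} (a : Fin (n + 1) → α → X) :
    Sum.elim (a (Fin.last n)) (fun q : Fin n × α => a q.1.castSucc q.2) ∘ splitLast α n =
      fun q => a q.1 q.2 := by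
  funext ⟨i, j⟩
  refine Fin.lastCases ?_ (fun i => ?_) i <;> simp [splitLast]

/-- Increasing subsequences of Morley sequences of an `A`-invariant type have the same type
over `A`. -/
theorem InvOver.tpEq_of_isMorley (hp : InvOver L A p) [Finite α] {a a' : ℕ → α → M}
    (ha : IsMorley L A p a) (ha' : IsMorley L A p a') {n : ℕ} {s t : Fin n → ℕ}
    (hs : StrictMono s) (ht : StrictMono t) :
    TpEq L A (fun q : Fin n × α => a (s q.1) q.2) (fun q : Fin n × α => a' (t q.1) q.2) := by
  induction n with
  | zero =>
    rw [Subsingleton.elim (fun q : Fin 0 × α => a' (t q.1) q.2) fun q => a (s q.1) q.2]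
    exact TpEq.refl A _
  | succ n ih =>
    have hsub : ∀ (a : ℕ → α → M) (s : Fin (n + 1) → ℕ), StrictMono s →
        A ∪ range (fun q : Fin n × α => a (s q.1.castSucc) q.2) ⊆
          A ∪ ⋃ i : Fin (s (Fin.last n)), range (a i) := by
      intro a s hs
      refine union_subset_union_right _ ?_
      rintro _ ⟨⟨i, j⟩, rfl⟩
      exact mem_iUnion.2 ⟨⟨_, hs (Fin.castSucc_lt_last i)⟩, j, rfl⟩
    have h1 := (hp.tpEq_elim
      (ih (hs.comp Fin.strictMono_castSucc) (ht.comp Fin.strictMono_castSucc))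
      ((ha _).mono (hsub a s hs)) ((ha' _).mono (hsub a' t ht))).comp (splitLast α n)
    have h2 := elim_comp_splitLast fun i => a (s i)
    have h3 := elim_comp_splitLast fun i => a' (t i)
    simp only [Function.comp_apply] at h1
    rw [h2, h3] at h1
    exact h1

theorem definable_setOf_realize (φ : L.Formula α) : A.Definable L {c : α → M | φ.Realize c} :=
  definable_iff_exists_formula_sum.2 ⟨φ.relabel Sum.inr, by
    ext c; simp [Formula.realize_relabel]⟩

theorem InvOver.isIndiscernible {k : ℕ} {p : Ultrafilter (Fin k → M)} (hp : InvOver L A p)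
    {a : ℕ → Fin k → M} (ha : IsMorley L A p a) : IsIndiscernible L a := fun _ s t φ =>
  hp.tpEq_of_isMorley ha ha s.strictMono t.strictMono _ (definable_setOf_realize φ)

/-- In a theory with NIP, a definable set is eventually constant along an indiscernible sequence. -/
theorem IsNIP.eventually (hNIP : IsNIP L M) {k : ℕ} {a : ℕ → Fin k → M} (ha : IsIndiscernible L a)
    {D : Set (Fin k → M)} (hD : A.Definable L D) :
    ∃ m : ℕ, (∀ i ≥ m, a i ∈ D) ∨ (∀ i ≥ m, a i ∉ D) := by
  obtain ⟨A0, -, hD⟩ := definable_iff_finitely_definable.1 hD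
  obtain ⟨φ, rfl⟩ := definable_iff_exists_formula_sum.1 hD
  obtain ⟨l, ⟨e⟩⟩ := Finite.exists_equiv_fin (A0 : Set M)
  obtain ⟨m, hm⟩ := hNIP k l a ha (φ.relabel (Sum.elim (Sum.inr ∘ e) Sum.inl))
    (fun j => (e.symm j : M))
  refine ⟨m, ?_⟩
  have h : ∀ i, (φ.relabel (Sum.elim (Sum.inr ∘ e) Sum.inl)).Realize
      (Sum.elim (a i) fun j => (e.symm j : M)) ↔
        φ.Realize (Sum.elim (fun x : (A0 : Set M) => (x : M)) (a i)) := by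
    intro i
    rw [Formula.realize_relabel]
    have : Sum.elim (a i) (fun j => (e.symm j : M)) ∘ Sum.elim (Sum.inr ∘ e) Sum.inl =
        Sum.elim (fun x : (A0 : Set M) => (x : M)) (a i) := by
      funext x
      rcases x with x | x <;> simp
    rw [this]
  simp only [h] at hm
  exact hm

theorem exists_mem_of_definable_elementarySubstructure (N : L.ElementarySubstructure M) [Finite β]
    {D : Set (β → M)} (hD : (N : Set M).Definable L D) (hne : D.Nonempty) :
    ∃ x ∈ D, range x ⊆ (N : Set M) := by
  obtain ⟨φ, rfl⟩ := definable_iff_exists_formula_sum.1 hD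
  obtain ⟨c, hc⟩ := hne
  have h1 : (φ.iExs β).Realize (fun x : (N : Set M) => (x : M)) := by
    rw [Formula.realize_iExs]
    exact ⟨c, hc⟩
  have h2 := (N.subtype.map_formula (φ.iExs β) id).1 h1
  rw [Formula.realize_iExs] at h2
  obtain ⟨x, hx⟩ := h2
  refine ⟨fun j => x j, ?_, by rintro _ ⟨j, rfl⟩; exact (x j).2⟩
  have h3 := (N.subtype.map_formula φ (Sum.elim id x)).2 hx
  have h4 : N.subtype ∘ Sum.elim id x =
      Sum.elim (fun x : (N : Set M) => (x : M)) fun j => (x j : M) := by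
    funext y
    rcases y with y | y <;> rfl
  rw [h4] at h3
  exact h3

/-- Every type over a model `N` extends to a global type that is finitely satisfiable in `N`. -/
theorem exists_coheir (N : L.ElementarySubstructure M) [Finite β] (b : β → M) :
    ∃ p : Ultrafilter (β → M), {x : β → M | range x ⊆ (N : Set M)} ∈ p ∧
      Realizes L (N : Set M) p b := by
  let F : Set (Set (β → M)) :=
    {E | ∃ D, (N : Set M).Definable L D ∧ b ∈ D ∧ E = D ∩ {x | range x ⊆ (N : Set M)}}
  obtain ⟨f, _, hf⟩ := exists_filter_of_inter F
    (by
      rintro _ ⟨D, hD, hb, rfl⟩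
      exact exists_mem_of_definable_elementarySubstructure N hD ⟨b, hb⟩)
    ⟨_, univ, definable_univ, mem_univ _, rfl⟩
    (by
      rintro _ ⟨D, hD, hb, rfl⟩ _ ⟨E, hE, hb', rfl⟩
      exact ⟨D ∩ E, hD.inter hE, ⟨hb, hb'⟩, by exact (inter_inter_distrib_right _ _ _).symm⟩)
  refine ⟨Ultrafilter.of f, ?_, fun D hD hdef => ?_⟩
  · exact Filter.mem_of_superset
      (Ultrafilter.of_le f (hf _ ⟨univ, definable_univ, mem_univ _, rfl⟩)) inter_subset_right
  · by_contra hb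
    have h1 : Dᶜ ∈ Ultrafilter.of f := Filter.mem_of_superset
      (Ultrafilter.of_le f (hf _ ⟨Dᶜ, hdef.compl, hb, rfl⟩)) inter_subset_left
    exact Ultrafilter.compl_mem_iff_notMem.1 h1 hD

variable [Nonempty M] {κ : Cardinal.{w}}

theorem IsMonster.exists_realizes (hM : IsMonster L M κ) (hA : #A < κ) [Finite α]
    (p : Ultrafilter (α → M)) : ∃ x, Realizes L A p x :=
  hM.exists_mem_of_filter hA (p : Filter (α → M))

theorem IsMonster.mk_lt_of_countable (hM : IsMonster L M κ) (hA : A.Countable) : #A < κ :=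
  (Cardinal.mk_le_aleph0_iff.2 hA.to_subtype).trans_lt hM.aleph0_lt

theorem IsMonster.exists_isMorley (hM : IsMonster L M κ) (hA : #A < κ) [Finite α]
    (p : Ultrafilter (α → M)) : ∃ a, IsMorley L A p a :=
  exists_seq_of_forall_fin (fun n v x => Realizes L (A ∪ ⋃ i : Fin n, range (v i)) p x)
    fun _ _ => hM.exists_realizes (hM.mk_union_lt hA (hM.mk_lt_of_countable
      (countable_iUnion fun _ => countable_range _))) p

end Morley

/-! ### Consequences of NIP: bounded alternation and finite VC dimension -/

section NIP

variable {L : FirstOrder.Language.{u, v}} {M : Type w} [L.Structure M] {α β γ : Type*} {A : Set M}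

theorem Realizes.tpEq {p : Ultrafilter (α → M)} {x x' : α → M} (hx : Realizes L A p x)
    (hx' : Realizes L A p x') : TpEq L A x x' := fun _ hD =>
  (hx.mem_iff hD).trans (hx'.mem_iff hD).symm

theorem IsMorley.mono {B : Set M} {p : Ultrafilter (α → M)} {a : ℕ → α → M} (ha : IsMorley L B p a)
    (h : A ⊆ B) : IsMorley L A p a := fun n => (ha n).mono (union_subset_union_left _ h)

variable [Nonempty M] {κ : Cardinal.{w}}

/-- Saturation turns arbitrarily long finite alternations along an indiscernible sequence into an
infinite one, which NIP excludes. -/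
theorem IsNIP.exists_not_alternating (hNIP : IsNIP L M) (hM : IsMonster L M κ) (hA : #A < κ)
    [Finite γ] {k : ℕ} {a : ℕ → Fin k → M} (ha : IsIndiscernible L a) {s : Set (γ ⊕ Fin k → M)}
    (hs : A.Definable L s) :
    ∃ n, ∀ x : γ → M, ∃ i < n, (Sum.elim x (a (2 * i)) ∈ s ↔ Sum.elim x (a (2 * i + 1)) ∈ s) := by
  by_contra! hcon
  let E : ℕ → Set (γ → M) := fun i =>
    (fiber s (a (2 * i)) ∩ (fiber s (a (2 * i + 1)))ᶜ) ∪
      ((fiber s (a (2 * i)))ᶜ ∩ fiber s (a (2 * i + 1)))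
  have hE : ∀ i x, x ∈ E i ↔ ¬ (Sum.elim x (a (2 * i)) ∈ s ↔ Sum.elim x (a (2 * i + 1)) ∈ s) := by
    intro i x
    simp only [E, mem_union, mem_inter_iff, mem_compl_iff, mem_fiber]
    tauto
  let B : Set M := A ∪ ⋃ i, range (a i)
  have hB : #B < κ := hM.mk_union_lt hA
    (hM.mk_lt_of_countable (countable_iUnion fun _ => countable_range _))
  have hfib : ∀ i, B.Definable L (fiber s (a i)) := fun i =>
    definable_fiber hs subset_union_left
      ((subset_iUnion (fun i => range (a i)) i).trans subset_union_right)
  have hEdef : ∀ i, B.Definable L (E i) := fun i =>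
    ((hfib _).inter (hfib _).compl).union ((hfib _).compl.inter (hfib _))
  obtain ⟨x, hx⟩ := hM.exists_mem_of_inter hB (range fun n => ⋂ i : Fin n, E i)
    (by
      rintro _ ⟨n, rfl⟩
      exact definable_iInter_of_finite fun i : Fin n => hEdef i)
    (by
      rintro _ ⟨n, rfl⟩
      obtain ⟨x, hx⟩ := hcon n
      refine ⟨x, mem_iInter.2 fun i => (hE _ _).2 ?_⟩
      have := hx i i.2
      tauto)
    (range_nonempty _)
    (by
      rintro _ ⟨n, rfl⟩ _ ⟨m, rfl⟩
      refine ⟨max n m, ?_⟩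
      ext x
      simp only [mem_iInter, mem_inter_iff]
      exact ⟨fun h => ⟨fun i => h ⟨i, by omega⟩, fun i => h ⟨i, by omega⟩⟩, fun h i =>
        (lt_max_iff.1 i.2).elim (fun hi => h.1 ⟨i, hi⟩) fun hi => h.2 ⟨i, hi⟩⟩)
  have hx : ∀ i, x ∈ E i := fun i => mem_iInter.1 (hx _ ⟨i + 1, rfl⟩) ⟨i, by omega⟩
  obtain ⟨m, hm⟩ := hNIP.eventually ha
    (definable_fiber_left (a := x) (hs.mono (subset_univ A)) Subset.rfl (subset_univ _))
  have h1 := (hE m x).1 (hx m)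
  rcases hm with hm | hm
  · exact h1 (iff_of_true (hm _ (by omega)) (hm _ (by omega)))
  · exact h1 (iff_of_false (hm _ (by omega)) (hm _ (by omega)))

/-- If the fibers of `s` shattered arbitrarily large finite sets of tuples, then they would shatter
an infinite sequence of tuples. -/
theorem IsMonster.exists_shattered_seq (hM : IsMonster L M κ) (hA : #A < κ) [Finite β] {m : ℕ}
    {s : Set (Fin m ⊕ β → M)} (hs : A.Definable L s)
    (h : ∀ n, ∃ x : Fin n → Fin m → M, ∀ t : Set (Fin n), ∃ b : β → M, ∀ i,
      (Sum.elim (x i) b ∈ s ↔ i ∈ t)) :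
    ∃ x : ℕ → Fin m → M, ∀ (n : ℕ) (t : Set ℕ), ∃ b : β → M, ∀ i < n,
      (Sum.elim (x i) b ∈ s ↔ i ∈ t) := by
  let Sh : ℕ → Set (ℕ × Fin m → M) := fun n =>
    {x | ∀ t : Set (Fin n), ∃ b : β → M, ∀ i : Fin n,
      (Sum.elim (fun j => x (i, j)) b ∈ s ↔ i ∈ t)}
  have hdef : ∀ n, A.Definable L (Sh n) := by
    intro n
    have h1 : Sh n = ⋂ t : Set (Fin n), {x | ∃ b : β → M, Sum.elim x b ∈
        ⋂ i : Fin n, {z : (ℕ × Fin m) ⊕ β → M |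
          (z ∘ Sum.map (fun j => ((i : ℕ), j)) id ∈ s ↔ i ∈ t)}} := by
      ext x
      simp only [Sh, mem_iInter, mem_ofPred_eq, Sum.elim_comp_map, Function.comp_id]
      rfl
    rw [h1]
    refine definable_iInter_of_finite fun t => Definable.exists_of_finite ?_
    refine definable_iInter_of_finite fun i => ?_
    by_cases hi : i ∈ t
    · simp only [hi, iff_true]
      exact hs.preimage_comp _
    · simp only [hi, iff_false]
      exact (hs.preimage_comp _).compl
  have hanti : ∀ n n', n ≤ n' → Sh n' ⊆ Sh n := by
    intro n n' hn x hx t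
    obtain ⟨b, hb⟩ := hx (Fin.castLE hn '' t)
    refine ⟨b, fun i => (hb (Fin.castLE hn i)).trans ?_⟩
    exact (Fin.castLE_injective hn).mem_set_image
  obtain ⟨f, _, hf⟩ := exists_filter_of_inter (range Sh)
    (by
      rintro _ ⟨n, rfl⟩
      obtain ⟨x, hx⟩ := h n
      refine ⟨fun q => if hq : q.1 < n then x ⟨q.1, hq⟩ q.2 else Classical.arbitrary M, fun t => ?_⟩
      obtain ⟨b, hb⟩ := hx t
      exact ⟨b, fun i => by simpa using hb i⟩)
    (range_nonempty _)
    (by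
      rintro _ ⟨n, rfl⟩ _ ⟨n', rfl⟩
      rcases le_total n n' with hn | hn
      · exact ⟨n', (inter_eq_right.2 (hanti _ _ hn)).symm⟩
      · exact ⟨n, (inter_eq_left.2 (hanti _ _ hn)).symm⟩)
  obtain ⟨x, hx⟩ := hM.exists_mem_of_filter_countable hA f
  refine ⟨fun i j => x (i, j), fun n t => ?_⟩
  obtain ⟨b, hb⟩ := hx _ (hf _ ⟨n, rfl⟩) (hdef n) {i | (i : ℕ) ∈ t}
  exact ⟨b, fun i hi => hb ⟨i, hi⟩⟩

/-- The fibers of a definable relation shatter no finite sets of tuples of large size. -/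
theorem IsNIP.exists_not_shattered (hNIP : IsNIP L M) (hM : IsMonster L M κ) (hA : #A < κ)
    [Finite β] {m : ℕ} {s : Set (Fin m ⊕ β → M)} (hs : A.Definable L s) :
    ∃ d, ∀ x : Fin d → Fin m → M, ∃ t : Set (Fin d), ∀ b : β → M, ∃ i,
      ¬ (Sum.elim (x i) b ∈ s ↔ i ∈ t) := by
  by_contra! hcon
  obtain ⟨a, ha⟩ := hM.exists_shattered_seq hA hs hcon
  -- A Morley sequence of a nonprincipal coheir of the shattered sequence is indiscernible.
  let p : Ultrafilter (Fin m → M) := (Filter.hyperfilter ℕ).map a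
  let A' : Set M := A ∪ ⋃ i, range (a i)
  have hA' : #A' < κ := hM.mk_union_lt hA
    (hM.mk_lt_of_countable (countable_iUnion fun _ => countable_range _))
  have haA' : ∀ i, range (a i) ⊆ A' := fun i =>
    (subset_iUnion (fun i => range (a i)) i).trans subset_union_right
  have hp : InvOver L A' p := invOver_of_finitely_satisfiable (by
    rw [Ultrafilter.mem_map]
    exact Filter.univ_mem' fun i => haA' i)
  obtain ⟨c, hc⟩ := hM.exists_isMorley hA' p
  -- Finite alternations pass from the shattered sequence to the Morley sequence, replacing one
  -- element at a time.
  have hyb : ∀ n j : ℕ, j ≤ n → ∀ e : ℕ → ℕ, InjOn e (Iio n) →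
      ∃ b : β → M, ∀ i : Fin n,
        (Sum.elim (if (i : ℕ) < j then c i else a (e i)) b ∈ s ↔ Even (i : ℕ)) := by
    intro n j
    induction j with
    | zero =>
      intro _ e he
      obtain ⟨N, hN⟩ : ∃ N, ∀ i < n, e i < N :=
        ⟨(Finset.range n).sup e + 1, fun i hi =>
          Nat.lt_succ_of_le (Finset.le_sup (f := e) (Finset.mem_range.2 hi))⟩
      obtain ⟨b, hb⟩ := ha N (e '' {i | i < n ∧ Even i})
      refine ⟨b, fun i => ?_⟩
      simp only [Nat.not_lt_zero, if_false]
      rw [hb _ (hN i i.2)]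
      constructor
      · rintro ⟨i', ⟨hi', hev⟩, h⟩
        rwa [← he hi' i.2 h]
      · exact fun h => ⟨i, ⟨i.2, h⟩, rfl⟩
    | succ j ih =>
      intro hj e he
      let P : Set (Fin n × Fin m → M) := {v | ∃ b : β → M, Sum.elim v b ∈
        ⋂ i : Fin n, {z : (Fin n × Fin m) ⊕ β → M |
          (z ∘ Sum.map (fun j => (i, j)) id ∈ s ↔ Even (i : ℕ))}}
      have hP : A.Definable L P := by
        refine Definable.exists_of_finite (definable_iInter_of_finite fun i => ?_)
        by_cases hi : Even (i : ℕ)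
        · simp only [hi, iff_true]
          exact hs.preimage_comp _
        · simp only [hi, iff_false]
          exact (hs.preimage_comp _).compl
      have hmemP : ∀ v : Fin n → Fin m → M, (fun q : Fin n × Fin m => v q.1 q.2) ∈ P ↔
          ∃ b : β → M, ∀ i : Fin n, (Sum.elim (v i) b ∈ s ↔ Even (i : ℕ)) := by
        intro v
        simp only [P, mem_iInter, mem_ofPred_eq, Sum.elim_comp_map, Function.comp_id]
        rfl
      let v : Fin n → Fin m → M := fun i => if (i : ℕ) < j then c i else a (e i)
      let g : Fin n × Fin m → Fin m ⊕ (Fin n × Fin m) := fun q =>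
        if (q.1 : ℕ) = j then Sum.inl q.2 else Sum.inr q
      let D : Set (Fin m → M) :=
        fiber ((fun z => z ∘ g) ⁻¹' P) fun q : Fin n × Fin m => v q.1 q.2
      have hDmem : ∀ y, y ∈ D ↔ ∃ b : β → M, ∀ i : Fin n,
          (Sum.elim (if (i : ℕ) = j then y else v i) b ∈ s ↔ Even (i : ℕ)) := by
        intro y
        rw [← hmemP]
        simp only [D, mem_fiber, mem_preimage]
        have : (Sum.elim y fun q : Fin n × Fin m => v q.1 q.2) ∘ g =
            fun q : Fin n × Fin m => (if (q.1 : ℕ) = j then y else v q.1) q.2 := by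
          funext q
          by_cases hq : (q.1 : ℕ) = j <;> simp [g, hq]
        rw [this]
      have hDdef : (A' ∪ ⋃ i : Fin j, range (c i)).Definable L D := by
        refine definable_fiber (hP.preimage_comp g)
          (subset_union_left.trans subset_union_left) ?_
        rintro _ ⟨q, rfl⟩
        by_cases hq : (q.1 : ℕ) < j
        · simp only [v, hq, if_true]
          exact Or.inr (mem_iUnion.2 ⟨⟨_, hq⟩, _, rfl⟩)
        · simp only [v, hq, if_false]
          exact Or.inl (haA' _ ⟨_, rfl⟩)
      have hDp : D ∈ p := by
        rw [Ultrafilter.mem_map]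
        refine Filter.mem_hyperfilter_of_finite_compl
          (((finite_Iio n).image e).subset fun t ht => ?_)
        by_contra hte
        refine ht ((hDmem _).2 ?_)
        obtain ⟨b, hb⟩ := ih (by omega) (Function.update e j t) (by
          intro x hx y hy hxy
          by_cases h1 : x = j <;> by_cases h2 : y = j
          · rw [h1, h2]
          · subst h1
            rw [Function.update_self, Function.update_of_ne h2] at hxy
            exact (hte ⟨y, hy, hxy.symm⟩).elim
          · subst h2
            rw [Function.update_self, Function.update_of_ne h1] at hxy
            exact (hte ⟨x, hx, hxy⟩).elim
          · rw [Function.update_of_ne h1, Function.update_of_ne h2] at hxy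
            exact he hx hy hxy)
        refine ⟨b, fun i => ?_⟩
        rw [← hb i]
        by_cases hi : (i : ℕ) = j
        · simp [hi]
        · simp [hi, v]
      obtain ⟨b, hb⟩ := (hDmem _).1 (hc j D hDp hDdef)
      refine ⟨b, fun i => ?_⟩
      rw [← hb i]
      rcases lt_trichotomy (i : ℕ) j with hi | hi | hi
      · simp [hi.ne, v, hi, hi.trans (Nat.lt_succ_self j)]
      · simp [hi]
      · simp [hi.ne', v, not_lt.2 hi.le, not_lt.2 (Nat.succ_le_of_lt hi)]
  obtain ⟨n, hn⟩ := hNIP.exists_not_alternating hM hA (hp.isIndiscernible hc)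
    (hs.preimage_comp (Sum.swap : Fin m ⊕ β → β ⊕ Fin m))
  obtain ⟨b, hb⟩ := hyb (2 * n) (2 * n) le_rfl id Function.injective_id.injOn
  obtain ⟨i, hi, h⟩ := hn b
  have h0 := hb ⟨2 * i, by omega⟩
  have h1 := hb ⟨2 * i + 1, by omega⟩
  simp only [show 2 * i < 2 * n by omega, show 2 * i + 1 < 2 * n by omega, if_true] at h0 h1
  simp only [mem_preimage, Sum.elim_swap] at h
  rw [h0, h1] at h
  simp at h

end NIP

/-! ### Uniform approximation of finite probability spaces by samples -/

section Sampling

variable {Y ι : Type*} {k : ℕ}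

/-- The membership difference `1_T(i, true) - 1_T(i, false)` of the two copies of `i`. -/
noncomputable def copyDiff (T : Set (Fin k × Bool)) (i : Fin k) : ℝ :=
  T.indicator 1 (i, true) - T.indicator 1 (i, false)

theorem abs_copyDiff_le_one (T : Set (Fin k × Bool)) (i : Fin k) : |copyDiff T i| ≤ 1 := by
  classical
  unfold copyDiff
  by_cases h1 : (i, true) ∈ T <;> by_cases h2 : (i, false) ∈ T <;> simp [h1, h2]

/-- The permutation of two copies of `Fin k` that exchanges the copies of the `i` with
`σ i = true`. -/
def swapCopies (σ : Fin k → Bool) : Equiv.Perm (Fin k × Bool) where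
  toFun q := (q.1, xor (σ q.1) q.2)
  invFun q := (q.1, xor (σ q.1) q.2)
  left_inv q := by simp
  right_inv q := by simp

theorem copyDiff_preimage_swapCopies (σ : Fin k → Bool) (T : Set (Fin k × Bool)) (i : Fin k) :
    copyDiff (swapCopies σ ⁻¹' T) i = (if σ i then -1 else 1) * copyDiff T i := by
  classical
  unfold copyDiff
  cases h : σ i <;> simp [swapCopies, h, Set.indicator, mem_preimage]

theorem sum_exp_signs (d : Fin k → ℝ) :
    ∑ σ : Fin k → Bool, Real.exp (∑ i, (if σ i then -1 else 1) * d i) =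
      ∏ i, (2 * Real.cosh (d i)) := by
  classical
  simp_rw [Real.exp_sum]
  have h := (Finset.prod_univ_sum (fun _ : Fin k => (Finset.univ : Finset Bool))
    fun i b => Real.exp ((if b then -1 else 1) * d i)).symm
  rw [Fintype.piFinset_univ] at h
  rw [h]
  refine Finset.prod_congr rfl fun i _ => ?_
  rw [Fintype.sum_bool, Real.cosh_eq]
  simp
  ring

theorem prod_two_mul_cosh_le {d : Fin k → ℝ} {ε : ℝ} (hd : ∀ i, |d i| ≤ ε) :
    ∏ i, (2 * Real.cosh (d i)) ≤ 2 ^ k * Real.exp (k * (ε ^ 2 / 2)) := by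
  have h1 : ∀ i, 2 * Real.cosh (d i) ≤ 2 * Real.exp (ε ^ 2 / 2) := by
    intro i
    have h2 : d i ^ 2 ≤ ε ^ 2 := sq_le_sq' (abs_le.1 (hd i)).1 (abs_le.1 (hd i)).2
    refine mul_le_mul_of_nonneg_left ((Real.cosh_le_exp_half_sq _).trans ?_) two_pos.le
    exact Real.exp_le_exp.2 (by linarith)
  calc ∏ i, (2 * Real.cosh (d i)) ≤ ∏ _i : Fin k, (2 * Real.exp (ε ^ 2 / 2)) :=
        Finset.prod_le_prod (fun i _ => by positivity) fun i _ => h1 i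
    _ = 2 ^ k * Real.exp (k * (ε ^ 2 / 2)) := by
        rw [Finset.prod_const, Finset.card_univ, Fintype.card_fin, mul_pow, ← Real.exp_nat_mul]

/-- The exponential moment of the discrepancy between the two halves of the doubled sample `z`,
summed over the traces on `z` of the sets `S j`. -/
noncomputable def traceMoment (S : ι → Set Y) (ε : ℝ) (z : Fin k × Bool → Y) : ℝ :=
  open Classical in
  ∑ T ∈ Finset.univ.filter (fun T => ∃ j, z ⁻¹' S j = T), 2 * Real.cosh (ε * ∑ i, copyDiff T i)

theorem sum_traceMoment_swapCopies_le (S : ι → Set Y) {ε : ℝ} (hε : 0 ≤ ε) (z : Fin k × Bool → Y)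
    {N : ℕ} (hN : {T | ∃ j, z ⁻¹' S j = T}.ncard ≤ N) :
    ∑ σ : Fin k → Bool, traceMoment S ε (z ∘ swapCopies σ) ≤
      2 ^ k * (2 * N * Real.exp (k * (ε ^ 2 / 2))) := by
  classical
  have h1 : ∀ σ : Fin k → Bool, traceMoment S ε (z ∘ swapCopies σ) =
      ∑ T ∈ Finset.univ.filter (fun T => ∃ j, z ⁻¹' S j = T),
        (Real.exp (∑ i, (if σ i then -1 else 1) * (ε * copyDiff T i)) +
          Real.exp (∑ i, (if σ i then -1 else 1) * (-(ε * copyDiff T i)))) := by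
    intro σ
    unfold traceMoment
    symm
    refine Finset.sum_bij (fun T _ => swapCopies σ ⁻¹' T) ?_ ?_ ?_ ?_
    · intro T hT
      simp only [Finset.mem_filter, Finset.mem_univ, true_and] at hT ⊢
      obtain ⟨j, rfl⟩ := hT
      exact ⟨j, rfl⟩
    · intro T _ T' _ h
      exact (swapCopies σ).surjective.preimage_injective h
    · intro T hT
      simp only [Finset.mem_filter, Finset.mem_univ, true_and] at hT
      obtain ⟨j, rfl⟩ := hT
      exact ⟨z ⁻¹' S j, by simp, rfl⟩
    · intro T _
      simp only [copyDiff_preimage_swapCopies]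
      rw [Real.cosh_eq, mul_div_cancel₀ _ two_ne_zero, Finset.mul_sum, ← Finset.sum_neg_distrib]
      congr 2 <;> exact Finset.sum_congr rfl fun i _ => by ring
  simp_rw [h1]
  rw [Finset.sum_comm]
  have h2 : ∀ T : Set (Fin k × Bool), ∑ σ : Fin k → Bool,
      (Real.exp (∑ i, (if σ i then -1 else 1) * (ε * copyDiff T i)) +
        Real.exp (∑ i, (if σ i then -1 else 1) * (-(ε * copyDiff T i)))) ≤
      2 * (2 ^ k * Real.exp (k * (ε ^ 2 / 2))) := by
    intro T
    have h3 : ∀ i, |ε * copyDiff T i| ≤ ε := fun i => by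
      rw [abs_mul, abs_of_nonneg hε]
      exact mul_le_of_le_one_right hε (abs_copyDiff_le_one T i)
    rw [Finset.sum_add_distrib, sum_exp_signs, sum_exp_signs, two_mul (2 ^ k * _)]
    exact add_le_add (prod_two_mul_cosh_le h3) (prod_two_mul_cosh_le fun i => by
      rw [abs_neg]; exact h3 i)
  refine (Finset.sum_le_card_nsmul _ _ _ fun T _ => h2 T).trans ?_
  have h4 : ((Finset.univ.filter (fun T => ∃ j, z ⁻¹' S j = T)).card : ℝ) ≤ N := by
    rw [Nat.cast_le]
    refine le_trans (le_of_eq ?_) hN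
    rw [← Set.ncard_coe_finset]
    simp
  rw [nsmul_eq_mul]
  calc _ ≤ (N : ℝ) * (2 * (2 ^ k * Real.exp (k * (ε ^ 2 / 2)))) :=
        mul_le_mul_of_nonneg_right h4 (by positivity)
    _ = _ := by ring

/-- The Sauer–Shelah bound for the number of traces on a doubled sample. -/
theorem ncard_trace_le {d : ℕ} (S : ι → Set Y)
    (hS : ∀ x : Fin d → Y, ∃ t : Set (Fin d), ∀ j, ∃ i, ¬ (x i ∈ S j ↔ i ∈ t))
    (z : Fin k × Bool → Y) :
    {T | ∃ j, z ⁻¹' S j = T}.ncard ≤ ∑ i ∈ Finset.Iic d, (k * 2).choose i := by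
  classical
  let 𝒜 : Finset (Finset (Fin k × Bool)) :=
    Finset.univ.filter fun T => ∃ j, z ⁻¹' S j = (T : Set (Fin k × Bool))
  have h1 : {T | ∃ j, z ⁻¹' S j = T}.ncard = 𝒜.card := by
    rw [← Set.ncard_coe_finset, ← Set.ncard_image_of_injective (𝒜 : Set (Finset (Fin k × Bool)))
      (f := fun T : Finset (Fin k × Bool) => (T : Set (Fin k × Bool))) Finset.coe_injective]
    congr 1
    ext T
    simp only [mem_image, 𝒜]
    constructor
    · intro hT
      exact ⟨T.toFinset, by simpa using hT, by simp⟩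
    · rintro ⟨T', hT', rfl⟩
      simpa using hT'
  have h2 : 𝒜.vcDim ≤ d := by
    refine Finset.sup_le fun s hs => ?_
    by_contra! hlt
    rw [Finset.mem_shatterer] at hs
    obtain ⟨s', hs', hcard⟩ := Finset.exists_subset_card_eq hlt.le
    let e := (Finset.equivFinOfCardEq hcard).symm
    obtain ⟨t, ht⟩ := hS fun i => z (e i)
    obtain ⟨T, hT, hsT⟩ := hs (t := Finset.univ.filter fun q => ∃ i ∈ t, (e i : Fin k × Bool) = q)
      (fun q hq => by
        simp only [Finset.mem_filter, Finset.mem_univ, true_and] at hq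
        obtain ⟨i, -, rfl⟩ := hq
        exact hs' (e i).2)
    simp only [𝒜, Finset.mem_filter, Finset.mem_univ, true_and] at hT
    obtain ⟨j, hj⟩ := hT
    obtain ⟨i, hi⟩ := ht j
    refine hi ?_
    have h3 : (e i : Fin k × Bool) ∈ s ∩ T ↔ i ∈ t := by
      rw [hsT]
      simp
    rw [← h3, Finset.mem_inter, ← mem_preimage, hj, Finset.mem_coe]
    exact ⟨fun h => ⟨hs' (e i).2, h⟩, fun h => h.2⟩
  rw [h1]
  refine (Finset.card_le_card_shatterer 𝒜).trans ((Finset.card_shatterer_le_sum_vcDim).trans ?_)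
  have h3 : Fintype.card (Fin k × Bool) = k * 2 := by simp
  rw [h3]
  exact Finset.sum_le_sum_of_subset (Finset.Iic_subset_Iic.2 h2)

variable [Fintype Y]

/-- Symmetrization: exchanging elements of the two halves of a doubled sample does not change its
distribution. -/
theorem sum_prod_mul_traceMoment_le {w : Y → ℝ} (hw : ∀ y, 0 ≤ w y) (hsum : ∑ y, w y = 1)
    (S : ι → Set Y) {ε : ℝ} (hε : 0 ≤ ε) {N : ℕ}
    (hN : ∀ z : Fin k × Bool → Y, {T | ∃ j, z ⁻¹' S j = T}.ncard ≤ N) :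
    ∑ z : Fin k × Bool → Y, (∏ q, w (z q)) * traceMoment S ε z ≤
      2 * N * Real.exp (k * (ε ^ 2 / 2)) := by
  classical
  have h1 : ∀ σ : Fin k → Bool, ∑ z : Fin k × Bool → Y, (∏ q, w (z q)) * traceMoment S ε z =
      ∑ z : Fin k × Bool → Y, (∏ q, w (z q)) * traceMoment S ε (z ∘ swapCopies σ) := by
    intro σ
    symm
    refine Fintype.sum_equiv (Equiv.arrowCongr (swapCopies σ).symm (Equiv.refl Y)) _ _ fun z => ?_
    have h2 : Equiv.arrowCongr (swapCopies σ).symm (Equiv.refl Y) z = z ∘ swapCopies σ := by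
      ext; simp [Equiv.arrowCongr]
    rw [h2]
    congr 1
    exact (Equiv.prod_comp (swapCopies σ) fun q => w (z q)).symm
  have h2 : (2 : ℝ) ^ k * ∑ z : Fin k × Bool → Y, (∏ q, w (z q)) * traceMoment S ε z =
      ∑ z : Fin k × Bool → Y, (∏ q, w (z q)) *
        ∑ σ : Fin k → Bool, traceMoment S ε (z ∘ swapCopies σ) := by
    simp_rw [Finset.mul_sum (s := (Finset.univ : Finset (Fin k → Bool)))]
    rw [Finset.sum_comm, ← Finset.sum_congr rfl fun σ _ => h1 σ, Finset.sum_const,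
      Finset.card_univ, Fintype.card_fun, Fintype.card_bool, Fintype.card_fin, nsmul_eq_mul]
    push_cast
    rfl
  have h3 : ∑ z : Fin k × Bool → Y, ∏ q, w (z q) = 1 := by
    have h := (Finset.prod_univ_sum (fun _ : Fin k × Bool => (Finset.univ : Finset Y))
      fun _ y => w y).symm
    rw [Fintype.piFinset_univ] at h
    rw [h, hsum, Finset.prod_const_one]
  have h4 : (2 : ℝ) ^ k * ∑ z : Fin k × Bool → Y, (∏ q, w (z q)) * traceMoment S ε z ≤
      2 ^ k * (2 * N * Real.exp (k * (ε ^ 2 / 2))) := by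
    rw [h2]
    calc _ ≤ ∑ z : Fin k × Bool → Y, (∏ q, w (z q)) *
            (2 ^ k * (2 * N * Real.exp (k * (ε ^ 2 / 2)))) :=
          Finset.sum_le_sum fun z _ => mul_le_mul_of_nonneg_left
            (sum_traceMoment_swapCopies_le S hε z (hN z)) (Finset.prod_nonneg fun q _ => hw _)
      _ = _ := by rw [← Finset.sum_mul, h3, one_mul]
  exact le_of_mul_le_mul_left h4 (by positivity)

/-- Jensen's inequality for a second, independent sample. -/
theorem exp_deviation_le {w : Y → ℝ} (hw : ∀ y, 0 ≤ w y) (hsum : ∑ y, w y = 1) (g : Y → ℝ) (c : ℝ)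
    (y : Fin k → Y) :
    Real.exp (c * (∑ i, g (y i) - k * ∑ u, w u * g u)) ≤
      ∑ y' : Fin k → Y, (∏ i, w (y' i)) * Real.exp (c * ∑ i, (g (y i) - g (y' i))) := by
  classical
  have h1 : ∀ i, Real.exp (c * (g (y i) - ∑ u, w u * g u)) ≤
      ∑ u, w u * Real.exp (c * (g (y i) - g u)) := by
    intro i
    have h := convexOn_exp.map_sum_le (t := Finset.univ) (w := w)
      (p := fun u => c * (g (y i) - g u)) (fun u _ => hw u) hsum fun _ _ => mem_univ _
    simp only [smul_eq_mul] at h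
    refine (le_of_eq (congrArg Real.exp ?_)).trans h
    calc c * (g (y i) - ∑ u, w u * g u)
        = c * ((∑ u, w u) * g (y i) - ∑ u, w u * g u) := by rw [hsum, one_mul]
      _ = ∑ u, w u * (c * (g (y i) - g u)) := by
        rw [Finset.sum_mul, ← Finset.sum_sub_distrib, Finset.mul_sum]
        exact Finset.sum_congr rfl fun u _ => by ring
  have h2 : c * (∑ i, g (y i) - k * ∑ u, w u * g u) =
      ∑ i, c * (g (y i) - ∑ u, w u * g u) := by
    rw [← Finset.mul_sum, Finset.sum_sub_distrib]
    simp
  rw [h2, Real.exp_sum]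
  calc _ ≤ ∏ i, ∑ u, w u * Real.exp (c * (g (y i) - g u)) :=
        Finset.prod_le_prod (fun i _ => (Real.exp_pos _).le) fun i _ => h1 i
    _ = ∑ y' : Fin k → Y, ∏ i, (w (y' i) * Real.exp (c * (g (y i) - g (y' i)))) := by
        rw [Finset.prod_univ_sum, Fintype.piFinset_univ]
    _ = _ := by
        refine Finset.sum_congr rfl fun y' _ => ?_
        rw [Finset.prod_mul_distrib, Finset.mul_sum, Real.exp_sum]

theorem sum_copies {R : Type*} [AddCommMonoid R] (f : (Fin k × Bool → Y) → R) :
    ∑ z, f z = ∑ y : Fin k → Y, ∑ y' : Fin k → Y, f fun q => if q.2 then y q.1 else y' q.1 := by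
  classical
  rw [← Fintype.sum_prod_type' fun (y y' : Fin k → Y) => f fun q => if q.2 then y q.1 else y' q.1]
  refine Fintype.sum_equiv
    { toFun := fun z => (fun i => z (i, true), fun i => z (i, false))
      invFun := fun p q => if q.2 then p.1 q.1 else p.2 q.1
      left_inv := fun z => by funext ⟨i, b⟩; cases b <;> rfl
      right_inv := fun p => rfl } _ _ fun z => ?_
  congr 1
  funext ⟨i, b⟩
  cases b <;> rfl

/-- A sample of size `k` approximates a family of sets uniformly up to `ε`, if the traces of the
family on samples of size `2 k` are few. -/
theorem exists_sample_of_ncard_trace_le {w : Y → ℝ} (hw : ∀ y, 0 ≤ w y) (hsum : ∑ y, w y = 1)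
    (S : ι → Set Y) {ε : ℝ} (hε : 0 < ε) {N : ℕ}
    (hN : ∀ z : Fin k × Bool → Y, {T | ∃ j, z ⁻¹' S j = T}.ncard ≤ N)
    (hk : 2 * N < Real.exp (k * (ε ^ 2 / 2))) :
    ∃ y : Fin k → Y, ∀ j, |∑ i, (S j).indicator 1 (y i) - k * ∑ u, w u * (S j).indicator 1 u| ≤
      k * ε := by
  classical
  by_contra! hcon
  have h1 : ∀ y : Fin k → Y, Real.exp (k * ε ^ 2) ≤ ∑ y' : Fin k → Y, (∏ i, w (y' i)) *
      traceMoment S ε (fun q => if q.2 then y q.1 else y' q.1) := by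
    intro y
    obtain ⟨j, hj⟩ := hcon y
    set dev : ℝ := ∑ i, (S j).indicator 1 (y i) - k * ∑ u, w u * (S j).indicator 1 u with hdev
    calc Real.exp (k * ε ^ 2) ≤ Real.exp (ε * |dev|) :=
          Real.exp_le_exp.2 (by nlinarith)
      _ ≤ Real.exp (ε * dev) + Real.exp (-ε * dev) := by
          rcases abs_cases dev with ⟨h, -⟩ | ⟨h, -⟩ <;> rw [h]
          · linarith [Real.exp_pos (-ε * dev)]
          · rw [mul_neg, ← neg_mul]
            linarith [Real.exp_pos (ε * dev)]
      _ ≤ _ := add_le_add (exp_deviation_le hw hsum _ _ y) (exp_deviation_le hw hsum _ _ y)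
      _ = ∑ y' : Fin k → Y, (∏ i, w (y' i)) * (2 * Real.cosh (ε * ∑ i,
            copyDiff ((fun q => if q.2 then y q.1 else y' q.1) ⁻¹' S j) i)) := by
          rw [← Finset.sum_add_distrib]
          refine Finset.sum_congr rfl fun y' _ => ?_
          rw [← mul_add, Real.cosh_eq, mul_div_cancel₀ _ two_ne_zero, neg_mul]
          rfl
      _ ≤ _ := by
          refine Finset.sum_le_sum fun y' _ => mul_le_mul_of_nonneg_left ?_
            (Finset.prod_nonneg fun i _ => hw _)
          unfold traceMoment
          exact Finset.single_le_sum
            (f := fun T : Set (Fin k × Bool) => 2 * Real.cosh (ε * ∑ i, copyDiff T i))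
            (fun T _ => by positivity) (by simp)
  have h2 : Real.exp (k * ε ^ 2) ≤
      ∑ z : Fin k × Bool → Y, (∏ q, w (z q)) * traceMoment S ε z := by
    have h3 : ∑ y : Fin k → Y, ∏ i, w (y i) = 1 := by
      have h := (Finset.prod_univ_sum (fun _ : Fin k => (Finset.univ : Finset Y))
        fun _ y => w y).symm
      rw [Fintype.piFinset_univ] at h
      rw [h, hsum, Finset.prod_const_one]
    rw [sum_copies]
    calc Real.exp (k * ε ^ 2) = ∑ y : Fin k → Y, (∏ i, w (y i)) * Real.exp (k * ε ^ 2) := by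
          rw [← Finset.sum_mul, h3, one_mul]
      _ ≤ _ := Finset.sum_le_sum fun y _ => mul_le_mul_of_nonneg_left (h1 y)
          (Finset.prod_nonneg fun i _ => hw _)
      _ = _ := by
          refine Finset.sum_congr rfl fun y _ => ?_
          rw [Finset.mul_sum]
          refine Finset.sum_congr rfl fun y' _ => ?_
          rw [Fintype.prod_prod_type]
          simp only [Fintype.prod_bool, if_true, Finset.prod_mul_distrib]
          simp [mul_assoc]
  have h3 := h2.trans (sum_prod_mul_traceMoment_le hw hsum S hε.le hN)
  have h4 : Real.exp (k * ε ^ 2) = Real.exp (k * (ε ^ 2 / 2)) * Real.exp (k * (ε ^ 2 / 2)) := by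
    rw [← Real.exp_add]
    ring_nf
  rw [h4] at h3
  exact absurd (le_of_mul_le_mul_right h3 (Real.exp_pos _)) (not_le.2 hk)

theorem exists_nat_sum_choose_lt_exp (d : ℕ) {ε : ℝ} (hε : 0 < ε) :
    ∃ k : ℕ, 0 < k ∧ 2 * (∑ i ∈ Finset.Iic d, (k * 2).choose i : ℕ) <
      Real.exp (k * (ε ^ 2 / 2)) := by
  set c : ℝ := ε ^ 2 / 2 with hc
  have hcpos : 0 < c := by positivity
  have h1 : Filter.Tendsto (fun k : ℕ => (k : ℝ) * c) Filter.atTop Filter.atTop :=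
    tendsto_natCast_atTop_atTop.atTop_mul_const hcpos
  have h2 := ((Real.tendsto_exp_div_pow_atTop d).comp h1).eventually_gt_atTop
    (2 * (d + 1) * (2 / c) ^ d)
  obtain ⟨k, hk, hk0⟩ := (h2.and (Filter.eventually_gt_atTop 0)).exists
  refine ⟨k, hk0, ?_⟩
  have hkpos : (0 : ℝ) < k := Nat.cast_pos.2 hk0
  simp only [Function.comp_apply] at hk
  rw [lt_div_iff₀ (by positivity)] at hk
  refine lt_of_le_of_lt ?_ hk
  have h3 : ∑ i ∈ Finset.Iic d, (k * 2).choose i ≤ (d + 1) * (k * 2) ^ d := by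
    calc _ ≤ ∑ _i ∈ Finset.Iic d, (k * 2) ^ d := Finset.sum_le_sum fun i hi =>
          (Nat.choose_le_pow _ _).trans (Nat.pow_le_pow_right (by omega) (Finset.mem_Iic.1 hi))
      _ = _ := by rw [Finset.sum_const, Nat.card_Iic, smul_eq_mul]
  have h4 : ((∑ i ∈ Finset.Iic d, (k * 2).choose i : ℕ) : ℝ) ≤ (d + 1) * (k * 2) ^ d := by
    exact_mod_cast h3
  have h5 : (2 / c) ^ d * ((k : ℝ) * c) ^ d = (k * 2) ^ d := by
    rw [← mul_pow]
    congr 1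
    field_simp
  calc _ ≤ 2 * (((d : ℝ) + 1) * (k * 2) ^ d) := by linarith
    _ = _ := by rw [← h5]; ring

/-- The **VC theorem**, for finite probability spaces: a family of events that shatters no set of
`d` points is approximated uniformly up to `ε` by a sample whose size depends only on `d`
and `ε`. -/
theorem exists_sample (d : ℕ) {ε : ℝ} (hε : 0 < ε) :
    ∃ k : ℕ, 0 < k ∧ ∀ (Y : Type u) (ι : Type v) [Fintype Y] (w : Y → ℝ), (∀ y, 0 ≤ w y) →
      ∑ y, w y = 1 → ∀ S : ι → Set Y,
      (∀ x : Fin d → Y, ∃ t : Set (Fin d), ∀ j, ∃ i, ¬ (x i ∈ S j ↔ i ∈ t)) →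
      ∃ y : Fin k → Y, ∀ j,
        |∑ i, (S j).indicator 1 (y i) - k * ∑ u, w u * (S j).indicator 1 u| ≤ k * ε := by
  obtain ⟨k, hk, h⟩ := exists_nat_sum_choose_lt_exp d hε
  exact ⟨k, hk, fun Y ι _ w hw hsum S hS =>
    exists_sample_of_ncard_trace_le hw hsum S hε (ncard_trace_le S hS) h⟩

end Sampling

/-! ### Keisler measures as set functions and the types in their support -/

namespace KeislerMeasure

variable {L : FirstOrder.Language.{u, v}} {M : Type w} [L.Structure M] {α β γ : Type*} {A : Set M}

theorem definable_univ_iff {D : Set (α → M)} :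
    (univ : Set M).Definable L D ↔ ∃ φ : L[[M]].Formula α, {c | φ.Realize c} = D := by
  constructor
  · rintro ⟨φ, rfl⟩
    exact ⟨toGlobal univ φ, by ext c; exact realize_toGlobal _ _ _⟩
  · rintro ⟨φ, rfl⟩
    have : (LHom.constantsOnMap fun a : M => (⟨a, mem_univ a⟩ : (univ : Set M))).IsExpansionOn M :=
      constantsOnMap_isExpansionOn rfl
    have : (L.lhomWithConstantsMap (fun a : M => (⟨a, mem_univ a⟩ : (univ : Set M)))).IsExpansionOn
        M := LHom.sumMap_isExpansionOn _ _ _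
    refine ⟨(L.lhomWithConstantsMap (fun a : M => (⟨a, mem_univ a⟩ : (univ : Set M)))).onFormula φ,
      ?_⟩
    ext c
    exact (LHom.realize_onFormula _ φ).symm

/-- The value of a global Keisler measure on a definable set (`0` on sets that are not
definable). -/
noncomputable def val (μ : KeislerMeasure L[[M]] M α) (D : Set (α → M)) : ℝ≥0 :=
  open Classical in
  if h : ∃ φ : L[[M]].Formula α, {c | φ.Realize c} = D then μ h.choose else 0

variable (μ : KeislerMeasure L[[M]] M α)

theorem val_setOf_realize (φ : L[[M]].Formula α) : μ.val {c | φ.Realize c} = μ φ := by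
  have h : ∃ ψ : L[[M]].Formula α, {c | ψ.Realize c} = {c : α → M | φ.Realize c} := ⟨φ, rfl⟩
  rw [val, dif_pos h]
  exact μ.congr' _ _ fun c => Set.ext_iff.1 h.choose_spec c

theorem val_univ : μ.val univ = 1 := by
  rw [← μ.map_top', ← val_setOf_realize]
  congr 1
  ext c
  simp [Formula.Realize]

theorem val_union {D E : Set (α → M)} (hD : A.Definable L D) (hE : A.Definable L E)
    (h : Disjoint D E) : μ.val (D ∪ E) = μ.val D + μ.val E := by
  obtain ⟨φ, rfl⟩ := definable_univ_iff.1 (hD.mono (subset_univ A))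
  obtain ⟨ψ, rfl⟩ := definable_univ_iff.1 (hE.mono (subset_univ A))
  rw [val_setOf_realize, val_setOf_realize, ← μ.map_sup' φ ψ fun c hc =>
    Set.disjoint_left.1 h hc.1 hc.2, ← val_setOf_realize]
  congr 1
  ext c
  exact BoundedFormula.realize_sup.symm

theorem val_empty : μ.val ∅ = 0 := by
  have h := μ.val_union (A := ∅) (D := ∅) (E := ∅) (L := L) definable_empty definable_empty
    (disjoint_empty _)
  simpa using h

theorem val_mono {D E : Set (α → M)} (hD : A.Definable L D) (hE : A.Definable L E) (h : D ⊆ E) :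
    μ.val D ≤ μ.val E := by
  have h1 := μ.val_union hD (hE.sdiff hD) disjoint_sdiff_right
  rw [union_sdiff_cancel h] at h1
  rw [h1]
  exact le_self_add

theorem val_union_le {D E : Set (α → M)} (hD : A.Definable L D) (hE : A.Definable L E) :
    μ.val (D ∪ E) ≤ μ.val D + μ.val E := by
  rw [← union_sdiff_self, μ.val_union hD (hE.sdiff hD) disjoint_sdiff_right]
  gcongr
  exact μ.val_mono (hE.sdiff hD) hE sdiff_subset

theorem val_biUnion_finset {ι : Type*} (s : Finset ι) {D : ι → Set (α → M)}
    (hD : ∀ i, A.Definable L (D i)) (h : Pairwise (Function.onFun Disjoint D)) :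
    μ.val (⋃ i ∈ s, D i) = ∑ i ∈ s, μ.val (D i) := by
  classical
  induction s using Finset.induction_on with
  | empty => simp [val_empty]
  | insert a s ha ih =>
    rw [Finset.set_biUnion_insert, Finset.sum_insert ha,
      μ.val_union (hD a) (definable_biUnion_finset hD s), ih]
    exact disjoint_iUnion₂_right.2 fun i hi => h fun hai => ha (hai ▸ hi)

/-- The atom of the Boolean algebra generated by the sets `D i` where exactly the `D i` with
`i ∈ t` hold. -/
def atom {X ι : Type*} (D : ι → Set X) (t : Set ι) : Set X := {x | ∀ i, x ∈ D i ↔ i ∈ t}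

theorem pairwise_disjoint_atom {X ι : Type*} (D : ι → Set X) :
    Pairwise (Function.onFun Disjoint (atom D)) := by
  intro t t' h
  refine Set.disjoint_left.2 fun x hx hx' => h ?_
  ext i
  exact (hx i).symm.trans (hx' i)

theorem definable_atom {ι : Type*} [Finite ι] {D : ι → Set (α → M)} (hD : ∀ i, A.Definable L (D i))
    (t : Set ι) : A.Definable L (atom D t) := by
  have h : atom D t = ⋂ i, {x | x ∈ D i ↔ i ∈ t} := by ext; simp [atom]
  rw [h]
  refine definable_iInter_of_finite fun i => ?_
  by_cases hi : i ∈ t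
  · simpa [hi] using hD i
  · simp only [hi, iff_false]
    exact (hD i).compl

theorem sum_val_atom {ι : Type*} [Fintype ι] {D : ι → Set (α → M)}
    (hD : ∀ i, A.Definable L (D i)) : ∑ t : Set ι, μ.val (atom D t) = 1 := by
  classical
  rw [← μ.val_biUnion_finset _ (definable_atom hD) (pairwise_disjoint_atom D), ← μ.val_univ]
  congr 1
  ext x
  simp only [mem_iUnion, mem_univ, iff_true]
  exact ⟨{i | x ∈ D i}, Finset.mem_univ _, fun i => Iff.rfl⟩

theorem val_eq_sum_atom {ι : Type*} [Fintype ι] {D : ι → Set (α → M)}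
    (hD : ∀ i, A.Definable L (D i)) (i : ι) :
    (μ.val (D i) : ℝ) = ∑ t : Set ι, (μ.val (atom D t) : ℝ) * t.indicator 1 i := by
  classical
  have h : D i = ⋃ t ∈ Finset.univ.filter (fun t : Set ι => i ∈ t), atom D t := by
    ext x
    simp only [mem_iUnion, Finset.mem_filter, Finset.mem_univ, true_and]
    constructor
    · exact fun hx => ⟨{i | x ∈ D i}, hx, fun i => Iff.rfl⟩
    · rintro ⟨t, hi, ht⟩
      exact (ht i).2 hi
  conv_lhs => rw [h]
  rw [μ.val_biUnion_finset _ (definable_atom hD) (pairwise_disjoint_atom D), Finset.sum_filter]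
  push_cast
  refine Finset.sum_congr rfl fun t _ => ?_
  by_cases hi : i ∈ t <;> simp [hi]

/-- If the sum of the measures of finitely many events exceeds `n`, then some point lies in more
than `n` of them. -/
theorem exists_lt_ncard {ι : Type*} [Finite ι] {D : ι → Set (α → M)}
    (hD : ∀ i, A.Definable L (D i)) {e : ℝ} (he : ∀ i, e ≤ μ.val (D i)) {n : ℕ}
    (hn : n < Nat.card ι * e) : ∃ x, n < {i | x ∈ D i}.ncard := by
  classical
  have := Fintype.ofFinite ι
  by_contra! hcon
  have h1 : Nat.card ι * e ≤ ∑ i, (μ.val (D i) : ℝ) := by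
    rw [Nat.card_eq_fintype_card, ← nsmul_eq_mul]
    exact Finset.card_nsmul_le_sum _ _ _ fun i _ => he i
  have h2 : ∑ i, (μ.val (D i) : ℝ) ≤ ∑ t : Set ι, (μ.val (atom D t) : ℝ) * n := by
    simp_rw [μ.val_eq_sum_atom hD]
    rw [Finset.sum_comm]
    refine Finset.sum_le_sum fun t _ => ?_
    rw [← Finset.mul_sum]
    rcases (atom D t).eq_empty_or_nonempty with ht | ⟨x, hx⟩
    · simp [ht, val_empty]
    · refine mul_le_mul_of_nonneg_left ?_ (NNReal.coe_nonneg _)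
      have h3 : t = {i | x ∈ D i} := by ext i; exact (hx i).symm
      have h4 : ∑ i, t.indicator (1 : ι → ℝ) i = t.ncard := by
        rw [Set.ncard_eq_toFinset_card', Finset.card_eq_sum_ones]
        simp [Set.indicator_apply, Finset.sum_boole]
      rw [h4, h3]
      exact_mod_cast hcon x
  rw [← Finset.sum_mul] at h2
  have h3 : ∑ t : Set ι, (μ.val (atom D t) : ℝ) = 1 := by exact_mod_cast μ.sum_val_atom hD
  rw [h3, one_mul] at h2
  linarith

/-- The global type given by `p` is in the support of `μ` (weakly random for `μ`). -/
def InSupport (p : Ultrafilter (α → M)) : Prop :=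
  ∀ D ∈ p, (univ : Set M).Definable L D → 0 < μ.val D

/-- A definable set of positive measure belongs to a type in the support: an ultrafilter containing
it and avoiding all null sets. -/
theorem exists_inSupport {D : Set (α → M)} (hD : A.Definable L D) (h : 0 < μ.val D) :
    ∃ p : Ultrafilter (α → M), D ∈ p ∧ μ.InSupport p := by
  have hD := hD.mono (subset_univ A)
  obtain ⟨f, _, hf⟩ := exists_filter_of_inter
    {E | ∃ Z, (univ : Set M).Definable L Z ∧ μ.val Z = 0 ∧ E = D \ Z}
    (by
      rintro _ ⟨Z, hZ, h0, rfl⟩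
      by_contra hne
      rw [not_nonempty_iff_eq_empty, sdiff_eq_empty] at hne
      exact absurd (μ.val_mono hD hZ hne) (by rw [h0]; exact not_le.2 h))
    ⟨_, ∅, definable_empty, μ.val_empty, rfl⟩
    (by
      rintro _ ⟨Z, hZ, h0, rfl⟩ _ ⟨Z', hZ', h0', rfl⟩
      refine ⟨Z ∪ Z', hZ.union hZ', ?_, ?_⟩
      · exact le_antisymm ((μ.val_union_le hZ hZ').trans_eq (by rw [h0, h0', add_zero])) zero_le
      · ext x
        simp only [mem_inter_iff, mem_sdiff, mem_union]
        tauto)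
  refine ⟨Ultrafilter.of f, ?_, fun E hE hdef => ?_⟩
  · exact Filter.mem_of_superset
      (Ultrafilter.of_le f (hf _ ⟨∅, definable_empty, μ.val_empty, rfl⟩)) sdiff_subset
  · by_contra h0
    have h1 := Filter.inter_mem hE
      (Ultrafilter.of_le f (hf _ ⟨E, hdef, by simpa using h0, rfl⟩))
    refine Ultrafilter.empty_notMem (f := Ultrafilter.of f) (Filter.mem_of_superset h1 ?_)
    rintro x ⟨hx, -, hx'⟩
    exact hx' hx

theorem realize_onFormula_equiv {N : Type w} [L.Structure N] (σ : M ≃[L] N)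
    (φ : L[[M]].Formula α) (c : α → M) :
    ((L.lhomWithConstantsMap σ).onFormula φ).Realize (σ ∘ c) ↔ φ.Realize c := by
  let : (constantsOn M).Structure N := constantsOn.structure σ
  have : (LHom.constantsOnMap σ).IsExpansionOn N := constantsOnMap_isExpansionOn rfl
  have : (L.lhomWithConstantsMap σ).IsExpansionOn N := LHom.sumMap_isExpansionOn _ _ _
  rw [LHom.realize_onFormula]
  let e : M ≃[L[[M]]] N :=
    { σ.toEquiv with
      map_fun' := by
        intro n f x
        cases f with
        | inl f => exact σ.map_fun f x
        | inr f =>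
          cases n with
          | zero => rfl
          | succ n => exact f.elim
      map_rel' := by
        intro n r x
        cases r with
        | inl r => exact σ.map_rel r x
        | inr r => exact r.elim }
  exact StrongHomClass.realize_formula e φ

theorem val_image {σ : M ≃[L] M} (hσ : ∀ φ : L[[M]].Formula α, μ (smulFormula σ φ) = μ φ)
    {D : Set (α → M)} (hD : A.Definable L D) : μ.val ((fun c => σ ∘ c) '' D) = μ.val D := by
  obtain ⟨φ, rfl⟩ := definable_univ_iff.1 (hD.mono (subset_univ A))
  rw [val_setOf_realize, ← hσ φ, ← val_setOf_realize]
  congr 1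
  ext c
  constructor
  · rintro ⟨c, hc, rfl⟩
    exact (realize_onFormula_equiv σ φ c).2 hc
  · intro hc
    refine ⟨σ.symm ∘ c, ?_, by ext; simp⟩
    refine (realize_onFormula_equiv σ φ _).1 ?_
    have : σ ∘ σ.symm ∘ c = c := by ext; simp
    rw [this]
    exact hc

theorem realize_instantiate (φ : L[[M]].Formula (α ⊕ β)) (b : β → M) (a : α → M) :
    (instantiate φ b).Realize a ↔ φ.Realize (Sum.elim a b) := by
  rw [instantiate, Formula.Realize, BoundedFormula.realize_subst]
  have : (fun x : α ⊕ β => Term.realize a (Sum.elim Term.var (fun j => (L.con (b j)).term) x :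
      L[[M]].Term α)) = Sum.elim a b := by
    funext x
    rcases x with x | x
    · rfl
    · simp; rfl
  rw [this]
  rfl

theorem apply_instantiate (φ : L[[A]].Formula (α ⊕ β)) (b : β → M) :
    μ (instantiate (toGlobal A φ) b) = μ.val (fiber {c | φ.Realize c} b) := by
  rw [← val_setOf_realize]
  congr 1
  ext c
  exact (realize_instantiate _ _ _).trans (realize_toGlobal _ _ _)

/-- The symmetric difference of the fibers over the two components of a pair of tuples. -/
theorem definable_symmDiff_fiber {s : Set (α ⊕ β → M)} (hs : A.Definable L s) :
    ∃ s₂ : Set (α ⊕ (β ⊕ β) → M), A.Definable L s₂ ∧ ∀ b b' : β → M,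
      fiber s₂ (Sum.elim b b') = symmDiff (fiber s b) (fiber s b') := by
  have h1 := hs.preimage_comp (Sum.map id Sum.inl : α ⊕ β → α ⊕ (β ⊕ β))
  have h2 := hs.preimage_comp (Sum.map id Sum.inr : α ⊕ β → α ⊕ (β ⊕ β))
  refine ⟨_, (h1.sdiff h2).union (h2.sdiff h1), fun b b' => ?_⟩
  ext a
  simp only [mem_fiber, mem_union, mem_sdiff, mem_preimage, Sum.elim_comp_map, Function.comp_id,
    Sum.elim_comp_inl, Sum.elim_comp_inr, Set.mem_symmDiff]

variable [Nonempty M] {κ : Cardinal.{w}} {μ}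

/-- The measure of an instance `s(x, b)` of a relation over `A`, for a measure invariant over `A`,
depends only on the type of `b` over `A`. -/
theorem IsInvariant.val_fiber (hμ : μ.IsInvariant A) (hM : IsMonster L M κ) (hA : #A < κ)
    [Finite β] {s : Set (α ⊕ β → M)} (hs : A.Definable L s) {b b' : β → M} (h : TpEq L A b b') :
    μ.val (fiber s b) = μ.val (fiber s b') := by
  obtain ⟨σ, hσA, hσ⟩ := hM.exists_equiv_of_tpEq hA h
  rw [← μ.val_image (hμ σ hσA) (definable_fiber hs (subset_univ A) (subset_univ (range b)))]
  congr 1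
  obtain ⟨φ, rfl⟩ := definable_iff_exists_formula_sum.1 hs
  have key : ∀ a : α → M,
      Sum.elim (σ ∘ a) b' ∈ {v | φ.Realize (Sum.elim (fun x : A => (x : M)) v)} ↔
      Sum.elim a b ∈ {v | φ.Realize (Sum.elim (fun x : A => (x : M)) v)} := by
    intro a
    rw [mem_ofPred_eq, mem_ofPred_eq,
      ← StrongHomClass.realize_formula σ φ (v := Sum.elim (fun x : A => (x : M)) (Sum.elim a b))]
    have : σ ∘ Sum.elim (fun x : A => (x : M)) (Sum.elim a b) =
        Sum.elim (fun x : A => (x : M)) (Sum.elim (σ ∘ a) b') := by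
      funext x
      rcases x with x | x | x
      · exact hσA x x.2
      · rfl
      · exact hσ x
    rw [this]
  ext c
  constructor
  · rintro ⟨a, ha, rfl⟩
    exact (key a).2 ha
  · intro hc
    have hc' : σ ∘ σ.symm ∘ c = c := by ext; simp
    refine ⟨σ.symm ∘ c, (key _).1 ?_, hc'⟩
    rw [hc']
    exact hc

end KeislerMeasure

/-! ### Invariance of the types in the support of an invariant measure -/

section Support

variable {L : FirstOrder.Language.{u, v}} {M : Type w} [L.Structure M] {α β γ : Type*} {A : Set M}
  [Nonempty M] {κ : Cardinal.{w}}

/-- In a theory with NIP, the global types in the support of a measure invariant over a small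
model `N` are invariant over `N`. -/
theorem KeislerMeasure.InSupport.invOver {m : ℕ} {μ : KeislerMeasure L[[M]] M (Fin m)}
    {p : Ultrafilter (Fin m → M)} (hp : μ.InSupport p) (hM : IsMonster L M κ) (hNIP : IsNIP L M)
    {N : L.ElementarySubstructure M} (hN : #N < κ) (hμ : μ.IsInvariant (N : Set M)) :
    InvOver L (N : Set M) p := by
  -- Otherwise `s(x, b)` and `s(x, b')` differ on a set of positive measure. A Morley sequence of a
  -- coheir of their common type over `N` is then separated by sets of a constant positive measure,
  -- so that some point alternates along a long part of the sequence, against NIP.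
  intro k s hs b b' hbb' hb
  by_contra hb'
  obtain ⟨q, hqN, hqb⟩ := exists_coheir N b
  have hq : InvOver L (N : Set M) q := invOver_of_finitely_satisfiable hqN
  -- `c` is a Morley sequence that continues both `b` and `b'`.
  obtain ⟨c, hc⟩ := hM.exists_isMorley
    (hM.mk_union_range_lt (hM.mk_union_range_lt hN b) b') q
  have hcN : IsMorley L (N : Set M) q c :=
    hc.mono (subset_union_left.trans subset_union_left)
  have hcb : ∀ i, TpEq L (N : Set M) (c i) b := fun i =>
    ((hcN i).mono subset_union_left).tpEq hqb
  obtain ⟨s₂, hs₂, hfib⟩ := KeislerMeasure.definable_symmDiff_fiber hs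
  set e : ℝ≥0 := μ.val (fiber s₂ (Sum.elim (c 1) (c 0))) with he
  have hreal : ∀ i j, i < j → Realizes L ((N : Set M) ∪ range (c i)) q (c j) := fun i j hij =>
    (hcN j).mono (union_subset_union_right _
      (subset_iUnion (fun x : Fin j => range (c x)) ⟨i, hij⟩))
  have hpair : ∀ i j, i < j → μ.val (symmDiff (fiber s (c j)) (fiber s (c i))) = e := by
    intro i j hij
    rw [← hfib, he]
    exact hμ.val_fiber hM hN hs₂ (hq.tpEq_elim ((hcb i).trans (hcb 0).symm) (hreal i j hij)
      (hreal 0 1 zero_lt_one))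
  have hpairb : ∀ d : Fin k → M, TpEq L (N : Set M) d b →
      (N : Set M) ∪ range d ⊆ (N : Set M) ∪ range b ∪ range b' →
      μ.val (symmDiff (fiber s (c 0)) (fiber s d)) = e := by
    intro d hd hsub
    rw [← hfib, he]
    exact hμ.val_fiber hM hN hs₂ (hq.tpEq_elim (hd.trans (hcb 0).symm)
      ((hc 0).mono (hsub.trans subset_union_left)) (hreal 0 1 zero_lt_one))
  have hdef : ∀ d : Fin k → M, (univ : Set M).Definable L (fiber s d) := fun d =>
    definable_fiber hs (subset_univ _) (subset_univ _)
  have hsd : ∀ d d' : Fin k → M,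
      (univ : Set M).Definable L (symmDiff (fiber s d) (fiber s d')) := fun d d' =>
    ((hdef d).sdiff (hdef d')).union ((hdef d').sdiff (hdef d))
  have hepos : 0 < e := by
    have h1 : fiber s b \ fiber s b' ⊆
        symmDiff (fiber s (c 0)) (fiber s b) ∪ symmDiff (fiber s (c 0)) (fiber s b') := by
      intro x hx
      simp only [mem_union, Set.mem_symmDiff]
      simp only [mem_sdiff] at hx
      tauto
    have h2 : 0 < μ.val (fiber s b \ fiber s b') :=
      hp _ (Filter.inter_mem hb (Ultrafilter.compl_mem_iff_notMem.2 hb')) ((hdef b).sdiff (hdef b'))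
    have h3 := h2.trans_le ((μ.val_mono ((hdef b).sdiff (hdef b')) ((hsd _ _).union (hsd _ _))
      h1).trans (μ.val_union_le (hsd _ _) (hsd _ _)))
    rw [hpairb b (TpEq.refl _ _) subset_union_left, hpairb b' hbb'.symm
      (union_subset_union_left _ subset_union_left)] at h3
    by_contra h0
    simp [le_antisymm (not_lt.1 h0) zero_le] at h3
  obtain ⟨n, hn⟩ := hNIP.exists_not_alternating hM hN (hq.isIndiscernible hcN) hs
  obtain ⟨K, hK⟩ := exists_nat_gt ((n : ℝ) / e)
  rw [div_lt_iff₀ (by exact_mod_cast hepos)] at hK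
  -- Many of the events `s(x, c (2i)) ≠ s(x, c (2i + 1))`, all of measure `e`, meet in one point.
  obtain ⟨x, hx⟩ := μ.exists_lt_ncard (ι := Fin K) (e := e) (n := n)
    (D := fun i => symmDiff (fiber s (c (2 * i + 1))) (fiber s (c (2 * i)))) (fun i => hsd _ _)
    (fun i => by rw [hpair _ _ (Nat.lt_succ_self _)])
    (by simpa using hK)
  classical
  let S : Finset (Fin K) := Finset.univ.filter fun i : Fin K =>
    x ∈ symmDiff (fiber s (c (2 * i + 1))) (fiber s (c (2 * i)))
  have hS : n ≤ S.card := by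
    refine hx.le.trans (le_of_eq ?_)
    rw [← Set.ncard_coe_finset]
    simp [S]
  let t := S.orderEmbOfCardLe hS
  have ht : ∀ i, x ∈ symmDiff (fiber s (c (2 * t i + 1))) (fiber s (c (2 * t i))) := fun i =>
    (Finset.mem_filter.1 (S.orderEmbOfCardLe_mem hS i)).2
  let r : Fin (2 * n) → ℕ := fun j => 2 * t ⟨j / 2, by omega⟩ + j % 2
  have hr : StrictMono r := by
    intro j j' hjj'
    have hlt : (j : ℕ) < j' := hjj'
    rcases Nat.lt_or_ge ((j : ℕ) / 2) ((j' : ℕ) / 2) with h | h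
    · have h1 : ((t ⟨j / 2, by omega⟩ : Fin K) : ℕ) < (t ⟨j' / 2, by omega⟩ : Fin K) :=
        t.strictMono (show (⟨j / 2, by omega⟩ : Fin n) < ⟨j' / 2, by omega⟩ from h)
      simp only [r]
      omega
    · have h2 : (⟨j / 2, by omega⟩ : Fin n) = ⟨j' / 2, by omega⟩ := Fin.ext (by simp; omega)
      simp only [r]
      rw [h2]
      omega
  -- The pairs can be moved to the front, contradicting NIP.
  let g : Fin (2 * n) → Fin m ⊕ Fin k → (Fin (2 * n) × Fin k) ⊕ Fin m := fun j =>
    Sum.elim Sum.inr fun l => Sum.inl (j, l)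
  let Q : Set (Fin (2 * n) × Fin k → M) := {v | ∃ x : Fin m → M, Sum.elim v x ∈
    ⋂ i : Fin n, symmDiff {z | z ∘ g ⟨2 * i + 1, by omega⟩ ∈ s} {z | z ∘ g ⟨2 * i, by omega⟩ ∈ s}}
  have hQ : (N : Set M).Definable L Q := by
    refine Definable.exists_of_finite (definable_iInter_of_finite fun i => ?_)
    exact ((hs.preimage_comp _).sdiff (hs.preimage_comp _)).union
      ((hs.preimage_comp _).sdiff (hs.preimage_comp _))
  have hcomp : ∀ (v : Fin (2 * n) → Fin k → M) (x : Fin m → M) j,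
      Sum.elim (fun q : Fin (2 * n) × Fin k => v q.1 q.2) x ∘ g j = Sum.elim x (v j) := by
    intro v x j
    funext y
    rcases y with y | y <;> rfl
  have hmemQ : ∀ v : Fin (2 * n) → Fin k → M, (fun q : Fin (2 * n) × Fin k => v q.1 q.2) ∈ Q ↔
      ∃ x : Fin m → M, ∀ i : Fin n,
        x ∈ symmDiff (fiber s (v ⟨2 * i + 1, by omega⟩)) (fiber s (v ⟨2 * i, by omega⟩)) := by
    intro v
    simp only [Q, mem_ofPred_eq, mem_iInter, Set.mem_symmDiff, hcomp, mem_fiber]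
  have h1 := (hq.tpEq_of_isMorley hcN hcN hr (Fin.val_strictMono) Q hQ).1
    ((hmemQ fun j => c (r j)).2 ⟨x, fun i => by
      have h2 : r ⟨2 * i + 1, by omega⟩ = 2 * t i + 1 := by
        have : (⟨(2 * (i : ℕ) + 1) / 2, by omega⟩ : Fin n) = i := Fin.ext (by simp; omega)
        simp only [r, this]
        omega
      have h3 : r ⟨2 * i, by omega⟩ = 2 * t i := by
        have : (⟨(2 * (i : ℕ)) / 2, by omega⟩ : Fin n) = i := Fin.ext (by simp)
        simp only [r, this]
        omega
      rw [h2, h3]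
      exact ht i⟩)
  obtain ⟨y, hy⟩ := (hmemQ fun j => c j).1 h1
  obtain ⟨i, hi, h⟩ := hn y
  have h2 := hy ⟨i, hi⟩
  simp only [Set.mem_symmDiff, mem_fiber] at h2
  tauto

end Support

/-! ### Borel definability of invariant types and measures -/

section BorelDefinability

variable {L : FirstOrder.Language.{u, v}} {M : Type w} [L.Structure M] {α β γ : Type*} {A : Set M}

theorem definable_alternating [Finite β] {m : ℕ} {s : Set (Fin m ⊕ β → M)} (hs : A.Definable L s)
    (n ε : ℕ) : A.Definable L {z : (Fin n × Fin m) ⊕ β → M | ∀ i : Fin n,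
      (Sum.elim (fun j => z (Sum.inl (i, j))) (z ∘ Sum.inr) ∈ s ↔ ((i : ℕ) + n) % 2 = ε)} := by
  rw [ofPred_forall]
  refine definable_iInter_of_finite fun i => ?_
  have h : ∀ z : (Fin n × Fin m) ⊕ β → M, Sum.elim (fun j => z (Sum.inl (i, j))) (z ∘ Sum.inr) =
      z ∘ Sum.map (fun j => (i, j)) id := by
    intro z
    funext y
    rcases y with y | y <;> rfl
  simp only [h]
  by_cases hi : ((i : ℕ) + n) % 2 = ε
  · simp only [hi, iff_true]
    exact hs.preimage_comp _
  · simp only [hi, iff_false]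
    exact (hs.preimage_comp _).compl

variable [Nonempty M] {κ : Cardinal.{w}}

variable (L β) in
/-- The σ-algebra on the tuples of `M` pulled back from the Borel sets of types over `A`. -/
@[reducible]
def borelTuples (A : Set M) : MeasurableSpace (β → M) :=
  MeasurableSpace.comap (L[[A]].completeTheory M).typeOf
    (inferInstance : MeasurableSpace ((L[[A]].completeTheory M).CompleteType β))

/-- Intersections of arbitrarily many definable sets correspond to closed sets of types. -/
theorem measurableSet_sInter_of_definable {F : Set (Set (β → M))}
    (hF : ∀ D ∈ F, A.Definable L D) : MeasurableSet[borelTuples L β A] (⋂₀ F) := by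
  refine ⟨⋂ φ ∈ {φ : L[[A]].Formula β | {c | φ.Realize c} ∈ F},
    clopen (L[[A]].completeTheory M) φ, ?_, ?_⟩
  · exact (isClosed_biInter fun φ _ => (KeislerMeasure.isClopen_clopen φ).isClosed).measurableSet
  · ext c
    simp only [mem_preimage, mem_iInter, mem_sInter, KeislerMeasure.mem_clopen_typeOf]
    constructor
    · intro h D hD
      obtain ⟨φ, rfl⟩ := hF D hD
      exact h φ hD
    · exact fun h φ hφ => h _ hφ

/-- `b` is alternating of length `n` for `s` and the type of `a`: some tuple of the same type as
`(a 0, …, a (n - 1))` over `A` lies alternatingly inside and outside the fiber of `s` over `b`; for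
`ε = 1` its last entry lies inside, for `ε = 0` outside. -/
def IsAlternating (A : Set M) {m : ℕ} (s : Set (Fin m ⊕ β → M)) (a : ℕ → Fin m → M) (n ε : ℕ)
    (b : β → M) : Prop :=
  ∃ x : Fin n × Fin m → M, TpEq L A x (fun q => a q.1 q.2) ∧
    ∀ i : Fin n, (Sum.elim (fun j => x (i, j)) b ∈ s ↔ ((i : ℕ) + n) % 2 = ε)

/-- By saturation, `IsAlternating` is an intersection of sets definable over `A`. -/
theorem IsMonster.measurableSet_isAlternating (hM : IsMonster L M κ) (hA : #A < κ) [Finite β]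
    {m : ℕ} {s : Set (Fin m ⊕ β → M)} (hs : A.Definable L s) (a : ℕ → Fin m → M) (n ε : ℕ) :
    MeasurableSet[borelTuples L β A] {b | IsAlternating (L := L) A s a n ε b} := by
  let E : Set ((Fin n × Fin m) ⊕ β → M) := {z | ∀ i : Fin n,
    (Sum.elim (fun j => z (Sum.inl (i, j))) (z ∘ Sum.inr) ∈ s ↔ ((i : ℕ) + n) % 2 = ε)}
  have hE : A.Definable L E := definable_alternating hs n ε
  have hmemE : ∀ (x : Fin n × Fin m → M) (b : β → M), Sum.elim x b ∈ E ↔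
      ∀ i : Fin n, (Sum.elim (fun j => x (i, j)) b ∈ s ↔ ((i : ℕ) + n) % 2 = ε) := by
    intro x b
    simp [E]
  let F : Set (Set (β → M)) := {G | ∃ D : Set (Fin n × Fin m → M), A.Definable L D ∧
    (fun q => a q.1 q.2) ∈ D ∧ G = {b | ∃ x ∈ D, Sum.elim x b ∈ E}}
  have hF : {b | IsAlternating (L := L) A s a n ε b} = ⋂₀ F := by
    ext b
    constructor
    · rintro ⟨x, hx, hxb⟩ _ ⟨D, hD, haD, rfl⟩
      exact ⟨x, (hx D hD).2 haD, (hmemE x b).2 hxb⟩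
    · intro hb
      obtain ⟨x, hx⟩ := hM.exists_mem_of_inter (hM.mk_union_range_lt hA b)
        {G | ∃ D : Set (Fin n × Fin m → M), A.Definable L D ∧ (fun q => a q.1 q.2) ∈ D ∧
          G = D ∩ fiber E b}
        (by
          rintro _ ⟨D, hD, -, rfl⟩
          exact (hD.mono subset_union_left).inter
            (definable_fiber hE subset_union_left subset_union_right))
        (by
          rintro _ ⟨D, hD, haD, rfl⟩
          obtain ⟨x, hx, hxb⟩ := hb _ ⟨D, hD, haD, rfl⟩
          exact ⟨x, hx, hxb⟩)
        ⟨_, univ, definable_univ, mem_univ _, rfl⟩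
        (by
          rintro _ ⟨D, hD, haD, rfl⟩ _ ⟨D', hD', haD', rfl⟩
          exact ⟨D ∩ D', hD.inter hD', ⟨haD, haD'⟩, (inter_inter_distrib_right _ _ _).symm⟩)
      exact ⟨x, (tpEq_of_imp fun D hD haD => (hx _ ⟨D, hD, haD, rfl⟩).1).symm,
        (hmemE x b).1 (hx _ ⟨univ, definable_univ, mem_univ _, rfl⟩).2⟩
  rw [hF]
  refine measurableSet_sInter_of_definable ?_
  rintro _ ⟨D, hD, -, rfl⟩
  have h1 := Definable.exists_of_finite
    ((hD.preimage_comp (Sum.inr : _ → β ⊕ (Fin n × Fin m))).inter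
      (hE.preimage_comp (Sum.swap : (Fin n × Fin m) ⊕ β → β ⊕ (Fin n × Fin m))))
  simpa [Sum.elim_swap] using h1

/-- If the fiber of `s` over `b` belongs to the invariant type `p` or not, against the side where an
alternating tuple for a Morley sequence of `p` ends, then the tuple is prolonged by a realization
of `p`. -/
theorem IsAlternating.succ {m : ℕ} {p : Ultrafilter (Fin m → M)} (hp : InvOver L A p)
    (hM : IsMonster L M κ) (hA : #A < κ) [Finite β] {s : Set (Fin m ⊕ β → M)}
    (hs : A.Definable L s) {a : ℕ → Fin m → M} (ha : IsMorley L A p a) {n ε : ℕ} {b : β → M}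
    (hε : ε < 2) (h : IsAlternating (L := L) A s a n ε b) (hb : fiber s b ∈ p ↔ ε = 0) :
    IsAlternating (L := L) A s a (n + 1) (1 - ε) b := by
  obtain ⟨x, hx, hxb⟩ := h
  obtain ⟨y, hy⟩ := hM.exists_realizes
    (hM.mk_union_range_lt (hM.mk_union_range_lt hA x) b) p
  have h1 := (hp.tpEq_elim hx (hy.mono subset_union_left) ((ha n).mono
    (union_subset_union_right _ (by
      rintro _ ⟨q, rfl⟩
      exact mem_iUnion.2 ⟨q.1, _, rfl⟩)))).comp (splitLast (Fin m) n)
  have h2 : Sum.elim (a n) (fun q : Fin n × Fin m => a q.1 q.2) ∘ splitLast (Fin m) n =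
      fun q => a q.1 q.2 := elim_comp_splitLast fun i : Fin (n + 1) => a i
  rw [h2] at h1
  refine ⟨_, h1, fun i => ?_⟩
  refine Fin.lastCases ?_ (fun i => ?_) i
  · have h3 : y ∈ fiber s b ↔ fiber s b ∈ p :=
      hy.mem_iff (definable_fiber hs (subset_union_left.trans subset_union_left)
        subset_union_right)
    have h4 : (fun j => (Sum.elim y x ∘ splitLast (Fin m) n) (Fin.last n, j)) = y := by
      funext j
      simp [splitLast]
    rw [h4, ← mem_fiber, h3, hb, Fin.val_last]
    omega
  · have h4 : (fun j => (Sum.elim y x ∘ splitLast (Fin m) n) (i.castSucc, j)) =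
        fun j => x (i, j) := by
      funext j
      simp [splitLast]
    rw [h4, hxb i, Fin.val_castSucc]
    omega

/-- The global types invariant over `A` are Borel definable over `A`: they are given by countable
unions of differences of closed sets of types over `A`. -/
theorem InvOver.measurableSet_fiber_mem {m : ℕ} {p : Ultrafilter (Fin m → M)} (hp : InvOver L A p)
    (hM : IsMonster L M κ) (hNIP : IsNIP L M) (hA : #A < κ) [Finite β] {s : Set (Fin m ⊕ β → M)}
    (hs : A.Definable L s) : MeasurableSet[borelTuples L β A] {b | fiber s b ∈ p} := by
  obtain ⟨a, ha⟩ := hM.exists_isMorley hA p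
  -- By NIP the lengths of the alternating tuples are bounded; the longest one ends on the side
  -- prescribed by `p`, since otherwise it could be prolonged.
  have h : {b | fiber s b ∈ p} = ⋃ n, {b | IsAlternating (L := L) A s a n 1 b} \
      {b | IsAlternating (L := L) A s a (n + 1) 0 b} := by
    ext b
    simp only [mem_ofPred_eq, mem_iUnion, mem_sdiff]
    constructor
    · intro hb
      by_contra! hcon
      have halt : ∀ n, ∃ ε < 2, IsAlternating (L := L) A s a n ε b := by
        intro n
        induction n with
        | zero => exact ⟨0, two_pos, _, TpEq.refl _ _, fun i => i.elim0⟩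
        | succ n ih =>
          obtain ⟨ε, hε, h⟩ := ih
          obtain rfl | rfl : ε = 0 ∨ ε = 1 := by omega
          · exact ⟨1, one_lt_two, h.succ hp hM hA hs ha two_pos (by simp [hb])⟩
          · exact ⟨0, two_pos, hcon n h⟩
      obtain ⟨n, hn⟩ := hNIP.exists_not_alternating hM hA (hp.isIndiscernible ha)
        (hs.preimage_comp (Sum.swap : Fin m ⊕ β → β ⊕ Fin m))
      obtain ⟨ε, hε, x, hx, hxb⟩ := halt (2 * n)
      have h1 := Definable.exists_of_finite (definable_alternating hs (2 * n) ε)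
      obtain ⟨b', hb'⟩ := (hx _ h1).1 ⟨b, by simpa using hxb⟩
      obtain ⟨i, hi, h2⟩ := hn b'
      have h3 := hb' ⟨2 * i, by omega⟩
      have h4 := hb' ⟨2 * i + 1, by omega⟩
      simp only [Sum.elim_inl, Sum.elim_comp_inr] at h3 h4
      simp only [mem_preimage, Sum.elim_swap] at h2
      rw [h3, h4] at h2
      omega
    · rintro ⟨n, h1, h2⟩
      by_contra hb
      exact h2 (h1.succ hp hM hA hs ha one_lt_two (by simp [hb]))
  rw [h]
  exact MeasurableSet.iUnion fun n => (hM.measurableSet_isAlternating hA hs a n 1).diff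
    (hM.measurableSet_isAlternating hA hs a (n + 1) 0)

namespace KeislerMeasure

/-- In a theory with NIP, the measures of the fibers of a definable relation are approximated
uniformly by averages over finitely many types in the support of the measure. -/
theorem exists_average {m : ℕ} (μ : KeislerMeasure L[[M]] M (Fin m)) (hM : IsMonster L M κ)
    (hNIP : IsNIP L M) (hA : #A < κ) [Finite β] {s : Set (Fin m ⊕ β → M)} (hs : A.Definable L s)
    {ε : ℝ} (hε : 0 < ε) :
    ∃ (k : ℕ) (p : Fin k → Ultrafilter (Fin m → M)), 0 < k ∧ (∀ i, μ.InSupport (p i)) ∧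
      ∀ b : β → M, |∑ i, {b | fiber s b ∈ p i}.indicator 1 b - k * (μ.val (fiber s b) : ℝ)| ≤
        k * ε := by
  classical
  obtain ⟨d, hd⟩ := hNIP.exists_not_shattered hM hA hs
  obtain ⟨k, hk, hsample⟩ := exists_sample d hε
  refine ⟨k, ?_⟩
  let G : (β → M) → Set (Fin k → Ultrafilter (Fin m → M)) := fun b =>
    {p | |∑ i, {b | fiber s b ∈ p i}.indicator 1 b - k * (μ.val (fiber s b) : ℝ)| ≤ k * ε}
  let S : Set (Fin k → Ultrafilter (Fin m → M)) := {p | ∀ i, μ.InSupport (p i)}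
  have hdef : ∀ b, (univ : Set M).Definable L (fiber s b) := fun b =>
    definable_fiber hs (subset_univ _) (subset_univ _)
  -- By compactness of the space of ultrafilters, it suffices to deal with finitely many fibers at a
  -- time; these generate a finite Boolean algebra, to which the VC theorem applies.
  have hfin : ∀ B : Finset (β → M), (S ∩ ⋂ b ∈ B, G b).Nonempty := by
    intro B
    let D : B → Set (Fin m → M) := fun b => fiber s (b : β → M)
    let Y := {t : Set B // 0 < μ.val (atom D t)}
    have hD : ∀ b : B, (univ : Set M).Definable L (D b) := fun b => hdef b
    have hsumY : ∀ f : Set B → ℝ, ∑ y : Y, (μ.val (atom D y.1) : ℝ) * f y.1 =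
        ∑ t : Set B, (μ.val (atom D t) : ℝ) * f t := by
      intro f
      rw [← Finset.sum_filter_of_ne (p := fun t => 0 < μ.val (atom D t))]
      · exact (Finset.sum_subtype (p := fun t => 0 < μ.val (atom D t)) _ (fun t => by simp)
          fun t => (μ.val (atom D t) : ℝ) * f t).symm
      · intro t _ ht
        exact pos_iff_ne_zero.2 fun h0 => ht (by rw [h0, NNReal.coe_zero, zero_mul])
    obtain ⟨y, hy⟩ := hsample Y B (fun y => μ.val (atom D y.1)) (fun y => NNReal.coe_nonneg _)
      (by
        have h1 := hsumY fun _ => 1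
        simp only [mul_one] at h1
        rw [h1]
        exact_mod_cast μ.sum_val_atom hD)
      (fun b => {y | b ∈ y.1}) (by
        intro y
        have hne : ∀ i, (atom D (y i).1).Nonempty := fun i => by
          by_contra h
          rw [not_nonempty_iff_eq_empty] at h
          have h1 := (y i).2
          rw [h, val_empty] at h1
          exact lt_irrefl _ h1
        choose x hx using hne
        obtain ⟨t, ht⟩ := hd x
        refine ⟨t, fun b => ?_⟩
        obtain ⟨i, hi⟩ := ht b
        refine ⟨i, fun h => hi ?_⟩
        rw [← h]
        exact hx i b)
    choose p hp hpS using fun i => μ.exists_inSupport (definable_atom hD (y i).1) (y i).2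
    refine ⟨p, hpS, mem_iInter₂.2 fun b hb => ?_⟩
    have h1 := hy ⟨b, hb⟩
    have h2 := hsumY fun t => t.indicator 1 (⟨b, hb⟩ : B)
    rw [← μ.val_eq_sum_atom hD ⟨b, hb⟩] at h2
    have h3 : ∀ i, fiber s b ∈ p i ↔ (⟨b, hb⟩ : B) ∈ (y i).1 := by
      intro i
      constructor
      · intro h
        obtain ⟨x, hx, hx'⟩ := (p i).neBot.nonempty_of_mem (Filter.inter_mem h (hp i))
        exact (hx' ⟨b, hb⟩).1 hx
      · intro h
        filter_upwards [hp i] with x hx using (hx ⟨b, hb⟩).2 h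
    simp only [G, mem_ofPred_eq]
    rw [← h2]
    convert h1 using 5 with i
    · simp [Set.indicator_apply, h3]
    · simp [Set.indicator_apply]
  have hS : IsClosed S := by
    have h : S = ⋂ i, ⋂ D ∈ {D : Set (Fin m → M) | (univ : Set M).Definable L D ∧ ¬ 0 < μ.val D},
        (fun p => p i) ⁻¹' {q : Ultrafilter (Fin m → M) | D ∈ q}ᶜ := by
      ext p
      simp only [S, InSupport, mem_ofPred_eq, mem_iInter, mem_preimage, mem_compl_iff]
      exact forall_congr' fun i => forall_congr' fun D => by tauto
    rw [h]
    exact isClosed_iInter fun i => isClosed_biInter fun D _ =>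
      (ultrafilter_isOpen_basic D).isClosed_compl.preimage (continuous_apply i)
  have hG : ∀ b, IsClosed (G b) := by
    intro b
    have hcont : Continuous fun p : Fin k → Ultrafilter (Fin m → M) =>
        ∑ i, ({b | fiber s b ∈ p i}.indicator 1 b : ℝ) := by
      refine continuous_finsetSum _ fun i _ => ?_
      have h : (fun p : Fin k → Ultrafilter (Fin m → M) =>
          ({b | fiber s b ∈ p i}.indicator 1 b : ℝ)) =
          ((fun p => p i) ⁻¹' {q : Ultrafilter (Fin m → M) | fiber s b ∈ q}).indicator 1 := by
        funext p
        simp [Set.indicator_apply]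
      have hclopen : IsClopen ((fun p : Fin k → Ultrafilter (Fin m → M) => p i) ⁻¹'
          {q : Ultrafilter (Fin m → M) | fiber s b ∈ q}) :=
        IsClopen.preimage ⟨ultrafilter_isClosed_basic _, ultrafilter_isOpen_basic _⟩
          (continuous_apply i)
      rw [h]
      refine continuous_indicator (fun a ha => ?_) continuous_one.continuousOn
      rw [hclopen.frontier_eq] at ha
      exact ha.elim
    exact isClosed_le (continuous_abs.comp (hcont.sub continuous_const)) continuous_const
  obtain ⟨p, hp⟩ := hS.isCompact.inter_iInter_nonempty G hG hfin
  exact ⟨p, hk, hp.1, fun b => mem_iInter.1 hp.2 b⟩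

/-- In a theory with NIP, measures invariant over a small model are Borel definable over it. -/
theorem IsInvariant.measurable_val_fiber {m : ℕ} {μ : KeislerMeasure L[[M]] M (Fin m)}
    (hM : IsMonster L M κ) (hNIP : IsNIP L M) {N : L.ElementarySubstructure M} (hN : #N < κ)
    (hμ : μ.IsInvariant (N : Set M)) [Finite β] {s : Set (Fin m ⊕ β → M)}
    (hs : (N : Set M).Definable L s) :
    Measurable[borelTuples L β (N : Set M)] fun b : β → M => (μ.val (fiber s b) : ℝ) := by
  choose k p hk hp happ using fun n : ℕ => μ.exists_average hM hNIP hN hs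
    (Nat.one_div_pos_of_nat (α := ℝ) (n := n))
  let _ := borelTuples L β (N : Set M)
  refine measurable_of_tendsto_metrizable (f := fun n (b : β → M) =>
    (k n : ℝ)⁻¹ * ∑ i, ({b | fiber s b ∈ p n i}.indicator 1 b : ℝ)) (fun n => ?_)
    (tendsto_pi_nhds.2 fun b => ?_)
  · refine Measurable.const_mul (Finset.measurable_sum _ fun i _ => ?_) _
    exact measurable_one.indicator
      (((hp n i).invOver hM hNIP hN hμ).measurableSet_fiber_mem hM hNIP hN hs)
  · rw [tendsto_iff_dist_tendsto_zero]
    refine squeeze_zero (fun _ => dist_nonneg) (fun n => ?_) tendsto_one_div_add_atTop_nhds_zero_nat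
    have hkpos : (0 : ℝ) < k n := Nat.cast_pos.2 (hk n)
    have h1 := happ n b
    rw [Real.dist_eq, ← mul_le_mul_iff_right₀ hkpos]
    refine le_trans (le_of_eq ?_) h1
    rw [← abs_of_pos hkpos, ← abs_mul, abs_of_pos hkpos, mul_sub, mul_inv_cancel_left₀ hkpos.ne']

end KeislerMeasure
end BorelDefinability

/-! ### Maps between type spaces and Borel extensions of Keisler measures -/

section TypeSpaceMaps

open KeislerMeasure

variable {L : FirstOrder.Language.{u, v}} {M : Type w} [L.Structure M] {α β : Type*} [Nonempty M]

theorem eq_of_forall_mem_clopen {T : L.Theory} {p q : T.CompleteType α}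
    (h : ∀ φ : L.Formula α, p ∈ clopen T φ → q ∈ clopen T φ) : p = q := by
  have h1 : ∀ φ : L.Formula α, p ∈ clopen T φ ↔ q ∈ clopen T φ := fun φ =>
    ⟨h φ, fun hq => by_contra fun hp => by
      have h2 := h (∼φ) (by rw [clopen_not]; exact hp)
      rw [clopen_not] at h2
      exact h2 hq⟩
  refine SetLike.ext fun σ => ?_
  have h2 := h1 (Formula.equivSentence.symm σ)
  simpa [clopen] using h2

theorem exists_realize_of_mem_clopen {φ : L.Formula α} {p : (L.completeTheory M).CompleteType α}
    (h : p ∈ clopen (L.completeTheory M) φ) : ∃ c : α → M, φ.Realize c := by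
  by_contra! hcon
  have h1 := (clopen_subset_iff (ψ := (BoundedFormula.not ⊤ : L.Formula α))).2
    (fun c hc => (hcon c hc).elim) h
  rw [clopen_not, clopen_top] at h1
  exact h1 (mem_univ _)

theorem mem_clopen_of_mem_of_filter {T : L.Theory} [M ⊨ T] (f : Filter (α → M)) [f.NeBot] :
    ∃ p : T.CompleteType α, ∀ φ : L.Formula α, {c | φ.Realize c} ∈ f → p ∈ clopen T φ := by
  obtain ⟨p, hp⟩ := exists_clusterPt_of_compactSpace (f.map (T.typeOf : (α → M) → _))
  refine ⟨p, fun φ hφ => isClosed_iff_clusterPt.1 (isClopen_clopen _).isClosed p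
    (hp.mono (Filter.le_principal_iff.2 ?_))⟩
  rw [Filter.mem_map]
  filter_upwards [hφ] with c hc
  exact (mem_clopen_typeOf (T := T) φ c).2 hc

theorem continuous_of_isOpen_preimage_clopen {X : Type*} [TopologicalSpace X] {T : L.Theory}
    {r : X → T.CompleteType α} (h : ∀ φ, IsOpen (r ⁻¹' clopen T φ)) : Continuous r := by
  refine continuous_generateFrom_iff.2 ?_
  rintro _ ⟨σ, rfl⟩
  simpa [clopen] using h (Formula.equivSentence.symm σ)

/-- A translation of the formulas of `L₁` to formulas of `L₂` which corresponds to a map of tuples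
of `M` induces a continuous map of type spaces. -/
theorem exists_typeMap {L₁ L₂ : FirstOrder.Language} [L₁.Structure M] [L₂.Structure M]
    (F : L₁.Formula α → L₂.Formula β) (ρ : (β → M) → α → M)
    (hF : ∀ φ c, (F φ).Realize c ↔ φ.Realize (ρ c)) :
    ∃ r : (L₂.completeTheory M).CompleteType β → (L₁.completeTheory M).CompleteType α,
      Continuous r ∧ (∀ φ, r ⁻¹' clopen _ φ = clopen _ (F φ)) ∧
      ∀ c : β → M, r ((L₂.completeTheory M).typeOf c) = (L₁.completeTheory M).typeOf (ρ c) := by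
  have hinf : ∀ (q : (L₂.completeTheory M).CompleteType β) (φ ψ : L₁.Formula α),
      q ∈ clopen _ (F φ) → q ∈ clopen _ (F ψ) → q ∈ clopen _ (F (φ ⊓ ψ)) := by
    intro q φ ψ hφ hψ
    by_contra h
    rw [← mem_compl_iff, ← clopen_not] at h
    have h1 : q ∈ clopen _ (∼(F (φ ⊓ ψ)) : L₂.Formula β) := h
    have h2 : clopen (L₂.completeTheory M) (F φ) ⊆
        clopen (L₂.completeTheory M) (∼(F ψ) ⊔ F (φ ⊓ ψ)) := clopen_subset_iff.2 fun c hc => by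
      have h3 := hF φ c
      have h4 := hF ψ c
      have h5 := hF (φ ⊓ ψ) c
      simp only [Formula.Realize, BoundedFormula.realize_sup, BoundedFormula.realize_inf,
        BoundedFormula.realize_not] at *
      tauto
    have h3 := h2 hφ
    rw [clopen_sup, clopen_not] at h3
    rw [clopen_not] at h1
    exact h3.elim (fun h => h hψ) h1
  have hnot : ∀ φ : L₁.Formula α, clopen (L₂.completeTheory M) (F (∼φ)) =
      (clopen (L₂.completeTheory M) (F φ))ᶜ := by
    intro φ
    rw [← clopen_not]
    refine Subset.antisymm (clopen_subset_iff.2 fun c hc => ?_) (clopen_subset_iff.2 fun c hc => ?_)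
    all_goals
      have h3 := hF φ c
      have h4 := hF (∼φ) c
      simp only [Formula.Realize, BoundedFormula.realize_not] at *
      tauto
  have hex : ∀ q : (L₂.completeTheory M).CompleteType β,
      ∃ p : (L₁.completeTheory M).CompleteType α, ∀ φ, p ∈ clopen _ φ ↔ q ∈ clopen _ (F φ) := by
    intro q
    obtain ⟨f, _, hf⟩ := exists_filter_of_inter
      {D : Set (α → M) | ∃ φ : L₁.Formula α, q ∈ clopen _ (F φ) ∧ D = {c | φ.Realize c}}
      (by
        rintro _ ⟨φ, hφ, rfl⟩
        obtain ⟨c, hc⟩ := exists_realize_of_mem_clopen hφ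
        exact ⟨ρ c, (hF φ c).1 hc⟩)
      (by
        by_cases h : q ∈ clopen _ (F ⊤)
        · exact ⟨_, ⊤, h, rfl⟩
        · exact ⟨_, ∼⊤, by rw [hnot]; exact h, rfl⟩)
      (by
        rintro _ ⟨φ, hφ, rfl⟩ _ ⟨ψ, hψ, rfl⟩
        refine ⟨φ ⊓ ψ, hinf q φ ψ hφ hψ, ?_⟩
        ext c
        exact BoundedFormula.realize_inf.symm)
    obtain ⟨p, hp⟩ := mem_clopen_of_mem_of_filter (T := L₁.completeTheory M) f
    refine ⟨p, fun φ => ⟨fun h => ?_, fun h => hp φ (hf _ ⟨φ, h, rfl⟩)⟩⟩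
    by_contra h1
    have h2 := hp (∼φ) (hf _ ⟨∼φ, by rw [hnot]; exact h1, rfl⟩)
    rw [clopen_not] at h2
    exact h2 h
  choose r hr using hex
  have hpre : ∀ φ, r ⁻¹' clopen _ φ = clopen _ (F φ) := fun φ => ext fun q => hr q φ
  refine ⟨r, continuous_of_isOpen_preimage_clopen fun φ => ?_, hpre, fun c => ?_⟩
  · rw [hpre]
    exact (isClopen_clopen _).isOpen
  · refine eq_of_forall_mem_clopen fun φ hφ => ?_
    rw [hr, mem_clopen_typeOf, hF] at hφ
    exact (mem_clopen_typeOf _ _).2 hφ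

variable (μ : KeislerMeasure L M α)

instance : μ.borelMeasure.Regular := μ.exists_regular_extension.choose_spec.1

theorem borelMeasure_clopen (φ : L.Formula α) : μ.borelMeasure (clopen _ φ) = μ φ :=
  μ.exists_regular_extension.choose_spec.2 φ

instance : IsProbabilityMeasure μ.borelMeasure := ⟨by
  rw [← clopen_top, borelMeasure_clopen, μ.map_top']
  rfl⟩

/-- Regular Borel measures on a type space are determined by their values on clopen sets. -/
theorem measure_eq_of_forall_clopen {T : L.Theory} {ν ν' : Measure (T.CompleteType α)} [ν.Regular]
    [ν'.Regular] (h : ∀ φ, ν (clopen T φ) = ν' (clopen T φ)) : ν = ν' := by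
  have hle : ∀ {ν ν' : Measure (T.CompleteType α)} [ν.Regular] [ν'.Regular],
      (∀ φ, ν (clopen T φ) = ν' (clopen T φ)) → ∀ U, IsOpen U → ν U ≤ ν' U := by
    intro ν ν' _ _ h U hU
    rw [hU.measure_eq_iSup_isCompact ν]
    refine iSup₂_le fun K hKU => iSup_le fun hK => ?_
    obtain ⟨χ, h1, h2⟩ := exists_clopen_separating hK.isClosed hU.isClosed_compl
      (disjoint_compl_right_iff_subset.2 hKU)
    rw [clopen_not, compl_subset_compl] at h2
    exact (measure_mono h1).trans ((h χ).trans_le (measure_mono h2))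
  exact Measure.OuterRegular.ext_isOpen fun U hU =>
    le_antisymm (hle h U hU) (hle (fun φ => (h φ).symm) U hU)

theorem map_borelMeasure {L₁ L₂ : FirstOrder.Language} [L₁.Structure M] [L₂.Structure M]
    {μ₁ : KeislerMeasure L₁ M α} {μ₂ : KeislerMeasure L₂ M β} {F : L₁.Formula α → L₂.Formula β}
    {r : (L₂.completeTheory M).CompleteType β → (L₁.completeTheory M).CompleteType α}
    (hr : Continuous r) (hF : ∀ φ, r ⁻¹' clopen _ φ = clopen _ (F φ))
    (hμ : ∀ φ, μ₁ φ = μ₂ (F φ)) : μ₂.borelMeasure.map r = μ₁.borelMeasure := by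
  have : IsProbabilityMeasure (μ₂.borelMeasure.map r) :=
    Measure.isProbabilityMeasure_map hr.measurable.aemeasurable
  have : (μ₂.borelMeasure.map r).InnerRegular := Measure.InnerRegular.map_of_continuous hr
  refine measure_eq_of_forall_clopen fun φ => ?_
  rw [Measure.map_apply hr.measurable (isClopen_clopen φ).isOpen.measurableSet, hF,
    borelMeasure_clopen, borelMeasure_clopen, hμ]

end TypeSpaceMaps

/-! ### Types over small sets of parameters and the schema of an invariant measure -/

namespace KeislerMeasure

variable {L : FirstOrder.Language.{u, v}} {M : Type w} [L.Structure M] {α β γ : Type*} {A B : Set M}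

theorem IsInvariant.mono {μ : KeislerMeasure L[[M]] M α} (hμ : μ.IsInvariant A) (h : A ⊆ B) :
    μ.IsInvariant B := fun σ hσ => hμ σ fun a ha => hσ a (h ha)

theorem definable_setOf_realize_constants (φ : L[[A]].Formula α) :
    A.Definable L {c : α → M | φ.Realize c} := ⟨φ, rfl⟩

variable [Nonempty M] {κ : Cardinal.{w}}

/-- Small sets of parameters are contained in small models. -/
theorem _root_.Keisler.IsMonster.exists_elementarySubstructure (hM : IsMonster L M κ)
    (hA : #A < κ) :
    ∃ N : L.ElementarySubstructure M, A ⊆ N ∧ #N < κ := by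
  let lam : Cardinal.{max u v w} :=
    max ℵ₀ (max (Cardinal.lift.{max u v} #A) (Cardinal.lift.{w} L.card))
  have hlam : lam < Cardinal.lift.{max u v} κ := by
    refine max_lt ?_ (max_lt (Cardinal.lift_lt.2 hA) hM.card_language_lt)
    rw [← Cardinal.lift_aleph0.{max u v, w}]
    exact Cardinal.lift_lt.2 hM.aleph0_lt
  rcases le_or_gt lam (Cardinal.lift.{max u v} #M) with h | h
  · obtain ⟨N, hAN, hN⟩ := exists_elementarySubstructure_card_eq L A lam (le_max_left _ _)
      (by
        rw [Cardinal.lift_umax.{w, max u v}, Cardinal.lift_id'.{w, max u v}]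
        exact (le_max_left _ _).trans (le_max_right _ _))
      (by
        rw [Cardinal.lift_umax.{max u v, w}, Cardinal.lift_id'.{max u v, max u v w}]
        exact (le_max_right _ _).trans (le_max_right _ _))
      (by
        rw [Cardinal.lift_umax.{w, max u v}, Cardinal.lift_id'.{w, max u v}]
        exact h)
    rw [Cardinal.lift_umax.{w, max u v}, Cardinal.lift_id'.{w, max u v}] at hN
    refine ⟨N, hAN, Cardinal.lift_lt.{w, max u v}.1 ?_⟩
    rw [hN]
    exact hlam
  · refine ⟨⊤, subset_univ _, ?_⟩
    have h1 : #M < κ := Cardinal.lift_lt.1 (h.trans hlam)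
    exact (Cardinal.mk_subtype_le _).trans_lt h1

/-- Saturation: types in countably many variables over a small set are realized. -/
theorem _root_.Keisler.IsMonster.typeOf_surjective (hM : IsMonster L M κ) (hA : #A < κ)
    [Countable β] : Function.Surjective ((L[[A]].completeTheory M).typeOf : (β → M) → _) := by
  intro q
  obtain ⟨f, _, hf⟩ := exists_filter_of_inter
    {D : Set (β → M) | ∃ φ : L[[A]].Formula β, q ∈ clopen _ φ ∧ D = {c | φ.Realize c}}
    (by
      rintro _ ⟨φ, hφ, rfl⟩
      exact exists_realize_of_mem_clopen hφ)
    ⟨_, ⊤, by rw [clopen_top]; exact mem_univ _, rfl⟩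
    (by
      rintro _ ⟨φ, hφ, rfl⟩ _ ⟨ψ, hψ, rfl⟩
      refine ⟨∼(∼φ ⊔ ∼ψ), ?_, ?_⟩
      · simp only [clopen_not, clopen_sup, mem_compl_iff, mem_union]
        tauto
      · ext c
        simp only [mem_inter_iff, mem_ofPred_eq, Formula.Realize, BoundedFormula.realize_not,
          BoundedFormula.realize_sup]
        tauto)
  obtain ⟨b, hb⟩ := hM.exists_mem_of_filter_countable hA f
  exact ⟨b, (eq_of_forall_mem_clopen fun φ hφ =>
    (mem_clopen_typeOf (T := L[[A]].completeTheory M) φ b).2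
      (hb _ (hf _ ⟨φ, hφ, rfl⟩) ⟨φ, rfl⟩)).symm⟩

theorem tpEq_of_typeOf_eq {b b' : β → M}
    (h : (L[[A]].completeTheory M).typeOf b = (L[[A]].completeTheory M).typeOf b') :
    TpEq L A b b' := by
  rintro _ ⟨φ, rfl⟩
  have h1 := mem_clopen_typeOf (T := L[[A]].completeTheory M) φ b
  rw [h, mem_clopen_typeOf] at h1
  exact h1.symm

variable (β) in
theorem exists_restrictType (A : Set M) :
    ∃ r : (L[[M]].completeTheory M).CompleteType β → (L[[A]].completeTheory M).CompleteType β,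
      Continuous r ∧ ∀ φ, r ⁻¹' clopen _ φ = clopen _ (toGlobal A φ) := by
  obtain ⟨r, h1, h2, -⟩ := exists_typeMap (M := M) (α := β) (toGlobal (L := L) A) id
    fun φ c => realize_toGlobal A φ c
  exact ⟨r, h1, h2⟩

/-- The restriction map from types over `M` to types over `A`. -/
noncomputable def restrictType (A : Set M) :
    (L[[M]].completeTheory M).CompleteType β → (L[[A]].completeTheory M).CompleteType β :=
  (exists_restrictType β A).choose

theorem continuous_restrictType : Continuous (restrictType (L := L) (β := β) A) :=
  (exists_restrictType β A).choose_spec.1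

theorem mem_clopen_restrictType {q : (L[[M]].completeTheory M).CompleteType β}
    {φ : L[[A]].Formula β} :
    restrictType A q ∈ clopen _ φ ↔ q ∈ clopen _ (toGlobal A φ) :=
  Set.ext_iff.1 ((exists_restrictType β A).choose_spec.2 φ) q

theorem restrictType_eq_of_subset {q : (L[[M]].completeTheory M).CompleteType β} {b : β → M}
    (hAB : A ⊆ B) (h : restrictType B q = (L[[B]].completeTheory M).typeOf b) :
    restrictType A q = (L[[A]].completeTheory M).typeOf b := by
  refine eq_of_forall_mem_clopen fun φ hφ => ?_
  rw [mem_clopen_restrictType] at hφ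
  obtain ⟨ψ, hψ⟩ : B.Definable L {c | φ.Realize c} := (definable_setOf_realize_constants φ).mono hAB
  have h1 : restrictType B q ∈ clopen _ ψ := by
    rw [mem_clopen_restrictType]
    refine clopen_subset_iff.2 (fun c hc => ?_) hφ
    rw [realize_toGlobal] at hc ⊢
    exact (Set.ext_iff.1 hψ c).1 hc
  rw [h, mem_clopen_typeOf] at h1
  exact (mem_clopen_typeOf (T := L[[A]].completeTheory M) φ b).2 ((Set.ext_iff.1 hψ b).2 h1)

theorem map_restrictType (ν : KeislerMeasure L[[M]] M β) :
    ν.borelMeasure.map (restrictType A) = (ν.restrict A).borelMeasure :=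
  map_borelMeasure continuous_restrictType (F := toGlobal A)
    (fun _ => Set.ext fun _ => mem_clopen_restrictType) fun _ => rfl

/-- By invariance and homogeneity, `μ(φ(x, b))` depends only on the type of `b`, so that the schema
is well defined. -/
theorem IsInvariant.schema_typeOf {μ : KeislerMeasure L[[M]] M α} (hμ : μ.IsInvariant A)
    (hM : IsMonster L M κ) (hA : #A < κ) [Finite β] (φ : L[[A]].Formula (α ⊕ β)) (b : β → M) :
    schema A μ φ ((L[[A]].completeTheory M).typeOf b) = μ.val (fiber {c | φ.Realize c} b) := by
  have hfac : Function.FactorsThrough (fun b : β → M => μ (instantiate (toGlobal A φ) b))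
      fun b : β → M => (L[[A]].completeTheory M).typeOf b := by
    intro b b' h
    simp only [apply_instantiate]
    exact hμ.val_fiber hM hA (definable_setOf_realize_constants φ) (tpEq_of_typeOf_eq h)
  rw [schema, hfac.extend_apply, apply_instantiate]

/-- In a theory with NIP, the function integrated in the definition of the nonforking product is
Borel. -/
theorem IsInvariant.measurable_schema {m : ℕ} {μ : KeislerMeasure L[[M]] M (Fin m)}
    {N : L.ElementarySubstructure M} (hμ : μ.IsInvariant (N : Set M)) (hM : IsMonster L M κ)
    (hNIP : IsNIP L M) (hN : #N < κ) [Finite β] (φ : L[[(N : Set M)]].Formula (Fin m ⊕ β)) :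
    Measurable fun q => (schema (N : Set M) μ φ q : ℝ≥0∞) := by
  refine Measurable.coe_nnreal_ennreal ?_
  intro E hE
  have h1 :=
    (hμ.measurable_val_fiber hM hNIP hN (definable_setOf_realize_constants φ)).real_toNNReal
  obtain ⟨S, hS, hSE⟩ := h1 hE
  convert hS
  -- All types over `N` are realized, so sets of types are determined by their preimages.
  refine (hM.typeOf_surjective hN).preimage_injective ?_
  rw [hSE]
  ext b
  have h2 := hμ.schema_typeOf hM hN φ b
  rw [mem_preimage, mem_preimage, mem_preimage, Real.toNNReal_coe, ← h2]

end KeislerMeasure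

/-! ### Existence and uniqueness of nonforking products -/

namespace KeislerMeasure

theorem comapVar_comapVar {L : FirstOrder.Language.{u, v}} {M : Type w} [L.Structure M]
    {α β γ : Type*} (μ : KeislerMeasure L M γ) (f : α → β) (g : β → γ) :
    (μ.comapVar g).comapVar f = μ.comapVar (g ∘ f) := by
  ext φ
  change ((μ _ : ℝ≥0) : ℝ) = ((μ _ : ℝ≥0) : ℝ)
  congr 1
  exact μ.congr' _ _ fun c => by simp only [Formula.realize_relabel, Function.comp_assoc]

variable {L : FirstOrder.Language.{u, v}} {M : Type w} [L.Structure M] {α β γ : Type*} {A B : Set M}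
  [Nonempty M] {κ : Cardinal.{w}}

theorem _root_.Keisler.IsMonster.exists_model_definable (hM : IsMonster L M κ) (hA : #A < κ)
    {D : Set (α → M)} (hD : (univ : Set M).Definable L D) :
    ∃ N : L.ElementarySubstructure M, A ⊆ N ∧ #N < κ ∧ (N : Set M).Definable L D := by
  obtain ⟨A0, -, hA0⟩ := definable_iff_finitely_definable.1 hD
  obtain ⟨N, hAN, hN⟩ := hM.exists_elementarySubstructure
    (hM.mk_union_lt hA (hM.mk_lt_of_countable A0.countable_toSet))
  exact ⟨N, subset_union_left.trans hAN, hN, hA0.mono (subset_union_right.trans hAN)⟩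

/-- For a global measure `μ(x)`, the function on the global types `q(y)` which takes `q` to
`μ(D(x, b))`, for `b` a realization of `q` over a small model over which `D` is defined and `μ` is
invariant. -/
noncomputable def globalSchema (κ : Cardinal.{w}) (μ : KeislerMeasure L[[M]] M α)
    (D : Set (α ⊕ β → M)) (q : (L[[M]].completeTheory M).CompleteType β) : ℝ≥0 :=
  open Classical in
  if h : ∃ (N : L.ElementarySubstructure M) (φ : L[[(N : Set M)]].Formula (α ⊕ β)),
      #N < κ ∧ μ.IsInvariant (N : Set M) ∧ {c | φ.Realize c} = D then
    schema (h.choose : Set M) μ h.choose_spec.choose (restrictType (h.choose : Set M) q)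
  else 0

section

variable {μ : KeislerMeasure L[[M]] M α} (hM : IsMonster L M κ) (hA : #A < κ)
  (hμ : μ.IsInvariant A)

include hM hA hμ

theorem exists_globalSchema_eq_schema {D : Set (α ⊕ β → M)} (hD : (univ : Set M).Definable L D) :
    ∃ (N : L.ElementarySubstructure M) (φ : L[[(N : Set M)]].Formula (α ⊕ β)),
      #N < κ ∧ μ.IsInvariant (N : Set M) ∧ {c | φ.Realize c} = D ∧
        ∀ q, globalSchema κ μ D q = schema (N : Set M) μ φ (restrictType (N : Set M) q) := by
  have h : ∃ (N : L.ElementarySubstructure M) (φ : L[[(N : Set M)]].Formula (α ⊕ β)),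
      #N < κ ∧ μ.IsInvariant (N : Set M) ∧ {c | φ.Realize c} = D := by
    obtain ⟨N, hAN, hN, φ, hφ⟩ := hM.exists_model_definable hA hD
    exact ⟨N, φ, hN, hμ.mono hAN, hφ.symm⟩
  refine ⟨h.choose, h.choose_spec.choose, h.choose_spec.choose_spec.1,
    h.choose_spec.choose_spec.2.1, h.choose_spec.choose_spec.2.2, fun q => ?_⟩
  rw [globalSchema, dif_pos h]

/-- The values of `globalSchema` at `q` are computed by every realization of `q` over a large enough
small set. -/
theorem exists_globalSchema_eq_val [Finite β] {D : Set (α ⊕ β → M)}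
    (hD : (univ : Set M).Definable L D) :
    ∃ B : Set M, #B < κ ∧ ∀ (C : Set M) (q : (L[[M]].completeTheory M).CompleteType β) (b : β → M),
      B ⊆ C → restrictType C q = (L[[C]].completeTheory M).typeOf b →
        globalSchema κ μ D q = μ.val (fiber D b) := by
  obtain ⟨N, φ, hN, hμN, rfl, h⟩ := exists_globalSchema_eq_schema hM hA hμ hD
  refine ⟨N, hN, fun C q b hNC hb => ?_⟩
  rw [h, restrictType_eq_of_subset hNC hb, hμN.schema_typeOf hM hN]

/-- The integral of the schema of `μ` over a small model agrees with the integral of its global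
version. -/
theorem lintegral_schema_eq {N : L.ElementarySubstructure M} (hN : #N < κ)
    (hμN : μ.IsInvariant (N : Set M)) [Finite β] (ν : KeislerMeasure L[[M]] M β)
    (φ : L[[(N : Set M)]].Formula (α ⊕ β))
    (hmeas : Measurable fun q => (schema (N : Set M) μ φ q : ℝ≥0∞)) :
    ∫⁻ q, (schema (N : Set M) μ φ q : ℝ≥0∞) ∂(ν.restrict (N : Set M)).borelMeasure =
      ∫⁻ q, (globalSchema κ μ {c | φ.Realize c} q : ℝ≥0∞) ∂ν.borelMeasure := by
  rw [← map_restrictType, lintegral_map hmeas continuous_restrictType.measurable]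
  refine lintegral_congr fun q => ?_
  obtain ⟨B, hB, h⟩ := exists_globalSchema_eq_val hM hA hμ
    ((definable_setOf_realize_constants φ).mono (subset_univ _))
  obtain ⟨b, hb⟩ := hM.typeOf_surjective (hM.mk_union_lt hB hN)
    (restrictType (B ∪ (N : Set M)) q)
  rw [h _ q b subset_union_left hb.symm, restrictType_eq_of_subset subset_union_right hb.symm,
    hμN.schema_typeOf hM hN]

theorem globalSchema_union [Finite β] {D E : Set (α ⊕ β → M)}
    (hD : (univ : Set M).Definable L D) (hE : (univ : Set M).Definable L E) (hDE : Disjoint D E)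
    (q : (L[[M]].completeTheory M).CompleteType β) :
    globalSchema κ μ (D ∪ E) q = globalSchema κ μ D q + globalSchema κ μ E q := by
  obtain ⟨B₁, hB₁, h₁⟩ := exists_globalSchema_eq_val hM hA hμ hD
  obtain ⟨B₂, hB₂, h₂⟩ := exists_globalSchema_eq_val hM hA hμ hE
  obtain ⟨B₃, hB₃, h₃⟩ := exists_globalSchema_eq_val hM hA hμ (hD.union hE)
  obtain ⟨b, hb⟩ := hM.typeOf_surjective (hM.mk_union_lt (hM.mk_union_lt hB₁ hB₂) hB₃)
    (restrictType (B₁ ∪ B₂ ∪ B₃) q)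
  rw [h₁ _ q b (subset_union_left.trans subset_union_left) hb.symm,
    h₂ _ q b (subset_union_right.trans subset_union_left) hb.symm,
    h₃ _ q b subset_union_right hb.symm]
  refine μ.val_union (definable_fiber hD Subset.rfl (subset_univ (range b)))
    (definable_fiber hE Subset.rfl (subset_univ (range b))) ?_
  exact Set.disjoint_left.2 fun a h h' => Set.disjoint_left.1 hDE h h'

theorem globalSchema_univ [Finite β] (q : (L[[M]].completeTheory M).CompleteType β) :
    globalSchema κ μ (univ : Set (α ⊕ β → M)) q = 1 := by
  obtain ⟨B, hB, h⟩ := exists_globalSchema_eq_val hM hA hμ (β := β) (D := univ) definable_univ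
  obtain ⟨b, hb⟩ := hM.typeOf_surjective hB (restrictType B q)
  rw [h _ q b Subset.rfl hb.symm]
  exact μ.val_univ

theorem globalSchema_le_one [Finite β] {D : Set (α ⊕ β → M)}
    (hD : (univ : Set M).Definable L D) (q : (L[[M]].completeTheory M).CompleteType β) :
    globalSchema κ μ D q ≤ 1 := by
  rw [← globalSchema_univ hM hA hμ (α := α) q, ← union_compl_self D,
    globalSchema_union hM hA hμ hD hD.compl disjoint_compl_right]
  exact le_self_add

end

section

variable {m : ℕ} {μ : KeislerMeasure L[[M]] M (Fin m)} (hM : IsMonster L M κ) (hNIP : IsNIP L M)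
  (hA : #A < κ) (hμ : μ.IsInvariant A)

include hM hNIP hA hμ

theorem measurable_globalSchema [Finite β] {D : Set (Fin m ⊕ β → M)}
    (hD : (univ : Set M).Definable L D) :
    Measurable fun q => (globalSchema κ μ D q : ℝ≥0∞) := by
  obtain ⟨N, φ, hN, hμN, rfl, h⟩ := exists_globalSchema_eq_schema hM hA hμ hD
  simp only [h]
  exact (hμN.measurable_schema hM hNIP hN φ).comp continuous_restrictType.measurable

/-- Nonforking products exist: integrating the global schema against `ν` defines one. -/
theorem exists_isProd [Finite β] (ν : KeislerMeasure L[[M]] M β) : ∃ ω, IsProd κ μ ν ω := by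
  let I : Set (Fin m ⊕ β → M) → ℝ≥0∞ := fun D => ∫⁻ q, (globalSchema κ μ D q : ℝ≥0∞) ∂ν.borelMeasure
  have hdef : ∀ φ : L[[M]].Formula (Fin m ⊕ β), (univ : Set M).Definable L {c | φ.Realize c} :=
    fun φ => definable_univ_iff.2 ⟨φ, rfl⟩
  have hIuniv : I univ = 1 := by
    simp only [I, globalSchema_univ hM hA hμ]
    simp
  have hIle : ∀ D : Set (Fin m ⊕ β → M), (univ : Set M).Definable L D → I D ≠ ∞ := by
    intro D hD
    refine ne_top_of_le_ne_top ENNReal.one_ne_top (hIuniv ▸ lintegral_mono fun q => ?_)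
    rw [globalSchema_univ hM hA hμ]
    exact ENNReal.coe_le_coe.2 (globalSchema_le_one hM hA hμ hD q)
  let ω : KeislerMeasure L[[M]] M (Fin m ⊕ β) :=
    { toFun := fun φ => (I {c | φ.Realize c}).toNNReal
      map_top' := by
        have : {c : Fin m ⊕ β → M | (⊤ : L[[M]].Formula (Fin m ⊕ β)).Realize c} = univ := by
          ext c
          simp [Formula.Realize]
        rw [this, hIuniv]
        rfl
      congr' := fun φ ψ h => by
        have : {c : Fin m ⊕ β → M | φ.Realize c} = {c | ψ.Realize c} := Set.ext h
        rw [this]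
      map_sup' := fun φ ψ h => by
        have h1 : {c : Fin m ⊕ β → M | (φ ⊔ ψ).Realize c} =
            {c | φ.Realize c} ∪ {c | ψ.Realize c} := by
          ext c
          exact BoundedFormula.realize_sup
        have h2 : I {c : Fin m ⊕ β → M | (φ ⊔ ψ).Realize c} =
            I {c | φ.Realize c} + I {c | ψ.Realize c} := by
          simp only [I]
          rw [h1, ← lintegral_add_left (measurable_globalSchema hM hNIP hA hμ (hdef φ))]
          refine lintegral_congr fun q => ?_
          rw [globalSchema_union hM hA hμ (hdef φ) (hdef ψ)
            (Set.disjoint_left.2 fun c hc hc' => h c ⟨hc, hc'⟩), ENNReal.coe_add]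
        rw [h2, ENNReal.toNNReal_add (hIle _ (hdef φ)) (hIle _ (hdef ψ))] }
  refine ⟨ω, fun N hN hμN φ => ?_⟩
  rw [lintegral_schema_eq hM hA hμ hN hμN ν φ (hμN.measurable_schema hM hNIP hN φ)]
  change (((I {c | (toGlobal (N : Set M) φ).Realize c}).toNNReal : ℝ≥0) : ℝ≥0∞) = _
  rw [ENNReal.coe_toNNReal (hIle _ (hdef _))]
  have : {c | (toGlobal (N : Set M) φ).Realize c} = {c | φ.Realize c} :=
    Set.ext fun c => realize_toGlobal _ _ _
  rw [this]

theorem isProd_prod [Finite β] (ν : KeislerMeasure L[[M]] M β) : IsProd κ μ ν (prod κ μ ν) :=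
  Classical.epsilon_spec (exists_isProd hM hNIP hA hμ ν)

end

/-- Nonforking products are unique: every formula is over some small model. -/
theorem IsProd.eq {μ : KeislerMeasure L[[M]] M α} {ν : KeislerMeasure L[[M]] M β}
    {ω ω' : KeislerMeasure L[[M]] M (α ⊕ β)} (hM : IsMonster L M κ) (hA : #A < κ)
    (hμ : μ.IsInvariant A) (h : IsProd κ μ ν ω) (h' : IsProd κ μ ν ω') : ω = ω' := by
  ext φ
  obtain ⟨N, hAN, hN, ψ, hψ⟩ := hM.exists_model_definable hA
    (definable_univ_iff.2 ⟨φ, rfl⟩ : (univ : Set M).Definable L {c | φ.Realize c})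
  have h1 : ∀ ω : KeislerMeasure L[[M]] M (α ⊕ β), ω φ = ω.restrict (N : Set M) ψ := fun ω =>
    ω.congr' _ _ fun c => by
      rw [realize_toGlobal]
      exact Set.ext_iff.1 hψ c
  have h2 := (h N hN (hμ.mono hAN) ψ).trans (h' N hN (hμ.mono hAN) ψ).symm
  change ((ω φ : ℝ≥0) : ℝ) = ((ω' φ : ℝ≥0) : ℝ)
  rw [h1 ω, h1 ω', ENNReal.coe_inj.1 h2]

variable {m : ℕ} {μ : KeislerMeasure L[[M]] M (Fin m)}

/-- The restriction of `μ ⊗ ν` to fewer variables on the right is a product. -/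
theorem prod_comapVar_map [Finite β] [Finite γ] (hM : IsMonster L M κ) (hNIP : IsNIP L M)
    (hA : #A < κ) (hμ : μ.IsInvariant A) (ν : KeislerMeasure L[[M]] M β) (g : γ → β) :
    (prod κ μ ν).comapVar (Sum.map id g) = prod κ μ (ν.comapVar g) := by
  refine IsProd.eq hM hA hμ (fun N hN hμN φ => ?_) (isProd_prod hM hNIP hA hμ _)
  obtain ⟨r, hr, hrF, hrT⟩ := exists_typeMap (L₁ := L[[(N : Set M)]]) (L₂ := L[[(N : Set M)]])
    (M := M) (fun φ : L[[(N : Set M)]].Formula γ => φ.relabel g) (fun c : β → M => c ∘ g)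
    fun φ c => Formula.realize_relabel
  have h1 : (ν.restrict (N : Set M)).borelMeasure.map r =
      ((ν.comapVar g).restrict (N : Set M)).borelMeasure := by
    refine map_borelMeasure hr hrF fun ψ => ?_
    refine ν.congr' _ _ fun c => ?_
    rw [Formula.realize_relabel, realize_toGlobal, realize_toGlobal, Formula.realize_relabel]
  rw [← h1, lintegral_map (hμN.measurable_schema hM hNIP hN φ) hr.measurable]
  have h2 : ((prod κ μ ν).comapVar (Sum.map id g)).restrict (N : Set M) φ =
      (prod κ μ ν).restrict (N : Set M) (φ.relabel (Sum.map id g)) := by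
    refine (prod κ μ ν).congr' _ _ fun c => ?_
    rw [Formula.realize_relabel, realize_toGlobal, realize_toGlobal, Formula.realize_relabel]
  rw [h2, isProd_prod hM hNIP hA hμ ν N hN hμN]
  refine lintegral_congr fun q => ?_
  obtain ⟨b, rfl⟩ := hM.typeOf_surjective hN q
  rw [hrT, hμN.schema_typeOf hM hN, hμN.schema_typeOf hM hN]
  congr 2
  ext a
  simp only [mem_fiber, mem_ofPred_eq, Formula.realize_relabel, Sum.elim_comp_map, Function.comp_id]

/-- The restriction of `μ ⊗ ν` to the variables on the right is `ν`. -/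
theorem prod_comapVar_inr [Finite β] (hM : IsMonster L M κ) (hNIP : IsNIP L M)
    (hA : #A < κ) (hμ : μ.IsInvariant A) (ν : KeislerMeasure L[[M]] M β) :
    (prod κ μ ν).comapVar Sum.inr = ν := by
  ext φ
  obtain ⟨N, hAN, hN, ψ, hψ⟩ := hM.exists_model_definable hA
    (definable_univ_iff.2 ⟨φ, rfl⟩ : (univ : Set M).Definable L {c | φ.Realize c})
  have hψ : ∀ c, φ.Realize c ↔ ψ.Realize c := fun c => Set.ext_iff.1 hψ c
  have hμN := hμ.mono hAN
  have h1 : (prod κ μ ν).comapVar Sum.inr φ =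
      (prod κ μ ν).restrict (N : Set M) (ψ.relabel Sum.inr) :=
    (prod κ μ ν).congr' _ _ fun c => by
      rw [realize_toGlobal, Formula.realize_relabel, Formula.realize_relabel, hψ]
  have h2 : ν φ = ν.restrict (N : Set M) ψ := ν.congr' _ _ fun c => by
    rw [realize_toGlobal, hψ]
  have h3 := isProd_prod hM hNIP hA hμ ν N hN hμN (ψ.relabel Sum.inr)
  have h4 : ∀ q, (schema (N : Set M) μ (ψ.relabel Sum.inr) q : ℝ≥0∞) =
      (clopen (L[[(N : Set M)]].completeTheory M) ψ).indicator 1 q := by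
    intro q
    obtain ⟨b, rfl⟩ := hM.typeOf_surjective hN q
    rw [hμN.schema_typeOf hM hN]
    have h5 := mem_clopen_typeOf (T := L[[(N : Set M)]].completeTheory M) ψ b
    by_cases hb : ψ.Realize b
    · rw [indicator_of_mem (h5.2 hb)]
      have : fiber {c : Fin m ⊕ β → M | (ψ.relabel Sum.inr).Realize c} b = univ := by
        ext a
        simp [Formula.realize_relabel, hb]
      rw [this, val_univ]
      rfl
    · rw [indicator_of_notMem fun h => hb (h5.1 h)]
      have : fiber {c : Fin m ⊕ β → M | (ψ.relabel Sum.inr).Realize c} b = ∅ := by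
        ext a
        simp [Formula.realize_relabel, hb]
      rw [this, val_empty]
      rfl
  simp only [h4] at h3
  rw [lintegral_indicator_one (isClopen_clopen ψ).isOpen.measurableSet, borelMeasure_clopen] at h3
  change (((prod κ μ ν).comapVar Sum.inr φ : ℝ≥0) : ℝ) = ((ν φ : ℝ≥0) : ℝ)
  rw [h1, h2, ENNReal.coe_inj.1 h3]

end KeislerMeasure

/-! ### Powers of an invariant measure -/

namespace KeislerMeasure

open Filter Topology

section Limits

variable {L : FirstOrder.Language.{u, v}} {M : Type w} [L.Structure M] {α ι : Type*}

/-- Pointwise limits of Keisler measures are Keisler measures. -/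
theorem exists_forall_tendsto {l : Filter ι} [l.NeBot] (f : ι → KeislerMeasure L M α)
    (hf : ∀ φ, ∃ r, Tendsto (fun k => f k φ) l (𝓝 r)) :
    ∃ ω : KeislerMeasure L M α, ∀ φ, Tendsto (fun k => f k φ) l (𝓝 (ω φ)) := by
  choose r hr using hf
  refine ⟨⟨r, ?_, fun φ ψ h => ?_, fun φ ψ h => ?_⟩, hr⟩
  · exact tendsto_nhds_unique (hr ⊤) (by simp only [map_top', tendsto_const_nhds])
  · refine tendsto_nhds_unique (hr φ) ?_
    simp only [fun k => (f k).congr' φ ψ h]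
    exact hr ψ
  · refine tendsto_nhds_unique (hr (φ ⊔ ψ)) ?_
    simp only [fun k => (f k).map_sup' φ ψ h]
    exact (hr φ).add (hr ψ)

/-- There is only one Keisler measure in no variables. -/
instance [IsEmpty α] : Subsingleton (KeislerMeasure L M α) := by
  refine ⟨fun μ ν => ?_⟩
  have h1 : ∀ (μ : KeislerMeasure L M α) (φ : L.Formula α),
      (∀ c : α → M, φ.Realize c) → μ φ = 1 := fun μ φ h => by
    rw [← μ.map_top']
    exact μ.congr' _ _ fun c => iff_of_true (h c) (BoundedFormula.realize_top.2 trivial)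
  have h0 : ∀ (μ : KeislerMeasure L M α) (φ : L.Formula α),
      (∀ c : α → M, ¬ φ.Realize c) → μ φ = 0 := fun μ φ h => by
    have h2 := μ.map_sup' ⊤ φ fun c hc => h c hc.2
    rw [h1 μ (⊤ ⊔ φ) fun c => BoundedFormula.realize_sup.2
      (Or.inl (BoundedFormula.realize_top.2 trivial)), μ.map_top'] at h2
    simpa using h2.symm
  ext φ
  by_cases h : φ.Realize (isEmptyElim : α → M)
  · have h' : ∀ c : α → M, φ.Realize c := fun c => by rwa [Subsingleton.elim c isEmptyElim]
    exact congrArg _ ((h1 μ φ h').trans (h1 ν φ h').symm)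
  · have h' : ∀ c : α → M, ¬ φ.Realize c := fun c => by rwa [Subsingleton.elim c isEmptyElim]
    exact congrArg _ ((h0 μ φ h').trans (h0 ν φ h').symm)

theorem comapVar_id (μ : KeislerMeasure L M α) : μ.comapVar id = μ := by
  ext φ
  exact congrArg _ (μ.congr' _ _ fun c => by rw [Formula.realize_relabel, Function.comp_id])

end Limits

section

variable {L : FirstOrder.Language.{u, v}} {M : Type w} [L.Structure M] {A : Set M}
  [Nonempty M] {κ : Cardinal.{w}} {m : ℕ} {μ : KeislerMeasure L[[M]] M (Fin m)}
  (hM : IsMonster L M κ) (hNIP : IsNIP L M) (hA : #A < κ) (hμ : μ.IsInvariant A)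

include hM hNIP hA hμ

theorem power_comapVar_castSucc (n : ℕ) :
    (power κ μ (n + 1)).comapVar (Prod.map Fin.castSucc id) = power κ μ n := by
  rw [power, comapVar_comapVar]
  convert prod_comapVar_inr hM hNIP hA hμ (power κ μ n) using 2
  ext p
  simp

theorem power_comapVar_castLE {n k : ℕ} (h : n ≤ k) :
    (power κ μ k).comapVar (Prod.map (Fin.castLE h) id) = power κ μ n := by
  induction k, h using Nat.le_induction with
  | base => exact comapVar_id _
  | succ k h ih =>
    rw [← ih, ← power_comapVar_castSucc hM hNIP hA hμ k, comapVar_comapVar]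
    rfl

theorem powerOmega_comapVar (n : ℕ) :
    (powerOmega κ μ).comapVar (fun p : Fin n × Fin m => ((p.1 : ℕ), p.2)) = power κ μ n := by
  refine Classical.epsilon_spec (p := fun ω : KeislerMeasure L[[M]] M (ℕ × Fin m) => ∀ n : ℕ,
    ω.comapVar (fun p : Fin n × Fin m => ((p.1 : ℕ), p.2)) = power κ μ n) ?_ n
  -- `μ⁽ω⁾` is the limit of the `μ⁽ᵏ⁺¹⁾`, with `xⱼ` for `j > k` identified with `xₖ`.
  let g : ∀ k : ℕ, ℕ × Fin m → Fin (k + 1) × Fin m := fun k p => (⟨min p.1 k, by omega⟩, p.2)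
  have hev : ∀ φ, ∃ r, ∀ᶠ k in atTop, (power κ μ (k + 1)).comapVar (g k) φ = r := fun φ => by
    let k₀ := φ.freeVarFinset.sup Prod.fst
    have hk₀ : ∀ p ∈ φ.freeVarFinset, p.1 ≤ k₀ := fun p hp => Finset.le_sup (f := Prod.fst) hp
    refine ⟨(power κ μ (k₀ + 1)).comapVar (g k₀) φ, ?_⟩
    filter_upwards [eventually_ge_atTop k₀] with k hk
    rw [← power_comapVar_castLE hM hNIP hA hμ (Nat.add_le_add_right hk 1), comapVar_comapVar]
    refine (power κ μ (k + 1)).congr' _ _ fun c => ?_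
    rw [Formula.realize_relabel, Formula.realize_relabel]
    refine realize_iff_of_eqOn_freeVar φ fun p hp => congrArg c ?_
    have := hk₀ p hp
    exact Prod.ext (Fin.ext (by simp [g, this, this.trans hk])) rfl
  obtain ⟨ω, hω⟩ := exists_forall_tendsto (l := atTop)
    (fun k => (power κ μ (k + 1)).comapVar (g k))
    fun φ => (hev φ).imp fun r hr => tendsto_nhds_of_eventually_eq hr
  refine ⟨ω, fun n => ?_⟩
  ext φ
  refine congrArg _ (tendsto_nhds_unique (hω (φ.relabel fun p : Fin n × Fin m => ((p.1 : ℕ), p.2)))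
    (tendsto_nhds_of_eventually_eq ?_))
  filter_upwards [eventually_ge_atTop n] with k hk
  change (((power κ μ (k + 1)).comapVar (g k)).comapVar
    (fun p : Fin n × Fin m => ((p.1 : ℕ), p.2))) φ = _
  rw [← power_comapVar_castLE hM hNIP hA hμ (hk.trans k.le_succ), comapVar_comapVar]
  congr 1
  have : g k ∘ (fun p : Fin n × Fin m => ((p.1 : ℕ), p.2)) =
      Prod.map (Fin.castLE (hk.trans k.le_succ)) id := by
    funext p
    exact Prod.ext (Fin.ext (min_eq_left (p.1.2.le.trans hk))) rfl
  rw [this]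

/-! ### Amalgamating powers along a product -/

/-- For an invariant measure `μ(x)` and a measure `ω(y)`, there is a measure in the variables
`x₀, …, xₖ₋₁, y` whose restriction to `x₀, …, xₖ₋₁` is `μ⁽ᵏ⁾` and whose restriction to each
`xᵢ, y` is `μ ⊗ ω`: the product `μ(xₖ₋₁) ⊗ (⋯ ⊗ (μ(x₀) ⊗ ω(y)))`. -/
theorem exists_comapVar_eq_power_and_prod {γ : Type*} [Finite γ] (ω : KeislerMeasure L[[M]] M γ)
    (k : ℕ) : ∃ Θ : KeislerMeasure L[[M]] M ((Fin k × Fin m) ⊕ γ),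
      Θ.comapVar Sum.inr = ω ∧ Θ.comapVar Sum.inl = power κ μ k ∧
      ∀ i : Fin k, Θ.comapVar (Sum.map (fun a => (i, a)) id) = prod κ μ ω := by
  induction k with
  | zero =>
    refine ⟨ω.comapVar (Sum.elim (fun p => p.1.elim0) id), ?_, Subsingleton.elim _ _,
      fun i => i.elim0⟩
    rw [comapVar_comapVar, Sum.elim_comp_inr, comapVar_id]
  | succ k ih =>
    obtain ⟨Θ, h1, h2, h3⟩ := ih
    refine ⟨(prod κ μ Θ).comapVar (Sum.elim
      (fun p => Fin.lastCases (motive := fun _ => Fin m ⊕ ((Fin k × Fin m) ⊕ γ)) (Sum.inl p.2)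
        (fun i => Sum.inr (Sum.inl (i, p.2))) p.1) (Sum.inr ∘ Sum.inr)), ?_, ?_, ?_⟩
    · rw [comapVar_comapVar, Sum.elim_comp_inr, ← comapVar_comapVar,
        prod_comapVar_inr hM hNIP hA hμ, h1]
    · rw [comapVar_comapVar, Sum.elim_comp_inl, power, ← h2,
        ← prod_comapVar_map hM hNIP hA hμ, comapVar_comapVar]
      congr 1
      funext ⟨i, a⟩
      induction i using Fin.lastCases <;> simp
    · intro i
      rw [comapVar_comapVar]
      induction i using Fin.lastCases with
      | last =>
        conv_rhs => rw [← h1, ← prod_comapVar_map hM hNIP hA hμ]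
        congr 1
        funext x
        rcases x with a | c <;> simp
      | cast i =>
        conv_rhs => rw [← h3 i, ← prod_comapVar_inr hM hNIP hA hμ Θ, comapVar_comapVar]
        congr 1
        funext x
        rcases x with a | c <;> simp

end

variable {L : FirstOrder.Language.{u, v}} {M : Type w} [L.Structure M] {A : Set M}
  [Nonempty M] {κ : Cardinal.{w}}

/-- For invariant measures `μ₁, …, μₙ`, there is a measure in the variables `yᵢ^α`, for `i < k` and
`α = 1, …, n`, whose restriction to `y₀^α, …, yₖ₋₁^α` is the power of `μ_α` for each `α`, and whose
restriction to `y_{i(1)}^1, …, y_{i(n)}^n` is `μ₁ ⊗ ⋯ ⊗ μₙ` for each choice of the `i(α)`. -/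
theorem exists_comapVar_eq_power_and_prodFin (hM : IsMonster L M κ) (hNIP : IsNIP L M)
    (hA : #A < κ) (k : ℕ) : ∀ (n : ℕ) (m : Fin n → ℕ)
      (μ : ∀ α, KeislerMeasure L[[M]] M (Fin (m α))), (∀ α, (μ α).IsInvariant A) →
      ∃ Ω : KeislerMeasure L[[M]] M (Σ α : Fin n, Fin k × Fin (m α)),
        (∀ α, Ω.comapVar (fun p => ⟨α, p⟩) = power κ (μ α) k) ∧
        ∀ i : Fin n → Fin k,
          Ω.comapVar (fun p : Σ α, Fin (m α) => ⟨p.1, (i p.1, p.2)⟩) = prodFin κ n m μ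
  | 0, _, _, _ =>
    ⟨dirac L[[M]] fun p => p.1.elim0, fun α => α.elim0, fun _ => Subsingleton.elim _ _⟩
  | n + 1, m, μ, hμ => by
    obtain ⟨Ω, h1, h2⟩ := exists_comapVar_eq_power_and_prodFin hM hNIP hA k n (fun α => m α.succ)
      (fun α => μ α.succ) fun α => hμ α.succ
    obtain ⟨Θ, h3, h4, h5⟩ := exists_comapVar_eq_power_and_prod hM hNIP hA (hμ 0) Ω k
    refine ⟨Θ.comapVar fun p => Fin.cases
      (motive := fun α => Fin k × Fin (m α) →
        (Fin k × Fin (m 0)) ⊕ (Σ α : Fin n, Fin k × Fin (m α.succ)))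
      Sum.inl (fun α q => Sum.inr ⟨α, q⟩) p.1 p.2, fun α => ?_, fun i => ?_⟩
    · rw [comapVar_comapVar]
      induction α using Fin.cases with
      | zero => exact h4
      | succ α =>
        rw [← h1 α, ← h3, comapVar_comapVar]
        rfl
    · rw [comapVar_comapVar, prodFin, ← h2 fun α => i α.succ,
        ← prod_comapVar_map hM hNIP hA (hμ 0), ← h5 (i 0), comapVar_comapVar, comapVar_comapVar]
      congr 1
      funext ⟨α, a⟩
      induction α using Fin.cases <;> rfl

end KeislerMeasure

/-! ### Joint measures and their generic types -/

namespace KeislerMeasure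

open Filter Topology

section

variable {L : FirstOrder.Language.{u, v}} {M : Type w} [L.Structure M] {A : Set M}
  [Nonempty M] {κ : Cardinal.{w}}

theorem apply_le_one {α : Type*} (μ : KeislerMeasure L M α) (φ : L.Formula α) : μ φ ≤ 1 :=
  (μ.mono fun _ _ => BoundedFormula.realize_top.2 trivial).trans_eq μ.map_top'

/-- For invariant measures `μ₁, …, μₙ`, there is a measure in the variables `yᵢ^α`, for `i < ω` and
`α = 1, …, n`, whose restriction to `y₀^α, y₁^α, …` is `μ_α⁽ω⁾` for each `α`, and whose
restriction to `y_{i(1)}^1, …, y_{i(n)}^n` is `μ₁ ⊗ ⋯ ⊗ μₙ` for each choice of the `i(α)`. -/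
theorem exists_comapVar_eq_powerOmega_and_prodFin (hM : IsMonster L M κ) (hNIP : IsNIP L M)
    (hA : #A < κ) {n : ℕ} {m : Fin n → ℕ} (μ : ∀ α, KeislerMeasure L[[M]] M (Fin (m α)))
    (hμ : ∀ α, (μ α).IsInvariant A) :
    ∃ Ω : KeislerMeasure L[[M]] M (Σ α : Fin n, ℕ × Fin (m α)),
      (∀ α, Ω.comapVar (fun p => ⟨α, p⟩) = powerOmega κ (μ α)) ∧
      ∀ i : Fin n → ℕ,
        Ω.comapVar (fun p : Σ α, Fin (m α) => ⟨p.1, (i p.1, p.2)⟩) = prodFin κ n m μ := by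
  choose Ω h1 h2 using fun k => exists_comapVar_eq_power_and_prodFin hM hNIP hA (k + 1) n m μ hμ
  -- A limit of the measures for finitely many `yᵢ^α`, with `yᵢ^α` for `i > k` identified
  -- with `yₖ^α`.
  let f : ∀ k : ℕ, ℕ → Fin (k + 1) := fun k i => ⟨min i k, by omega⟩
  let y : ∀ k, (Σ α : Fin n, ℕ × Fin (m α)) → Σ α : Fin n, Fin (k + 1) × Fin (m α) :=
    fun k p => ⟨p.1, (f k p.2.1, p.2.2)⟩
  obtain ⟨ω, hω⟩ := exists_forall_tendsto (l := (hyperfilter ℕ : Filter ℕ))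
    (fun k => (Ω k).comapVar (y k)) fun φ => by
      obtain ⟨r, -, hr⟩ := (isCompact_Icc (a := (0 : ℝ≥0)) (b := 1)).ultrafilter_le_nhds
        ((hyperfilter ℕ).map fun k => (Ω k).comapVar (y k) φ)
        (le_principal_iff.2 (mem_map.2 (Eventually.of_forall fun k => ⟨zero_le, apply_le_one _ _⟩)))
      exact ⟨r, hr⟩
  refine ⟨ω, fun α => ?_, fun i => ?_⟩
  · ext φ
    refine congrArg _ (tendsto_nhds_unique (hω (φ.relabel fun p => ⟨α, p⟩))
      (tendsto_nhds_of_eventually_eq (Filter.Eventually.filter_mono Nat.hyperfilter_le_atTop ?_)))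
    filter_upwards [eventually_ge_atTop (φ.freeVarFinset.sup Prod.fst)] with k hk
    have h3 : ((Ω k).comapVar (y k)).comapVar (fun p => ⟨α, p⟩) =
        (powerOmega κ (μ α)).comapVar fun p => ((f k p.1 : ℕ), p.2) := by
      rw [comapVar_comapVar]
      change (Ω k).comapVar ((fun p => ⟨α, p⟩) ∘ fun p : ℕ × Fin (m α) => (f k p.1, p.2)) = _
      rw [← comapVar_comapVar, h1, ← powerOmega_comapVar hM hNIP hA (hμ α), comapVar_comapVar]
      rfl
    refine (congrArg (fun ν => ν φ) h3).trans ((powerOmega κ (μ α)).congr' _ _ fun c => ?_)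
    rw [Formula.realize_relabel]
    refine realize_iff_of_eqOn_freeVar φ fun p hp => congrArg c ?_
    exact Prod.ext (min_eq_left ((Finset.le_sup (f := Prod.fst) hp).trans hk)) rfl
  · ext φ
    refine congrArg _ (tendsto_nhds_unique (hω (φ.relabel _))
      (tendsto_nhds_of_eventually_eq (Eventually.of_forall fun k => ?_)))
    have h3 : ((Ω k).comapVar (y k)).comapVar (fun p : Σ α, Fin (m α) => ⟨p.1, (i p.1, p.2)⟩) =
        prodFin κ n m μ := by
      rw [comapVar_comapVar, ← h2 k fun α => f k (i α)]
      rfl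
    exact congrArg (fun ν => ν φ) h3

/-- Almost all types, for the Borel measure of a Keisler measure, contain no null formula. -/
theorem ae_forall_notMem_clopen {α : Type*} (μ : KeislerMeasure L M α) :
    ∀ᵐ p ∂μ.borelMeasure, ∀ φ, μ φ = 0 → p ∉ clopen (L.completeTheory M) φ := by
  have hU : IsOpen (⋃ φ : {φ // μ φ = 0}, clopen (L.completeTheory M) φ.1) :=
    isOpen_iUnion fun φ => (isClopen_clopen φ.1).isOpen
  have h0 : μ.borelMeasure (⋃ φ : {φ // μ φ = 0}, clopen (L.completeTheory M) φ.1) = 0 := by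
    by_contra h
    obtain ⟨K, hKU, hK, hK0⟩ := hU.exists_lt_isCompact (pos_iff_ne_zero.2 h)
    refine hK0.ne' (hK.measure_zero_of_nhdsWithin fun p hp => ?_)
    obtain ⟨φ, hφ⟩ := mem_iUnion.1 (hKU hp)
    refine ⟨_, mem_nhdsWithin_of_mem_nhds ((isClopen_clopen φ.1).isOpen.mem_nhds hφ), ?_⟩
    rw [borelMeasure_clopen, φ.2, ENNReal.coe_zero]
  rw [measure_eq_zero_iff_ae_notMem] at h0
  filter_upwards [h0] with p hp φ hφ h
  exact hp (mem_iUnion.2 ⟨⟨φ, hφ⟩, h⟩)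

end

end KeislerMeasure

end Keisler

theorem proposition3p8 {L : FirstOrder.Language.{u, v}} {M : Type w} [L.Structure M]
    [Nonempty M] {κ : Cardinal.{w}} (hM : Keisler.IsMonster L M κ) (hNIP : Keisler.IsNIP L M)
    (M₀ : L.ElementarySubstructure M) (hM₀ : Cardinal.mk M₀ < κ)
    {n : ℕ} {m : Fin n → ℕ} (μ : ∀ α : Fin n, Keisler.KeislerMeasure L[[M]] M (Fin (m α)))
    (hμ : ∀ α, (μ α).IsInvariant (M₀ : Set M))
    (B : Set ((L[[(M₀ : Set M)]].completeTheory M).CompleteType (Σ α, Fin (m α))))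
    (hB : MeasurableSet B)
    (hB1 : ((Keisler.KeislerMeasure.prodFin κ n m μ).restrict (M₀ : Set M)).borelMeasure B = 1) :
    ∃ b : ∀ α : Fin n, ℕ → Fin (m α) → M,
      (∀ α, (((μ α).powerOmega κ).restrict (M₀ : Set M)).IsWeaklyRandom
        fun p : ℕ × Fin (m α) => b α p.1 p.2) ∧
      ∀ i : Fin n → ℕ,
        (L[[(M₀ : Set M)]].completeTheory M).typeOf
          (fun p : Σ α, Fin (m α) => b p.1 (i p.1) p.2) ∈ B := by
  obtain ⟨Ω, h1, h2⟩ :=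
    Keisler.KeislerMeasure.exists_comapVar_eq_powerOmega_and_prodFin hM hNIP hM₀ μ hμ
  -- The restriction maps from types of the whole array to types of the transversals of the array.
  choose r hr hrF hrT using fun i : Fin n → ℕ =>
    Keisler.exists_typeMap (L₁ := L[[(M₀ : Set M)]]) (L₂ := L[[(M₀ : Set M)]]) (M := M)
      (fun φ : L[[(M₀ : Set M)]].Formula (Σ α, Fin (m α)) =>
        φ.relabel fun p => (⟨p.1, (i p.1, p.2)⟩ : Σ α : Fin n, ℕ × Fin (m α)))
      (fun c => c ∘ fun p => ⟨p.1, (i p.1, p.2)⟩) fun φ c => Formula.realize_relabel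
  have hΩr : ∀ i, (Ω.restrict (M₀ : Set M)).borelMeasure.map (r i) =
      ((Keisler.KeislerMeasure.prodFin κ n m μ).restrict (M₀ : Set M)).borelMeasure := fun i =>
    Keisler.map_borelMeasure (hr i) (hrF i) fun φ => by
      rw [← h2 i]
      refine Ω.congr' _ _ fun c => ?_
      rw [Formula.realize_relabel, Keisler.KeislerMeasure.realize_toGlobal,
        Keisler.KeislerMeasure.realize_toGlobal, Formula.realize_relabel]
  have hae : ∀ᵐ p ∂(Ω.restrict (M₀ : Set M)).borelMeasure, ∀ i, r i p ∈ B := by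
    refine ae_all_iff.2 fun i => ?_
    refine (mem_ae_iff_prob_eq_one ((hr i).measurable hB)).2 ?_
    rw [← Measure.map_apply (hr i).measurable hB, hΩr, hB1]
  -- A type with all transversals in `B` and without null formulas.
  obtain ⟨p, hp1, hp2⟩ :=
    (hae.and (Keisler.KeislerMeasure.ae_forall_notMem_clopen (Ω.restrict (M₀ : Set M)))).exists
  obtain ⟨c, rfl⟩ := hM.typeOf_surjective hM₀ p
  refine ⟨fun α i a => c ⟨α, (i, a)⟩, fun α φ hφ hc => ?_, fun i => ?_⟩
  · refine hp2 (φ.relabel fun p => ⟨α, p⟩) ?_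
      ((Keisler.KeislerMeasure.mem_clopen_typeOf _ _).2 (Formula.realize_relabel.2 hc))
    rw [← hφ, ← h1 α]
    refine Ω.congr' _ _ fun c => ?_
    rw [Formula.realize_relabel, Keisler.KeislerMeasure.realize_toGlobal,
      Keisler.KeislerMeasure.realize_toGlobal, Formula.realize_relabel]
  · have h := hp1 i
    rw [hrT] at h
    exact h
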